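/- Let $\Omega=\mathbb R\times(0,1)$, $\nu>0$, $s>0$, and $\langle t\rangle=\max\{1,t\}$. Norms are taken over $\Omega$, with $\|f\|_{W^{m,p}}=\|f\|_{L^p}+\sum_{|\alpha|=m}\|\partial^\alpha f\|_{L^p}$ and $H^m=W^{m,2}$. Let $\mathfrak D^{m,1}$ be the set of $f\in W^{m,1}(\Omega)$ such that $\partial_2^n f=0$ on $\partial\Omega$, in the sense of traces, for every even $n$ with $0\le n<m$. For $f\in L^2(\Omega)$ let $(-\Delta)^{-1}f$ be the unique $\psi\in H^2\cap H^1_0(\Omega)$ with $-\Delta\psi=f$. Let $\phi_0\in\mathfrak D^{8,1}$, $\phi_1\in\mathfrak D^{6,1}$, and let $F\in L^\infty(0,\infty;\mathfrak D^{6,1})$ with $\|\langle\cdot\rangle^sF\|_{L^\infty(W^{6,1})}<\infty$, where $$\|\langle\cdot\rangle^sF\|_{L^\infty(W^{m,1})}:=\operatorname*{ess\,sup}_{t>0}\ \langle t\rangle^s\|F(t)\|_{W^{m,1}}.$$ Let $\phi$ be the solution of $$\partial_{tt}\phi-\nu\Delta\partial_t\phi-\partial_1(-\Delta)^{-1}\partial_1\phi=F\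 \text{ in }\Omega\times(0,\infty),\qquad \phi|_{t=0}=\phi_0,\quad \partial_t\phi|_{t=0}=\phi_1,\quad \phi|_{\partial\Omega}=0,$$ that is, $\phi\in C^1([0,\infty);L^2(\Omega))$ with $\phi(t)\in H^2\cap H^1_0(\Omega)$ for all $t\ge0$, and the equation holds in the weak sense: tested with any $\eta\in C_c^\infty(\Omega)$ and integrated over any time interval $(0,t)$. Then there is a constant $C$ depending only on $\nu$ and $s$ such that the following holds for all $t>0$, where $$A_m:=\|\phi_0\|_{W^{m+2,1}}+\|\phi_1\|_{W^{m,1}}+\|\langle\cdot\rangle^sF\|_{L^\infty(W^{m,1})}.$$ If $s>1$, then $\phi(t)\in H^4$ and $$\|\phi(t)\|_{L^\infty}\le C\langle t\rangle^{-1/2}A_4,\qquad \|\partial_2\phi(t)\|_{L^\infty}\le C\langle t\rangle^{-1/2}A_5,\qquad \|\partial_1\phi(t)\|_{L^\infty}\le C\langle t\rangle^{-1}A_6,$$ $$\|\phi(t)\|_{H^4}\le C\langle t\rangle^{-1/4}A_6,\qquad \|\partial_1\phi(t)\|_{H^2}\le C\langle t\rangle^{-3/4}A_6.$$ If $s\ge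 5/4$, then moreover $\partial_t\phi(t)\in H^3$ and $$\|\partial_{11}\phi(t)\|_{L^2}\le C\langle t\rangle^{-5/4}A_6,\qquad \|\partial_t\phi(t)\|_{H^3}\le C\langle t\rangle^{-5/4}A_6.$$ -/

import Mathlib

open MeasureTheory Set Filter Topology
open scoped ENNReal NNReal ContDiff

noncomputable section

namespace Strip

/-- The infinite flat strip `Ω = ℝ × (0, 1)`. -/
def Ω : Set (ℝ × ℝ) := univ ×ˢ Ioo (0 : ℝ) 1

/-- Lebesgue measure on the strip. -/
def μ : Measure (ℝ × ℝ) := volume.restrict Ω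

/-- Classical partial derivative `∂₁` (horizontal direction). -/
def d1 (η : ℝ × ℝ → ℝ) : ℝ × ℝ → ℝ := fun z => fderiv ℝ η z (1, 0)

/-- Classical partial derivative `∂₂` (vertical direction). -/
def d2 (η : ℝ × ℝ → ℝ) : ℝ × ℝ → ℝ := fun z => fderiv ℝ η z (0, 1)

/-- Test functions on the strip: the class `C_c^∞(Ω)`. -/
structure IsTest (η : ℝ × ℝ → ℝ) : Prop where
  smooth : ContDiff ℝ ∞ η
  compact : HasCompactSupport η
  support : tsupport η ⊆ Ω

/-- `g` is the weak derivative `∂₁^i ∂₂^j f` on the strip. -/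
structure IsWeakDeriv (i j : ℕ) (f g : ℝ × ℝ → ℝ) : Prop where
  locInt : LocallyIntegrableOn f Ω volume
  locInt_deriv : LocallyIntegrableOn g Ω volume
  integral_eq : ∀ η : ℝ × ℝ → ℝ, IsTest η →
    ∫ z, f z * (d1^[i] (d2^[j] η)) z ∂μ = (-1) ^ (i + j) * ∫ z, g z * η z ∂μ

open Classical in
/-- The weak derivative `∂₁^i ∂₂^j f` on the strip, which is unique up to null sets (and `0` by
convention if it does not exist). -/
def weakDeriv (i j : ℕ) (f : ℝ × ℝ → ℝ) : ℝ × ℝ → ℝ :=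
  if h : ∃ g, IsWeakDeriv i j f g then h.choose else 0

/-- The Sobolev space `W^{m,p}(Ω)`: all weak derivatives up to order `m` exist and are in `L^p`. -/
def MemW (m : ℕ) (p : ℝ≥0∞) (f : ℝ × ℝ → ℝ) : Prop :=
  MemLp f p μ ∧ ∀ i j : ℕ, i + j ≤ m → ∃ g, IsWeakDeriv i j f g ∧ MemLp g p μ

/-- The norm of `W^{m,p}(Ω)`, namely the `L^p` norm plus the `L^p` norms of all derivatives of
order exactly `m`. -/
def normW (m : ℕ) (p : ℝ≥0∞) (f : ℝ × ℝ → ℝ) : ℝ≥0∞ :=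
  eLpNorm f p μ + ∑ a ∈ Finset.HasAntidiagonal.antidiagonal m, eLpNorm (weakDeriv a.1 a.2 f) p μ

/-- The space `W_0^{1,p}(Ω)`, the closure of `C_c^∞(Ω)` in `W^{1,p}(Ω)`. For `p < ∞` these are the
functions in `W^{1,p}(Ω)` whose trace on `∂Ω` vanishes. -/
def MemW0 (p : ℝ≥0∞) (f : ℝ × ℝ → ℝ) : Prop :=
  MemW 1 p f ∧ ∃ u : ℕ → ℝ × ℝ → ℝ, (∀ n, IsTest (u n)) ∧
    Tendsto (fun n => eLpNorm (fun z => u n z - f z) p μ) atTop (𝓝 0) ∧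
    Tendsto (fun n => eLpNorm (fun z => d1 (u n) z - weakDeriv 1 0 f z) p μ) atTop (𝓝 0) ∧
    Tendsto (fun n => eLpNorm (fun z => d2 (u n) z - weakDeriv 0 1 f z) p μ) atTop (𝓝 0)

/-- The space `𝔇^{m,p}` of all `f` in `W^{m,p}(Ω)` with `∂₂^n f = 0` on `∂Ω` (in the sense of
traces) for `n = 0, 2, …, 2[(m-1)/2]`, that is, for all even `n < m`. -/
def MemD (m : ℕ) (p : ℝ≥0∞) (f : ℝ × ℝ → ℝ) : Prop :=
  MemW m p f ∧ ∀ n : ℕ, Even n → n < m → MemW0 p (weakDeriv 0 n f)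

/-- The weak Laplacian. -/
def lap (f : ℝ × ℝ → ℝ) : ℝ × ℝ → ℝ := fun z => weakDeriv 2 0 f z + weakDeriv 0 2 f z

/-- `ψ = (-Δ)⁻¹ f`: `ψ` is the solution in `H² ∩ H_0^1` of the Dirichlet problem `-Δψ = f` in `Ω`,
`ψ = 0` on `∂Ω`. -/
structure IsInvNegLap (f ψ : ℝ × ℝ → ℝ) : Prop where
  memH2 : MemW 2 2 ψ
  memH10 : MemW0 2 ψ
  eq : ∀ᵐ z ∂μ, -lap ψ z = f z

/-- The time derivative of a curve `[0, ∞) → L²(Ω)` (one-sided at time `0`). -/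
def dt (φ : ℝ → Lp ℝ 2 μ) (t : ℝ) : Lp ℝ 2 μ := derivWithin φ (Ici 0) t

/-- `φ` solves `∂ₜₜφ - νΔ∂ₜφ - ∂₁(-Δ)⁻¹∂₁φ = F` in `Ω × (0, ∞)` with `φ = φ₀`, `∂ₜφ = φ₁` at time
`0` and `φ = 0` on `∂Ω`. Here `φ` is a `C¹` curve in `L²(Ω)` with values in `H² ∩ H_0^1`, and the
equation is understood in the weak sense: it is tested with `η ∈ C_c^∞(Ω)` and integrated over
the time interval `(0, t)`. -/
structure IsSolution (ν : ℝ) (φ₀ φ₁ : ℝ × ℝ → ℝ) (F : ℝ → Lp ℝ 1 μ) (φ : ℝ → Lp ℝ 2 μ) :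
    Prop where
  contDiff : ContDiffOn ℝ 1 φ (Ici 0)
  memH2 : ∀ t, 0 ≤ t → MemW 2 2 (φ t)
  boundary : ∀ t, 0 ≤ t → MemW0 2 (φ t)
  init : φ 0 =ᵐ[μ] φ₀
  init_dt : dt φ 0 =ᵐ[μ] φ₁
  equation : ∃ ψ : ℝ → ℝ × ℝ → ℝ,
    (∀ t, 0 ≤ t → IsInvNegLap (weakDeriv 1 0 (φ t)) (ψ t)) ∧
    ∀ η : ℝ × ℝ → ℝ, IsTest η → ∀ t, 0 ≤ t →
      (∫ z, dt φ t z * η z ∂μ) - (∫ z, dt φ 0 z * η z ∂μ)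
        - ν * ((∫ z, lap (φ t) z * η z ∂μ) - ∫ z, lap (φ 0) z * η z ∂μ)
        - (∫ τ in (0 : ℝ)..t, ∫ z, weakDeriv 1 0 (ψ τ) z * η z ∂μ)
      = ∫ τ in (0 : ℝ)..t, ∫ z, F τ z * η z ∂μ

/-- `⟨t⟩ = max {1, t}`. -/
def bracket (t : ℝ) : ℝ := max 1 t

/-- The decay factor `⟨t⟩^r`, as an extended nonnegative number. -/
def rate (t r : ℝ) : ℝ≥0∞ := ENNReal.ofReal (bracket t ^ r)

/-- The norm `‖⟨·⟩^s F(·)‖_{L^∞(W^{m,1})}` over times `t > 0`. -/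
def normF (s : ℝ) (m : ℕ) (F : ℝ → Lp ℝ 1 μ) : ℝ≥0∞ :=
  essSup (fun t => rate t s * normW m 1 (F t)) (volume.restrict (Ioi 0))

end Strip

end

open scoped RealInnerProductSpace FourierTransform

noncomputable section

namespace Strip

/-! ### Test functions and weak derivatives -/

/-! The modes cos(κx + θ) sin(kπy) diagonalise the problem. With L² = κ² + (kπ)², the amplitude of a
mode obeys a damped oscillator equation y'' + a y' + b y = f, where a = νL² and b = κ²/L². The
friction a is at least ν, but the stiffness b degenerates as κ → 0, and a Lyapunov functional gives
a factor exp(-cκ²t/L⁴) (`IsOscillation.lyapunov`, `oscillator_bound`). The algebraic rates come from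
integrating this factor over small κ: |κ|^i yields t^(-(i+1)/2) in an L¹ setting in frequency, and
|κ|^e yields t^(-(2e+1)/4) in an L² setting. In the time derivative the slow part carries the
additional factor κ²/L⁶ (`IsOscillation.deriv_bound`), which accounts for the rate 5/4.

The powers of L lost in this way are paid for by the regularity of the data. The boundary conditions
in 𝔇^{m,1} are those under which m integrations by parts against sin(kπy) leave no boundary terms,
so the coefficients of the data are O(L^(-m)) (`ell_pow_mul_coeff_le`).

The solution is only known to lie in L², so its amplitudes have no meaning at a single κ. They are
replaced by pairings with wave packets, that is, waves with a cutoff of width N. Such a pairing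
satisfies the oscillator equation up to a force of size O(N^(-1/2)) (`IsSolution.packet_equation`),
and the data see the pure wave up to a tail that vanishes as N → ∞ (`IsSolution.packet_bound`). The
error, which grows at most like (1 + |κ|)², is carried along until the packets are integrated
against the rapidly decaying Fourier transform of a test function; only then N → ∞
(`ofReal_abs_integral_mul_prod_le`).

The way back to physical space is duality. A test function is expanded in a sine series in y and a
Fourier integral in x. Bounding its transform by its L¹ norm controls the solution in L^∞
(`IsKernel.exists_dualSum_le_integral`). Cauchy-Schwarz with Plancherel and Parseval controls it in
L² (`IsKernel.exists_dualSum_le_eLpNorm`), and the same estimate yields the existence of the higher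
weak derivatives through the Riesz representation (`weakDeriv_of_forall_test`).

The force enters through Duhamel's formula. Convolution in time with ⟨τ⟩^(-s), s > 1, preserves each
rate ⟨t⟩^(-r) with r ≤ s (`exists_convolution_bound`); this is where s > 1 and, for the rate 5/4, s
≥ 5/4 are needed. -/

theorem isOpen_Ω : IsOpen Ω := isOpen_univ.prod isOpen_Ioo

theorem measurableSet_Ω : MeasurableSet Ω := isOpen_Ω.measurableSet

theorem mem_Ω {z : ℝ × ℝ} : z ∈ Ω ↔ 0 < z.2 ∧ z.2 < 1 := by
  simp [Ω]

theorem ae_mem_Ω : ∀ᵐ z ∂μ, z ∈ Ω := ae_restrict_mem measurableSet_Ω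

instance : IsLocallyFiniteMeasure μ := by unfold μ; infer_instance

instance : SigmaFinite μ := by unfold μ; infer_instance

theorem tsupport_fderiv_apply_subset' (η : ℝ × ℝ → ℝ) (v : ℝ × ℝ) :
    tsupport (fun z => fderiv ℝ η z v) ⊆ tsupport η :=
  tsupport_fderiv_apply_subset ℝ v

namespace IsTest

variable {η ζ : ℝ × ℝ → ℝ}

theorem of_fderiv (h : IsTest η) (v : ℝ × ℝ) : IsTest (fun z => fderiv ℝ η z v) where
  smooth := (h.smooth.fderiv_right (m := ∞) (by simp)).clm_apply contDiff_const
  compact := h.compact.mono' <|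
    subset_trans subset_closure (tsupport_fderiv_apply_subset' η v)
  support := (tsupport_fderiv_apply_subset' η v).trans h.support

theorem d1 (h : IsTest η) : IsTest (d1 η) := h.of_fderiv _

theorem d2 (h : IsTest η) : IsTest (d2 η) := h.of_fderiv _

theorem d1_iterate (h : IsTest η) (i : ℕ) : IsTest (Strip.d1^[i] η) := by
  induction i with
  | zero => exact h
  | succ n ih => rw [Function.iterate_succ_apply']; exact ih.d1

theorem d2_iterate (h : IsTest η) (i : ℕ) : IsTest (Strip.d2^[i] η) := by
  induction i with
  | zero => exact h
  | succ n ih => rw [Function.iterate_succ_apply']; exact ih.d2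

theorem partials (h : IsTest η) (i j : ℕ) : IsTest (Strip.d1^[i] (Strip.d2^[j] η)) :=
  (h.d2_iterate j).d1_iterate i

theorem continuous (h : IsTest η) : Continuous η := h.smooth.continuous

theorem differentiable (h : IsTest η) : Differentiable ℝ η :=
  h.smooth.differentiable (by simp)

theorem add (h : IsTest η) (k : IsTest ζ) : IsTest (fun z => η z + ζ z) where
  smooth := h.smooth.add k.smooth
  compact := h.compact.add k.compact
  support := (tsupport_add η ζ).trans (union_subset h.support k.support)

theorem const_mul (h : IsTest η) (c : ℝ) : IsTest (fun z => c * η z) where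
  smooth := contDiff_const.mul h.smooth
  compact := h.compact.mul_left
  support := (tsupport_mul_subset_right (f := fun _ => c)).trans h.support

theorem mul_smooth (h : IsTest η) (hζ : ContDiff ℝ ∞ ζ) : IsTest (fun z => η z * ζ z) where
  smooth := h.smooth.mul hζ
  compact := h.compact.mul_right
  support := (tsupport_mul_subset_left (f := η)).trans h.support

theorem eq_zero (h : IsTest η) {z : ℝ × ℝ} (hz : z ∉ Ω) : η z = 0 :=
  image_eq_zero_of_notMem_tsupport fun h' => hz (h.support h')

theorem integrable (h : IsTest η) : Integrable η volume :=
  h.continuous.integrable_of_hasCompactSupport h.compact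

theorem memLp (h : IsTest η) (p : ℝ≥0∞) : MemLp η p μ :=
  (h.continuous.memLp_of_hasCompactSupport h.compact).restrict _

theorem exists_bound (h : IsTest η) : ∃ C, ∀ z, |η z| ≤ C := by
  obtain ⟨C, hC⟩ := h.compact.exists_bound_of_continuous h.continuous
  exact ⟨C, hC⟩

theorem integrable_mul (h : IsTest η) {f : ℝ × ℝ → ℝ} (hf : LocallyIntegrableOn f Ω volume) :
    Integrable (fun z => f z * η z) μ := by
  obtain ⟨C, hC⟩ := h.exists_bound
  have h1 : IntegrableOn f (tsupport η) volume :=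
    hf.integrableOn_compact_subset h.support h.compact
  have h2 : IntegrableOn (fun z => f z * η z) (tsupport η) volume :=
    h1.mul_bdd h.continuous.aestronglyMeasurable (ae_of_all _ hC)
  have h3 : Integrable (fun z => f z * η z) volume := by
    rw [← integrableOn_iff_integrable_of_support_subset (s := tsupport η)]
    · exact h2
    · intro z hz
      exact subset_tsupport η (fun h0 => hz (by simp [h0]))
  exact h3.restrict

theorem integral_eq_volume (h : IsTest η) (f : ℝ × ℝ → ℝ) :
    ∫ z, f z * η z ∂μ = ∫ z, f z * η z := by
  refine setIntegral_eq_integral_of_forall_compl_eq_zero fun z hz => ?_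
  rw [h.eq_zero hz, mul_zero]

end IsTest

theorem d1_add {η ζ : ℝ × ℝ → ℝ} (h : IsTest η) (k : IsTest ζ) :
    d1 (fun z => η z + ζ z) = fun z => d1 η z + d1 ζ z := by
  ext z
  simp only [d1]
  rw [fderiv_fun_add (h.differentiable z) (k.differentiable z)]
  rfl

theorem d2_add {η ζ : ℝ × ℝ → ℝ} (h : IsTest η) (k : IsTest ζ) :
    d2 (fun z => η z + ζ z) = fun z => d2 η z + d2 ζ z := by
  ext z
  simp only [d2]
  rw [fderiv_fun_add (h.differentiable z) (k.differentiable z)]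
  rfl

theorem d1_const_mul {η : ℝ × ℝ → ℝ} (h : IsTest η) (c : ℝ) :
    d1 (fun z => c * η z) = fun z => c * d1 η z := by
  ext z
  simp only [d1]
  rw [fderiv_const_mul (h.differentiable z)]
  rfl

theorem d2_const_mul {η : ℝ × ℝ → ℝ} (h : IsTest η) (c : ℝ) :
    d2 (fun z => c * η z) = fun z => c * d2 η z := by
  ext z
  simp only [d2]
  rw [fderiv_const_mul (h.differentiable z)]
  rfl

theorem partials_add {η ζ : ℝ × ℝ → ℝ} (h : IsTest η) (k : IsTest ζ) (i j : ℕ) :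
    d1^[i] (d2^[j] fun z => η z + ζ z)
      = fun z => d1^[i] (d2^[j] η) z + d1^[i] (d2^[j] ζ) z := by
  have h2 : ∀ j, d2^[j] (fun z => η z + ζ z) = fun z => d2^[j] η z + d2^[j] ζ z := by
    intro j
    induction j with
    | zero => rfl
    | succ n ih =>
      simp only [Function.iterate_succ_apply', ih]
      exact d2_add (h.d2_iterate n) (k.d2_iterate n)
  rw [h2]
  induction i with
  | zero => rfl
  | succ n ih =>
    simp only [Function.iterate_succ_apply', ih]
    exact d1_add (h.partials n j) (k.partials n j)

theorem partials_const_mul {η : ℝ × ℝ → ℝ} (h : IsTest η) (c : ℝ) (i j : ℕ) :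
    d1^[i] (d2^[j] fun z => c * η z) = fun z => c * d1^[i] (d2^[j] η) z := by
  have h2 : ∀ j, d2^[j] (fun z => c * η z) = fun z => c * d2^[j] η z := by
    intro j
    induction j with
    | zero => rfl
    | succ n ih =>
      simp only [Function.iterate_succ_apply', ih]
      exact d2_const_mul (h.d2_iterate n) c
  rw [h2]
  induction i with
  | zero => rfl
  | succ n ih =>
    simp only [Function.iterate_succ_apply', ih]
    exact d1_const_mul (h.partials n j) c

/-- The fundamental lemma of the calculus of variations on the strip. -/
theorem ae_eq_of_forall_test {f g : ℝ × ℝ → ℝ} (hf : LocallyIntegrableOn f Ω volume)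
    (hg : LocallyIntegrableOn g Ω volume)
    (h : ∀ η, IsTest η → ∫ z, f z * η z ∂μ = ∫ z, g z * η z ∂μ) : f =ᵐ[μ] g := by
  have key := isOpen_Ω.ae_eq_zero_of_integral_contDiff_smul_eq_zero (μ := volume)
    (f := fun z => f z - g z) (hf.sub hg) fun η h1 h2 h3 => ?_
  · rw [Filter.EventuallyEq, μ, ae_restrict_iff' measurableSet_Ω]
    filter_upwards [key] with z hz hzΩ
    linarith [hz hzΩ]
  · have ht : IsTest η := ⟨h1, h2, h3⟩
    have e : ∀ z, η z • (f z - g z) = (f z - g z) * η z := fun z => by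
      rw [smul_eq_mul, mul_comm]
    simp_rw [e]
    rw [← ht.integral_eq_volume (fun z => f z - g z)]
    simp_rw [sub_mul]
    rw [integral_sub (ht.integrable_mul hf) (ht.integrable_mul hg), h η ht, sub_self]

theorem IsWeakDeriv.ae_eq {i j : ℕ} {f g g' : ℝ × ℝ → ℝ} (h : IsWeakDeriv i j f g)
    (h' : IsWeakDeriv i j f g') : g =ᵐ[μ] g' := by
  refine ae_eq_of_forall_test h.locInt_deriv h'.locInt_deriv fun η hη => ?_
  have := (h.integral_eq η hη).symm.trans (h'.integral_eq η hη)
  exact mul_left_cancel₀ (pow_ne_zero _ (by norm_num)) this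

theorem IsWeakDeriv.weakDeriv {i j : ℕ} {f g : ℝ × ℝ → ℝ} (h : IsWeakDeriv i j f g) :
    IsWeakDeriv i j f (weakDeriv i j f) := by
  have h' : ∃ g, IsWeakDeriv i j f g := ⟨g, h⟩
  rw [Strip.weakDeriv, dif_pos h']
  exact h'.choose_spec

theorem IsWeakDeriv.weakDeriv_ae_eq {i j : ℕ} {f g : ℝ × ℝ → ℝ} (h : IsWeakDeriv i j f g) :
    Strip.weakDeriv i j f =ᵐ[μ] g := h.weakDeriv.ae_eq h

theorem LocallyIntegrableOn.of_memLp {f : ℝ × ℝ → ℝ} {p : ℝ≥0∞} (hp : 1 ≤ p)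
    (hf : MemLp f p μ) : LocallyIntegrableOn f Ω volume := by
  have := hf.locallyIntegrable hp
  exact locallyIntegrableOn_of_locallyIntegrable_restrict this

/-- Weak derivatives compose as long as the commutation of `∂₁` and `∂₂` is not involved. -/
theorem IsWeakDeriv.of_comp_d1 {i j k : ℕ} {f g h : ℝ × ℝ → ℝ} (hg : IsWeakDeriv k 0 f g)
    (hh : IsWeakDeriv (k + i) j f h) : IsWeakDeriv i j g h where
  locInt := hg.locInt_deriv
  locInt_deriv := hh.locInt_deriv
  integral_eq η hη := by
    have h1 := hg.integral_eq _ (hη.partials i j)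
    have h2 := hh.integral_eq η hη
    rw [Function.iterate_add_apply] at h2
    simp only [Function.iterate_zero, id_eq, add_zero] at h1
    rw [h2, add_assoc, pow_add (-1 : ℝ) k (i + j), mul_assoc] at h1
    exact (mul_left_cancel₀ (pow_ne_zero _ (by norm_num)) h1).symm

theorem IsWeakDeriv.of_comp_d2 {j k : ℕ} {f g h : ℝ × ℝ → ℝ} (hg : IsWeakDeriv 0 k f g)
    (hh : IsWeakDeriv 0 (k + j) f h) : IsWeakDeriv 0 j g h where
  locInt := hg.locInt_deriv
  locInt_deriv := hh.locInt_deriv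
  integral_eq η hη := by
    have h1 := hg.integral_eq _ (hη.d2_iterate j)
    have h2 := hh.integral_eq η hη
    rw [Function.iterate_add_apply] at h2
    simp only [Function.iterate_zero, id_eq, zero_add] at h1 h2 ⊢
    rw [h2, pow_add (-1 : ℝ) k j, mul_assoc] at h1
    exact (mul_left_cancel₀ (pow_ne_zero _ (by norm_num)) h1).symm

theorem MemW.isWeakDeriv {m : ℕ} {p : ℝ≥0∞} {f : ℝ × ℝ → ℝ} (h : MemW m p f) {i j : ℕ}
    (hij : i + j ≤ m) : IsWeakDeriv i j f (weakDeriv i j f) := by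
  obtain ⟨g, hg, -⟩ := h.2 i j hij
  exact hg.weakDeriv

theorem MemW.memLp {m : ℕ} {p : ℝ≥0∞} {f : ℝ × ℝ → ℝ} (h : MemW m p f) {i j : ℕ}
    (hij : i + j ≤ m) : MemLp (weakDeriv i j f) p μ := by
  obtain ⟨g, hg, hgp⟩ := h.2 i j hij
  exact (memLp_congr_ae hg.weakDeriv_ae_eq).2 hgp

/-- A function whose pairings with test functions are controlled by the `L¹` norm is bounded. -/
theorem eLpNorm_top_le_of_forall_test {f : ℝ × ℝ → ℝ} (hf : MemLp f 2 μ)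
    {M : ℝ} (h : ∀ η, IsTest η → |∫ z, f z * η z ∂μ| ≤ M * ∫ z, |η z| ∂μ) :
    eLpNorm f ⊤ μ ≤ ENNReal.ofReal M := by
  have hg : LocallyIntegrable (Ω.indicator f) volume :=
    ((memLp_indicator_iff_restrict measurableSet_Ω).2 hf).locallyIntegrable one_le_two
  -- Shrinking mollifiers: almost every value of f is the limit of its pairings with mollifiers
  -- centred there, and these are test functions of L¹ norm one once their radius is below the
  -- distance to the boundary.
  let φ : ℕ → ContDiffBump (0 : ℝ × ℝ) := fun n =>
    ⟨1 / ((n : ℝ) + 1), 2 * (1 / ((n : ℝ) + 1)), by positivity, by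
      have : 0 < 1 / ((n : ℝ) + 1) := by positivity
      linarith⟩
  have hφ : Tendsto (fun n => (φ n).rOut) atTop (𝓝 0) := by
    simpa [φ] using (tendsto_one_div_add_atTop_nhds_zero_nat (𝕜 := ℝ)).const_mul 2
  have key := ContDiffBump.ae_convolution_tendsto_right_of_locallyIntegrable (K := 2) hφ
    (Eventually.of_forall fun n => le_rfl) hg
  have bound : ∀ᵐ z ∂μ, ‖f z‖ ≤ M := by
    rw [μ, ae_restrict_iff' measurableSet_Ω]
    filter_upwards [key] with x hx hxΩ
    rw [indicator_of_mem hxΩ] at hx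
    obtain ⟨r, hr, hball⟩ := Metric.nhds_basis_closedBall.mem_iff.1 (isOpen_Ω.mem_nhds hxΩ)
    refine le_of_tendsto hx.norm ?_
    filter_upwards [hφ.eventually (gt_mem_nhds hr)] with n hn
    have hsm : ContDiff ℝ ∞ (fun z => (φ n).normed volume (x - z)) :=
      (φ n).contDiff_normed.comp (contDiff_const.sub contDiff_id)
    have hts : tsupport (fun z => (φ n).normed volume (x - z))
        ⊆ Metric.closedBall x (φ n).rOut := by
      refine closure_minimal (fun z hz => ?_) Metric.isClosed_closedBall
      have : x - z ∈ Function.support ((φ n).normed volume) := hz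
      rw [ContDiffBump.support_normed_eq, mem_ball_zero_iff] at this
      rw [Metric.mem_closedBall, dist_comm, dist_eq_norm]
      exact this.le
    have ht : IsTest (fun z => (φ n).normed volume (x - z)) :=
      ⟨hsm, HasCompactSupport.of_support_subset_isCompact (isCompact_closedBall x (φ n).rOut)
        (subset_closure.trans hts),
        hts.trans ((Metric.closedBall_subset_closedBall hn.le).trans hball)⟩
    have e1 : MeasureTheory.convolution ((φ n).normed volume) (Ω.indicator f)
        (ContinuousLinearMap.lsmul ℝ ℝ) volume x
        = ∫ z, f z * (φ n).normed volume (x - z) ∂μ := by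
      rw [convolution_eq_swap, μ, ← integral_indicator measurableSet_Ω]
      congr 1
      ext z
      by_cases hz : z ∈ Ω
      · simp [hz, mul_comm]
      · simp [hz]
    have e2 : ∫ z, |(φ n).normed volume (x - z)| ∂μ = 1 := by
      rw [μ, setIntegral_eq_integral_of_forall_compl_eq_zero
        (fun z hz => by rw [ht.eq_zero hz, abs_zero])]
      simp_rw [abs_of_nonneg ((φ n).nonneg_normed _)]
      rw [integral_sub_left_eq_self (fun z => (φ n).normed volume z) volume x]
      exact (φ n).integral_normed
    rw [e1, Real.norm_eq_abs]
    simpa [e2] using h _ ht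
  rw [eLpNorm_exponent_top]
  refine essSup_le_of_ae_le _ ?_
  filter_upwards [bound] with z hz
  rw [← ofReal_norm]
  exact ENNReal.ofReal_le_ofReal hz

/-- The subspace of `L²` spanned by the test functions. -/
def testSubmodule : Submodule ℝ (Lp ℝ 2 μ) where
  carrier := {u | ∃ η, IsTest η ∧ u =ᵐ[μ] η}
  add_mem' := by
    rintro u v ⟨η, hη, hu⟩ ⟨ζ, hζ, hv⟩
    refine ⟨_, hη.add hζ, ?_⟩
    filter_upwards [hu, hv, Lp.coeFn_add u v] with z h1 h2 h3
    rw [h3, Pi.add_apply, h1, h2]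
  zero_mem' := by
    refine ⟨fun _ => 0, ⟨contDiff_const, HasCompactSupport.zero, by simp [tsupport]⟩, ?_⟩
    exact Lp.coeFn_zero _ _ _
  smul_mem' := by
    rintro c u ⟨η, hη, hu⟩
    refine ⟨_, hη.const_mul c, ?_⟩
    filter_upwards [hu, Lp.coeFn_smul c u] with z h1 h2
    rw [h2, Pi.smul_apply, h1, smul_eq_mul]

/-- A distributional derivative that is bounded on test functions with the `L²` norm is
a weak derivative in `L²`. -/
theorem weakDeriv_of_forall_test {f : ℝ × ℝ → ℝ} (hf : LocallyIntegrableOn f Ω volume)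
    {i j : ℕ} {M : ℝ} (hM : 0 ≤ M)
    (h : ∀ η, IsTest η → |∫ z, f z * (d1^[i] (d2^[j] η)) z ∂μ| ≤ M * (eLpNorm η 2 μ).toReal) :
    (∃ g, IsWeakDeriv i j f g ∧ MemLp g 2 μ) ∧
      eLpNorm (weakDeriv i j f) 2 μ ≤ ENNReal.ofReal M := by
  set T : (ℝ × ℝ → ℝ) → ℝ := fun η => ∫ z, f z * (d1^[i] (d2^[j] η)) z ∂μ with hT
  have T_add : ∀ {η ζ}, IsTest η → IsTest ζ → T (fun z => η z + ζ z) = T η + T ζ := by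
    intro η ζ hη hζ
    simp only [hT, partials_add hη hζ, mul_add]
    exact integral_add ((hη.partials i j).integrable_mul hf) ((hζ.partials i j).integrable_mul hf)
  have T_mul : ∀ {η} (c : ℝ), IsTest η → T (fun z => c * η z) = c * T η := by
    intro η c hη
    simp only [hT, partials_const_mul hη, ← integral_const_mul]
    congr 1
    ext z
    ring
  -- The functional depends only on the almost everywhere class of the test function, so the
  -- arbitrary representatives chosen below still give a linear map.
  have T_congr : ∀ {η ζ}, IsTest η → IsTest ζ → η =ᵐ[μ] ζ → T η = T ζ := by
    intro η ζ hη hζ he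
    have h1 := h _ (hη.add (hζ.const_mul (-1)))
    have h2 : eLpNorm (fun z => η z + -1 * ζ z) 2 μ = 0 := by
      rw [eLpNorm_eq_zero_iff (hη.add (hζ.const_mul (-1))).continuous.aestronglyMeasurable
        (by norm_num)]
      filter_upwards [he] with z hz
      simp [hz]
    have h3 : T (fun z => η z + -1 * ζ z) = T η + -1 * T ζ := by
      rw [T_add hη (hζ.const_mul (-1)), T_mul _ hζ]
    rw [h2, ENNReal.toReal_zero, mul_zero] at h1
    have h4 : T (fun z => η z + -1 * ζ z) = 0 := abs_nonpos_iff.1 h1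
    linarith
  have spec : ∀ u : testSubmodule, ∃ η, IsTest η ∧ (u : Lp ℝ 2 μ) =ᵐ[μ] η := fun u => u.2
  choose e he hue using spec
  let L : testSubmodule →ₗ[ℝ] ℝ :=
    { toFun := fun u => T (e u)
      map_add' := fun u v => by
        rw [← T_add (he u) (he v)]
        refine T_congr (he _) ((he u).add (he v)) ?_
        filter_upwards [hue u, hue v, hue (u + v), Lp.coeFn_add (u : Lp ℝ 2 μ) v]
          with z h1 h2 h3 h4
        rw [← h3, ← h1, ← h2]
        exact h4
      map_smul' := fun c u => by
        rw [RingHom.id_apply, smul_eq_mul, ← T_mul c (he u)]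
        refine T_congr (he _) ((he u).const_mul c) ?_
        filter_upwards [hue u, hue (c • u), Lp.coeFn_smul c (u : Lp ℝ 2 μ)] with z h1 h2 h3
        rw [← h2, ← h1]
        exact h3 }
  have L_bound : ∀ u, ‖L u‖ ≤ M * ‖u‖ := by
    intro u
    have h1 := h _ (he u)
    rwa [← eLpNorm_congr_ae (hue u), ← Lp.norm_def] at h1
  -- Hahn-Banach extends the functional from test functions to L² with the same norm, so their
  -- density is not needed; the Riesz representative is the weak derivative up to sign.
  obtain ⟨g, hg, hgn⟩ := exists_extension_norm_eq testSubmodule (L.mkContinuous M L_bound)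
  have hgM : ‖g‖ ≤ M := hgn.le.trans (L.mkContinuous_norm_le hM L_bound)
  let w : Lp ℝ 2 μ := (InnerProductSpace.toDual ℝ (Lp ℝ 2 μ)).symm g
  have hw : ‖w‖ ≤ M := by simpa [w] using hgM
  have hwη : ∀ η, IsTest η → ∫ z, w z * η z ∂μ = T η := by
    intro η hη
    have hmem : (hη.memLp 2).toLp η ∈ testSubmodule := ⟨η, hη, MemLp.coeFn_toLp _⟩
    have h1 : g ((hη.memLp 2).toLp η) = T η := by
      rw [hg ⟨_, hmem⟩]
      exact T_congr (he _) hη ((hue _).symm.trans (MemLp.coeFn_toLp (hη.memLp 2)))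
    rw [← h1, ← InnerProductSpace.toDual_symm_apply (𝕜 := ℝ), L2.inner_def]
    refine integral_congr_ae ?_
    filter_upwards [MemLp.coeFn_toLp (hη.memLp 2)] with z hz
    rw [hz]
    simp [w, mul_comm]
  have hwd : IsWeakDeriv i j f (fun z => (-1) ^ (i + j) * w z) := by
    refine ⟨hf, LocallyIntegrableOn.of_memLp one_le_two ((Lp.memLp w).const_mul _), ?_⟩
    intro η hη
    simp_rw [mul_assoc]
    rw [integral_const_mul, hwη η hη, ← mul_assoc, ← mul_pow]
    simp [hT]
  have hmem : MemLp (fun z => (-1) ^ (i + j) * w z) 2 μ := (Lp.memLp w).const_mul _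
  refine ⟨⟨_, hwd, hmem⟩, ?_⟩
  rw [eLpNorm_congr_ae hwd.weakDeriv_ae_eq]
  have e1 : eLpNorm (fun z => (-1) ^ (i + j) * w z) 2 μ = eLpNorm w 2 μ := by
    refine eLpNorm_congr_norm_ae (ae_of_all _ fun z => ?_)
    simp
  rw [e1, ← Lp.enorm_def, ← ofReal_norm]
  exact ENNReal.ofReal_le_ofReal hw

/-! ### The damped oscillator -/

/-- `q` solves the damped oscillator equation with damping `a` and stiffness `b`, and `q₁` is its
derivative. -/
structure IsOscillation (a b : ℝ) (q q₁ : ℝ → ℝ) : Prop where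
  hasDeriv : ∀ t, HasDerivAt q (q₁ t) t
  hasDeriv₁ : ∀ t, HasDerivAt q₁ (-a * q₁ t - b * q t) t

/-- The fundamental solution is read off from the exponential of the companion matrix, which avoids
a case distinction between real and complex characteristic roots. -/
theorem exists_isOscillation (a b : ℝ) :
    ∃ q q₁ : ℝ → ℝ, IsOscillation a b q q₁ ∧ q 0 = 0 ∧ q₁ 0 = 1 := by
  let G : ℝ × ℝ →L[ℝ] ℝ × ℝ := (ContinuousLinearMap.snd ℝ ℝ ℝ).prod
    (-a • ContinuousLinearMap.snd ℝ ℝ ℝ - b • ContinuousLinearMap.fst ℝ ℝ ℝ)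
  have h1 : ∀ t : ℝ, HasDerivAt (fun u : ℝ => NormedSpace.exp (u • G) ((0 : ℝ), (1 : ℝ)))
      (G (NormedSpace.exp (t • G) ((0 : ℝ), (1 : ℝ)))) t := by
    intro t
    have := (hasDerivAt_exp_smul_const' (𝕂 := ℝ) G t).clm_apply
      (hasDerivAt_const t ((0 : ℝ), (1 : ℝ)))
    simpa using this
  refine ⟨fun t => (NormedSpace.exp (t • G) ((0 : ℝ), (1 : ℝ))).1,
    fun t => (NormedSpace.exp (t • G) ((0 : ℝ), (1 : ℝ))).2, ⟨fun t => ?_, fun t => ?_⟩, ?_, ?_⟩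
  · exact (h1 t).fst
  · exact (ContinuousLinearMap.snd ℝ ℝ ℝ).hasFDerivAt.comp_hasDerivAt t (h1 t)
  · simp
  · simp

namespace IsOscillation

variable {a b : ℝ} {q q₁ : ℝ → ℝ}

/-- This lets `duhamel` be applied with q₁ in place of q, which turns the formula for y into one for
its derivative. -/
theorem derivative (h : IsOscillation a b q q₁) :
    IsOscillation a b q₁ (fun t => -a * q₁ t - b * q t) :=
  ⟨h.hasDeriv₁, fun t => ((h.hasDeriv₁ t).const_mul (-a)).sub ((h.hasDeriv t).const_mul b)⟩

theorem continuous (h : IsOscillation a b q q₁) : Continuous q :=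
  continuous_iff_continuousAt.2 fun t => (h.hasDeriv t).continuousAt

theorem continuous₁ (h : IsOscillation a b q q₁) : Continuous q₁ :=
  continuous_iff_continuousAt.2 fun t => (h.hasDeriv₁ t).continuousAt

/-- The Lyapunov functional of the damped oscillator decays with rate `2 c b / a`. -/
theorem lyapunov (h : IsOscillation a b q q₁) {c : ℝ} (ha : 0 < a) (hb : 0 ≤ b) (hc : 0 ≤ c)
    (h1 : 2 * c * (a ^ 2 + b) ≤ a ^ 2) (h2 : 3 * c * b ≤ a ^ 2) {t : ℝ} (ht : 0 ≤ t) :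
    (q₁ t + a * q t) ^ 2 / 2 + q₁ t ^ 2 / 2 + b * q t ^ 2 ≤
      ((q₁ 0 + a * q 0) ^ 2 / 2 + q₁ 0 ^ 2 / 2 + b * q 0 ^ 2) *
        Real.exp (-(2 * (c * b / a) * t)) := by
  set α := c * b / a with hα
  let L : ℝ → ℝ := fun t => (q₁ t + a * q t) ^ 2 / 2 + q₁ t ^ 2 / 2 + b * q t ^ 2
  -- Since (q₁ + a q)' = -b q, the mixed terms -b q q₁ from the two squares cancel against the
  -- derivative of b q².
  have hL : ∀ t, HasDerivAt L (-(a * b * q t ^ 2) - a * q₁ t ^ 2) t := by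
    intro t
    have d := (((((h.hasDeriv₁ t).add ((h.hasDeriv t).const_mul a)).pow 2).div_const 2).add
      (((h.hasDeriv₁ t).pow 2).div_const 2)).add (((h.hasDeriv t).pow 2).const_mul b)
    refine d.congr_deriv ?_
    simp
    ring
  have hLα : ∀ t, -(a * b * q t ^ 2) - a * q₁ t ^ 2 + 2 * α * L t ≤ 0 := by
    intro t
    have e1 : L t ≤ (a ^ 2 + b) * q t ^ 2 + 3 / 2 * q₁ t ^ 2 := by
      simp only [L]
      nlinarith [sq_nonneg (q₁ t - a * q t)]
    have hα0 : 0 ≤ α := by positivity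
    have e2 : 2 * α * (a ^ 2 + b) ≤ a * b := by
      have : 2 * α * (a ^ 2 + b) = (2 * c * (a ^ 2 + b)) * (b / a) := by rw [hα]; ring
      rw [this]
      calc _ ≤ a ^ 2 * (b / a) := by gcongr
        _ = a * b := by field_simp
    have e3 : 3 * α ≤ a := by
      rw [hα, ← mul_div_assoc, div_le_iff₀ ha]
      nlinarith
    have e4 : 2 * α * L t ≤ 2 * α * ((a ^ 2 + b) * q t ^ 2 + 3 / 2 * q₁ t ^ 2) := by gcongr
    have e5 : 2 * α * (a ^ 2 + b) * q t ^ 2 ≤ a * b * q t ^ 2 := by gcongr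
    have e6 : 3 * α * q₁ t ^ 2 ≤ a * q₁ t ^ 2 := by gcongr
    nlinarith
  have hmono : Antitone fun t => L t * Real.exp (2 * α * t) := by
    have hd : ∀ t, HasDerivAt (fun t => L t * Real.exp (2 * α * t))
        ((-(a * b * q t ^ 2) - a * q₁ t ^ 2 + 2 * α * L t) * Real.exp (2 * α * t)) t := by
      intro t
      have e := ((hasDerivAt_id t).const_mul (2 * α)).exp
      refine ((hL t).mul e).congr_deriv ?_
      simp
      ring
    refine antitone_of_deriv_nonpos (fun t => (hd t).differentiableAt) fun t => ?_
    rw [(hd t).deriv]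
    exact mul_nonpos_of_nonpos_of_nonneg (hLα t) (Real.exp_pos _).le
  have := hmono ht
  simp only [mul_zero, Real.exp_zero, mul_one] at this
  rw [Real.exp_neg, ← div_eq_mul_inv, le_div_iff₀ (Real.exp_pos _)]
  exact this

/-- Bounds for the fundamental solution. -/
theorem bounds (h : IsOscillation a b q q₁) (q0 : q 0 = 0) (q10 : q₁ 0 = 1) {c : ℝ} (ha : 0 < a)
    (hb : 0 ≤ b) (hc : 0 ≤ c) (h1 : 2 * c * (a ^ 2 + b) ≤ a ^ 2) (h2 : 3 * c * b ≤ a ^ 2)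
    {t : ℝ} (ht : 0 ≤ t) :
    |q t| ≤ 2 / a * Real.exp (-(c * b / a * t)) ∧
      |q₁ t + a * q t| ≤ 2 * Real.exp (-(c * b / a * t)) := by
  have key := h.lyapunov ha hb hc h1 h2 ht
  set e := Real.exp (-(c * b / a * t)) with he
  have he2 : Real.exp (-(2 * (c * b / a) * t)) = e ^ 2 := by
    rw [he, ← Real.exp_nat_mul]
    congr 1
    push_cast
    ring
  have he0 : 0 < e := Real.exp_pos _
  -- With these initial values the functional equals 1 at time 0.
  rw [he2, q0, q10] at key
  have hbq : 0 ≤ b * q t ^ 2 := by positivity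
  have k1 : (a * q t) ^ 2 ≤ (2 * e) ^ 2 := by
    nlinarith [sq_nonneg (q₁ t + (q₁ t + a * q t))]
  have k2 : (q₁ t + a * q t) ^ 2 ≤ (2 * e) ^ 2 := by
    nlinarith [sq_nonneg (q₁ t)]
  refine ⟨?_, abs_le_of_sq_le_sq k2 (by positivity)⟩
  have := abs_le_of_sq_le_sq k1 (by positivity)
  rw [abs_mul, abs_of_pos ha] at this
  rw [div_mul_eq_mul_div, le_div_iff₀ ha]
  linarith

/-- The Lyapunov functional alone would give q₁ the same slow decay as a q. Integrating (exp(a t)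
q₁)' = -b exp(a t) q with the known bound for q separates a fast part exp(-a t) from a slow part
that carries the small factor b/a². -/
theorem deriv_bound (h : IsOscillation a b q q₁) (q0 : q 0 = 0) (q10 : q₁ 0 = 1) {c : ℝ}
    (ha : 0 < a) (hb : 0 ≤ b) (hc : 0 ≤ c) (h1 : 2 * c * (a ^ 2 + b) ≤ a ^ 2)
    (h2 : 3 * c * b ≤ a ^ 2) {t : ℝ} (ht : 0 ≤ t) :
    |q₁ t| ≤ Real.exp (-(a * t)) + 4 * b / a ^ 2 * Real.exp (-(c * b / a * t)) := by
  set α := c * b / a with hα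
  have hαa : 2 * α ≤ a := by
    rw [hα, ← mul_div_assoc, div_le_iff₀ ha]
    nlinarith [mul_nonneg hc hb]
  have hd : ∀ t, HasDerivAt (fun t => Real.exp (a * t) * q₁ t)
      (-(b * Real.exp (a * t) * q t)) t := by
    intro t
    have e := ((hasDerivAt_id t).const_mul a).exp
    refine (e.mul (h.hasDeriv₁ t)).congr_deriv ?_
    simp
    ring
  -- The factor 4 is chosen so that, by a - α ≥ a/2, the derivative of this majorant dominates b
  -- exp(a t) · (2/a) exp(-α t).
  have hu : ∀ t, HasDerivAt (fun t => 4 * b / a ^ 2 * Real.exp ((a - α) * t))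
      (4 * b / a ^ 2 * (a - α) * Real.exp ((a - α) * t)) t := by
    intro t
    have e := (((hasDerivAt_id t).const_mul (a - α)).exp).const_mul (4 * b / a ^ 2)
    refine e.congr_deriv ?_
    simp
    ring
  have comp : ∀ t, 0 ≤ t → |b * Real.exp (a * t) * q t| ≤
      4 * b / a ^ 2 * (a - α) * Real.exp ((a - α) * t) := by
    intro t ht
    have hq := (h.bounds q0 q10 ha hb hc h1 h2 ht).1
    have e1 : Real.exp ((a - α) * t) = Real.exp (a * t) * Real.exp (-(α * t)) := by
      rw [← Real.exp_add]
      congr 1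
      ring
    rw [abs_mul, abs_of_nonneg (by positivity), e1]
    calc b * Real.exp (a * t) * |q t|
        ≤ b * Real.exp (a * t) * (2 / a * Real.exp (-(α * t))) := by gcongr
      _ = 4 * b / a ^ 2 * (a / 2) * (Real.exp (a * t) * Real.exp (-(α * t))) := by
        field_simp
        ring
      _ ≤ _ := by
        gcongr
        linarith
  -- Monotonicity for both signs σ = ±1 is a comparison argument: the majorant grows faster than
  -- exp(a t) q₁ moves in either direction.
  have mono : ∀ σ : ℝ, |σ| = 1 → MonotoneOn
      (fun t => 4 * b / a ^ 2 * Real.exp ((a - α) * t) - σ * (Real.exp (a * t) * q₁ t))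
      (Ici 0) := by
    intro σ hσ
    have hd' := fun t => (hu t).sub ((hd t).const_mul σ)
    refine monotoneOn_of_deriv_nonneg (convex_Ici 0)
      (fun t _ => (hd' t).continuousAt.continuousWithinAt)
      (fun t _ => (hd' t).differentiableAt.differentiableWithinAt) fun t ht => ?_
    rw [interior_Ici, mem_Ioi] at ht
    have e0 := (hd' t).deriv
    simp only [Pi.sub_def] at e0
    rw [e0]
    have e1 := comp t ht.le
    have e2 : |σ * (b * Real.exp (a * t) * q t)| = |b * Real.exp (a * t) * q t| := by
      rw [abs_mul, hσ, one_mul]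
    have e3 := neg_abs_le (σ * (b * Real.exp (a * t) * q t))
    linarith
  have m1 := mono 1 (by simp) self_mem_Ici ht ht
  have m2 := mono (-1) (by simp) self_mem_Ici ht ht
  simp only [mul_zero, Real.exp_zero, mul_one, q10] at m1 m2
  have hb2 : 0 ≤ 4 * b / a ^ 2 := by positivity
  have key : |Real.exp (a * t) * q₁ t| ≤ 1 + 4 * b / a ^ 2 * Real.exp ((a - α) * t) := by
    rw [abs_le]
    constructor <;> linarith
  rw [abs_mul, abs_of_pos (Real.exp_pos _)] at key
  have e1 : Real.exp ((a - α) * t) = Real.exp (a * t) * Real.exp (-(α * t)) := by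
    rw [← Real.exp_add]
    congr 1
    ring
  have e2 : Real.exp (a * t) * Real.exp (-(a * t)) = 1 := by
    rw [← Real.exp_add]
    simp
  refine le_of_mul_le_mul_left ?_ (Real.exp_pos (a * t))
  rw [mul_add, e2]
  rw [e1] at key
  linarith

/-- Duhamel's formula for the damped oscillator in integrated form. -/
theorem duhamel (h : IsOscillation a b q q₁) {y w f : ℝ → ℝ} {t : ℝ} (ht : 0 ≤ t)
    (hy : ∀ τ ∈ Icc 0 t, HasDerivWithinAt y (w τ) (Icc 0 t) τ) (hw : ContinuousOn w (Icc 0 t))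
    (hf : IntervalIntegrable f volume 0 t)
    (heq : ∀ τ ∈ Icc 0 t, w τ + a * y τ = w 0 + a * y 0 + ∫ σ in (0 : ℝ)..τ, (f σ - b * y σ)) :
    q 0 * (w t + a * y t) + q₁ 0 * y t = q t * (w 0 + a * y 0) + q₁ t * y 0
      + ∫ τ in (0 : ℝ)..t, q (t - τ) * f τ := by
  have hu : uIcc 0 t = Icc 0 t := uIcc_of_le ht
  have hyc : ContinuousOn y (Icc 0 t) := fun τ hτ => (hy τ hτ).continuousWithinAt
  have hby : IntervalIntegrable (fun σ => b * y σ) volume 0 t :=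
    ContinuousOn.intervalIntegrable (by rw [hu]; exact continuousOn_const.mul hyc)
  have hI : IntervalIntegrable (fun σ => f σ - b * y σ) volume 0 t := hf.sub hby
  have hrev : ∀ τ, HasDerivAt (fun τ => t - τ) (-1) τ := fun τ => by
    simpa using (hasDerivAt_id τ).const_sub t
  have hq : ∀ τ, HasDerivAt (fun τ => q (t - τ)) (-q₁ (t - τ)) τ := fun τ =>
    ((h.hasDeriv (t - τ)).comp τ (hrev τ)).congr_deriv (by ring)
  have hq₁ : ∀ τ, HasDerivAt (fun τ => q₁ (t - τ)) (a * q₁ (t - τ) + b * q (t - τ)) τ :=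
    fun τ => by
      have := (h.hasDeriv₁ (t - τ)).comp τ (hrev τ)
      refine this.congr_deriv ?_
      ring
  have hqc : Continuous fun τ => q (t - τ) := h.continuous.comp (by fun_prop)
  have hq₁c : Continuous fun τ => q₁ (t - τ) := h.continuous₁.comp (by fun_prop)
  -- The force is only integrable in time, so w + a y is merely absolutely continuous, and
  -- integration by parts is used in that class.
  have acq : AbsolutelyContinuousOnInterval (fun τ => q (t - τ)) 0 t := by
    refine ContDiffOn.absolutelyContinuousOnInterval (ContDiff.contDiffOn ?_)
    rw [contDiff_one_iff_deriv]
    refine ⟨fun τ => (hq τ).differentiableAt, ?_⟩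
    have : deriv (fun τ => q (t - τ)) = fun τ => -q₁ (t - τ) := funext fun τ => (hq τ).deriv
    rw [this]
    exact hq₁c.neg
  have ibp := acq.integral_mul_deriv_eq_deriv_mul
    (hI.absolutelyContinuousOnInterval_intervalIntegral (c := 0) left_mem_uIcc)
  have e1 : ∫ τ in (0 : ℝ)..t, q (t - τ) * deriv (fun x => ∫ σ in (0 : ℝ)..x, (f σ - b * y σ)) τ
      = ∫ τ in (0 : ℝ)..t, q (t - τ) * (f τ - b * y τ) := by
    refine intervalIntegral.integral_congr_ae ?_
    filter_upwards [hI.ae_hasDerivAt_integral] with τ hτ hτ'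
    rw [(hτ (uIoc_subset_uIcc hτ') 0 left_mem_uIcc).deriv]
  have e2 : ∫ τ in (0 : ℝ)..t, deriv (fun τ => q (t - τ)) τ * ∫ σ in (0 : ℝ)..τ, (f σ - b * y σ)
      = ∫ τ in (0 : ℝ)..t, (-q₁ (t - τ)) * (w τ + a * y τ - (w 0 + a * y 0)) := by
    refine intervalIntegral.integral_congr fun τ hτ => ?_
    rw [hu] at hτ
    rw [(hq τ).deriv, heq τ hτ]
    ring
  rw [e1, e2] at ibp
  have hwu : ContinuousOn w (uIcc 0 t) := by rwa [hu]
  have hyu : ContinuousOn y (uIcc 0 t) := by rwa [hu]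
  have i1 : IntervalIntegrable (fun τ => q (t - τ) * f τ) volume 0 t :=
    hf.continuousOn_mul hqc.continuousOn
  have i2 : IntervalIntegrable (fun τ => b * (q (t - τ) * y τ)) volume 0 t :=
    ContinuousOn.intervalIntegrable (continuousOn_const.mul (hqc.continuousOn.mul hyu))
  have i3 : IntervalIntegrable (fun τ => q₁ (t - τ) * (w τ + a * y τ)) volume 0 t :=
    ContinuousOn.intervalIntegrable
      (hq₁c.continuousOn.mul (hwu.add (continuousOn_const.mul hyu)))
  have i4 : IntervalIntegrable (fun τ => (-q₁ (t - τ)) * (w 0 + a * y 0)) volume 0 t :=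
    (hq₁c.neg.mul continuous_const).intervalIntegrable _ _
  have e3 : ∫ τ in (0 : ℝ)..t, q (t - τ) * (f τ - b * y τ)
      = (∫ τ in (0 : ℝ)..t, q (t - τ) * f τ) - ∫ τ in (0 : ℝ)..t, b * (q (t - τ) * y τ) := by
    rw [← intervalIntegral.integral_sub i1 i2]
    congr 1
    ext τ
    ring
  have e4 : ∫ τ in (0 : ℝ)..t, (-q₁ (t - τ)) * (w τ + a * y τ - (w 0 + a * y 0))
      = -(∫ τ in (0 : ℝ)..t, q₁ (t - τ) * (w τ + a * y τ))
        - ∫ τ in (0 : ℝ)..t, (-q₁ (t - τ)) * (w 0 + a * y 0) := by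
    have i5 : IntervalIntegrable (fun τ => -(q₁ (t - τ) * (w τ + a * y τ))) volume 0 t := i3.neg
    rw [← intervalIntegral.integral_neg, ← intervalIntegral.integral_sub i5 i4]
    congr 1
    ext τ
    ring
  have e5 : ∫ τ in (0 : ℝ)..t, (-q₁ (t - τ)) * (w 0 + a * y 0)
      = (q 0 - q t) * (w 0 + a * y 0) := by
    rw [intervalIntegral.integral_mul_const,
      intervalIntegral.integral_eq_sub_of_hasDerivAt (fun τ _ => hq τ)
        (hq₁c.neg.intervalIntegrable _ _)]
    simp
  have e6 : (∫ τ in (0 : ℝ)..t, q₁ (t - τ) * (w τ + a * y τ))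
      + ∫ τ in (0 : ℝ)..t, b * (q (t - τ) * y τ) = q₁ 0 * y t - q₁ t * y 0 := by
    rw [← intervalIntegral.integral_add i3 i2]
    have hd : ∀ τ ∈ Ioo 0 t, HasDerivAt (fun τ => q₁ (t - τ) * y τ)
        (q₁ (t - τ) * (w τ + a * y τ) + b * (q (t - τ) * y τ)) τ := by
      intro τ hτ
      have h1 := (hy τ (Ioo_subset_Icc_self hτ)).hasDerivAt (Icc_mem_nhds hτ.1 hτ.2)
      refine ((hq₁ τ).mul h1).congr_deriv ?_
      ring
    rw [intervalIntegral.integral_eq_sub_of_hasDerivAt_of_le ht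
      (hq₁c.continuousOn.mul hyc) hd (i3.add i2)]
    simp
  rw [e3, e4, e5] at ibp
  simp only [intervalIntegral.integral_same, sub_self, sub_zero, mul_zero] at ibp
  have e7 := heq t (right_mem_Icc.2 ht)
  have e8 : ∫ σ in (0 : ℝ)..t, (f σ - b * y σ) = w t + a * y t - (w 0 + a * y 0) := by
    rw [e7]
    ring
  rw [e8] at ibp
  linarith

end IsOscillation

/-- Decay of solutions of the damped oscillator equation with a force, which is understood in
integrated form. -/
theorem oscillator_bound {a b c : ℝ} (ha : 0 < a) (hb : 0 ≤ b) (hc : 0 ≤ c)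
    (h1 : 2 * c * (a ^ 2 + b) ≤ a ^ 2) (h2 : 3 * c * b ≤ a ^ 2) {y w f : ℝ → ℝ} {t : ℝ}
    (ht : 0 ≤ t) (hy : ∀ τ ∈ Icc 0 t, HasDerivWithinAt y (w τ) (Icc 0 t) τ)
    (hw : ContinuousOn w (Icc 0 t)) (hf : IntervalIntegrable f volume 0 t)
    (heq : ∀ τ ∈ Icc 0 t, w τ + a * y τ = w 0 + a * y 0 + ∫ σ in (0 : ℝ)..τ, (f σ - b * y σ)) :
    |y t| ≤ 2 / a * Real.exp (-(c * b / a * t)) * |w 0| + 2 * Real.exp (-(c * b / a * t)) * |y 0|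
        + ∫ τ in (0 : ℝ)..t, 2 / a * Real.exp (-(c * b / a * (t - τ))) * |f τ| ∧
      |w t| ≤ (Real.exp (-(a * t)) + 4 * b / a ^ 2 * Real.exp (-(c * b / a * t))) * |w 0|
        + 2 * b / a * Real.exp (-(c * b / a * t)) * |y 0|
        + ∫ τ in (0 : ℝ)..t, (Real.exp (-(a * (t - τ)))
          + 4 * b / a ^ 2 * Real.exp (-(c * b / a * (t - τ)))) * |f τ| := by
  obtain ⟨q, q₁, h, q0, q10⟩ := exists_isOscillation a b
  have D1 := h.duhamel ht hy hw hf heq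
  -- Here q₁ is the oscillation, with initial value 1 and initial derivative -a, so that the left
  -- side of Duhamel's formula reduces to w t.
  have D2 := h.derivative.duhamel ht hy hw hf heq
  rw [q0, q10] at D1
  rw [q0, q10] at D2
  obtain ⟨B1, B2⟩ := h.bounds q0 q10 ha hb hc h1 h2 ht
  have B3 := h.deriv_bound q0 q10 ha hb hc h1 h2 ht
  have hint : ∀ g G : ℝ → ℝ, Continuous G → (∀ τ, 0 ≤ τ → |g τ| ≤ G τ) →
      |∫ τ in (0 : ℝ)..t, g (t - τ) * f τ| ≤ ∫ τ in (0 : ℝ)..t, G (t - τ) * |f τ| := by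
    intro g G hG hgG
    rw [← Real.norm_eq_abs]
    refine intervalIntegral.norm_integral_le_of_norm_le ht (ae_of_all _ fun τ hτ => ?_) ?_
    · rw [norm_mul, Real.norm_eq_abs, Real.norm_eq_abs]
      exact mul_le_mul_of_nonneg_right (hgG _ (by linarith [hτ.2])) (abs_nonneg _)
    · exact hf.abs.continuousOn_mul (hG.comp (by fun_prop)).continuousOn
  constructor
  · have e : y t = q t * w 0 + (q₁ t + a * q t) * y 0 + ∫ τ in (0 : ℝ)..t, q (t - τ) * f τ := by
      linarith
    rw [e]
    refine (abs_add_three _ _ _).trans ?_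
    rw [abs_mul, abs_mul]
    refine add_le_add (add_le_add ?_ ?_) ?_
    · exact mul_le_mul_of_nonneg_right B1 (abs_nonneg _)
    · exact mul_le_mul_of_nonneg_right B2 (abs_nonneg _)
    · exact hint q (fun τ => 2 / a * Real.exp (-(c * b / a * τ))) (by fun_prop)
        fun τ hτ => (h.bounds q0 q10 ha hb hc h1 h2 hτ).1
  · have e : w t = q₁ t * w 0 + (-(b * q t)) * y 0 + ∫ τ in (0 : ℝ)..t, q₁ (t - τ) * f τ := by
      linarith
    rw [e]
    refine (abs_add_three _ _ _).trans ?_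
    rw [abs_mul, abs_mul, abs_neg, abs_mul, abs_of_nonneg hb]
    refine add_le_add (add_le_add ?_ ?_) ?_
    · exact mul_le_mul_of_nonneg_right B3 (abs_nonneg _)
    · refine mul_le_mul_of_nonneg_right ?_ (abs_nonneg _)
      calc b * |q t| ≤ b * (2 / a * Real.exp (-(c * b / a * t))) := by gcongr
        _ = _ := by ring
    · exact hint q₁ (fun τ => Real.exp (-(a * τ)) + 4 * b / a ^ 2 * Real.exp (-(c * b / a * τ)))
        (by fun_prop) fun τ hτ => h.deriv_bound q0 q10 ha hb hc h1 h2 hτ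

/-! ### Cutoff functions -/

/-- Smooth cutoff functions exhausting the interval `(0, 1)`. -/
def cut (n : ℕ) (y : ℝ) : ℝ := Real.smoothTransition (n * (y * (1 - y)) - 1)

theorem contDiff_cut (n : ℕ) : ContDiff ℝ ∞ (cut n) :=
  Real.smoothTransition.contDiff.comp (by fun_prop)

theorem cut_nonneg (n : ℕ) (y : ℝ) : 0 ≤ cut n y := Real.smoothTransition.nonneg _

theorem cut_le_one (n : ℕ) (y : ℝ) : cut n y ≤ 1 := Real.smoothTransition.le_one _

theorem abs_cut_le (n : ℕ) (y : ℝ) : |cut n y| ≤ 1 := by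
  rw [abs_of_nonneg (cut_nonneg n y)]
  exact cut_le_one n y

theorem tsupport_cut_subset (n : ℕ) : tsupport (cut n) ⊆ Ioo 0 1 := by
  have h1 : tsupport (cut n) ⊆ {y : ℝ | 1 ≤ n * (y * (1 - y))} := by
    refine closure_minimal (fun y hy => ?_) (isClosed_le continuous_const (by fun_prop))
    by_contra h
    simp only [mem_ofPred_eq, not_le] at h
    exact hy (Real.smoothTransition.zero_of_nonpos (by linarith))
  intro y hy
  have h2 : 1 ≤ n * (y * (1 - y)) := h1 hy
  have h3 : 0 < y * (1 - y) := by
    by_contra h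
    have : (n : ℝ) * (y * (1 - y)) ≤ 0 := mul_nonpos_of_nonneg_of_nonpos (by positivity) (by linarith)
    linarith
  constructor <;> nlinarith

theorem hasCompactSupport_cut (n : ℕ) : HasCompactSupport (cut n) :=
  HasCompactSupport.of_support_subset_isCompact (isCompact_Icc (a := (0 : ℝ)) (b := 1))
    (subset_closure.trans ((tsupport_cut_subset n).trans Ioo_subset_Icc_self))

theorem deriv_smoothTransition_eq_zero {u : ℝ} (hu : u < 0 ∨ 1 < u) :
    deriv Real.smoothTransition u = 0 := by
  rcases hu with hu | hu
  · have : Real.smoothTransition =ᶠ[𝓝 u] fun _ => 0 := by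
      filter_upwards [Iio_mem_nhds hu] with v hv
      exact Real.smoothTransition.zero_of_nonpos (le_of_lt hv)
    rw [this.deriv_eq, deriv_const]
  · have : Real.smoothTransition =ᶠ[𝓝 u] fun _ => 1 := by
      filter_upwards [Ioi_mem_nhds hu] with v hv
      exact Real.smoothTransition.one_of_one_le (le_of_lt hv)
    rw [this.deriv_eq, deriv_const]

theorem exists_bound_deriv_smoothTransition :
    ∃ B, 0 ≤ B ∧ ∀ u, |deriv Real.smoothTransition u| ≤ B := by
  have hc : Continuous (deriv Real.smoothTransition) :=
    (Real.smoothTransition.contDiff (n := 1)).continuous_deriv le_rfl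
  obtain ⟨B, hB⟩ := (isCompact_Icc (a := (0 : ℝ)) (b := 1)).exists_bound_of_continuousOn
    hc.continuousOn
  refine ⟨max B 0, le_max_right _ _, fun u => ?_⟩
  by_cases hu : u ∈ Icc (0 : ℝ) 1
  · exact (hB u hu).trans (le_max_left _ _)
  · rw [deriv_smoothTransition_eq_zero, abs_zero]
    · exact le_max_right _ _
    · by_contra! h
      exact hu h

theorem deriv_cut (n : ℕ) (y : ℝ) : deriv (cut n) y =
    deriv Real.smoothTransition (n * (y * (1 - y)) - 1) * (n * (1 - 2 * y)) := by
  have h1 : HasDerivAt (fun y : ℝ => (n : ℝ) * (y * (1 - y)) - 1) (n * (1 - 2 * y)) y := by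
    have := ((((hasDerivAt_id y).mul ((hasDerivAt_id y).const_sub 1)).const_mul (n : ℝ)).sub_const 1)
    refine this.congr_deriv ?_
    simp only [id_eq]
    ring
  have h2 := (((Real.smoothTransition.contDiff (n := 1)).differentiable (by simp))
    (n * (y * (1 - y)) - 1)).hasDerivAt
  exact (h2.comp y h1).deriv

/-- The cutoff changes only where n y(1 - y) lies between 1 and 2, so its derivative, of size n, is
at most of order 1/(y(1 - y)). Against a function that vanishes linearly at the boundary it stays
bounded uniformly in n. -/
theorem exists_bound_deriv_cut :
    ∃ C, 0 ≤ C ∧ ∀ n : ℕ, ∀ y ∈ Ioo (0 : ℝ) 1, |deriv (cut n) y| * (y * (1 - y)) ≤ C := by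
  obtain ⟨B, hB0, hB⟩ := exists_bound_deriv_smoothTransition
  refine ⟨2 * B, by positivity, fun n y hy => ?_⟩
  have hq : 0 < y * (1 - y) := mul_pos hy.1 (by linarith [hy.2])
  rw [deriv_cut]
  by_cases h : 2 < n * (y * (1 - y))
  · rw [deriv_smoothTransition_eq_zero (Or.inr (by linarith))]
    simp [hB0]
  · push Not at h
    rw [abs_mul, abs_mul, Nat.abs_cast]
    have h1 : |1 - 2 * y| ≤ 1 := by
      rw [abs_le]
      constructor <;> linarith [hy.1, hy.2]
    calc |deriv Real.smoothTransition (n * (y * (1 - y)) - 1)| * (n * |1 - 2 * y|) * (y * (1 - y))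
        ≤ B * (n * 1) * (y * (1 - y)) := by
          gcongr
          exact hB _
      _ = B * (n * (y * (1 - y))) := by ring
      _ ≤ B * 2 := by gcongr
      _ = 2 * B := by ring

theorem eventually_cut {y : ℝ} (hy : y ∈ Ioo (0 : ℝ) 1) :
    ∀ᶠ n : ℕ in atTop, cut n y = 1 ∧ deriv (cut n) y = 0 := by
  have hq : 0 < y * (1 - y) := mul_pos hy.1 (by linarith [hy.2])
  have : Tendsto (fun n : ℕ => (n : ℝ) * (y * (1 - y))) atTop atTop :=
    tendsto_natCast_atTop_atTop.atTop_mul_const hq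
  filter_upwards [this.eventually_gt_atTop 2] with n hn
  refine ⟨Real.smoothTransition.one_of_one_le (by linarith), ?_⟩
  rw [deriv_cut, deriv_smoothTransition_eq_zero (Or.inr (by linarith)), zero_mul]

/-- A smooth cutoff function on the line. -/
def bump (x : ℝ) : ℝ := Real.smoothTransition (2 - x ^ 2)

theorem contDiff_bump : ContDiff ℝ ∞ bump := Real.smoothTransition.contDiff.comp (by fun_prop)

theorem bump_nonneg (x : ℝ) : 0 ≤ bump x := Real.smoothTransition.nonneg _

theorem bump_le_one (x : ℝ) : bump x ≤ 1 := Real.smoothTransition.le_one _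

theorem bump_eq_one {x : ℝ} (hx : |x| ≤ 1) : bump x = 1 := by
  refine Real.smoothTransition.one_of_one_le ?_
  have := (sq_le_one_iff_abs_le_one x).2 hx
  linarith

theorem bump_eq_zero {x : ℝ} (hx : 2 < |x|) : bump x = 0 := by
  refine Real.smoothTransition.zero_of_nonpos ?_
  have : 2 ^ 2 < |x| ^ 2 := by gcongr
  rw [sq_abs] at this
  linarith

theorem hasCompactSupport_bump : HasCompactSupport bump := by
  refine HasCompactSupport.of_support_subset_isCompact (isCompact_Icc (a := (-2 : ℝ)) (b := 2))
    fun x hx => ?_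
  rw [mem_Icc, ← abs_le]
  by_contra! h
  exact hx (bump_eq_zero h)

/-! ### Products of functions of one variable -/

theorem hasFDerivAt_prod {g s : ℝ → ℝ} {z : ℝ × ℝ} {g' s' : ℝ} (hg : HasDerivAt g g' z.1)
    (hs : HasDerivAt s s' z.2) (v : ℝ × ℝ) :
    fderiv ℝ (fun z : ℝ × ℝ => g z.1 * s z.2) z v = g' * s z.2 * v.1 + g z.1 * s' * v.2 := by
  have h1 := hg.comp_hasFDerivAt z (hasFDerivAt_fst (𝕜 := ℝ) (p := z))
  have h2 := hs.comp_hasFDerivAt z (hasFDerivAt_snd (𝕜 := ℝ) (p := z))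
  have h3 : HasFDerivAt (fun z : ℝ × ℝ => g z.1 * s z.2) _ z := h1.mul h2
  rw [h3.fderiv]
  simp
  ring

theorem d1_prod {g s : ℝ → ℝ} (hg : Differentiable ℝ g) (hs : Differentiable ℝ s) :
    d1 (fun z : ℝ × ℝ => g z.1 * s z.2) = fun z => deriv g z.1 * s z.2 := by
  ext z
  rw [d1, hasFDerivAt_prod (hg z.1).hasDerivAt (hs z.2).hasDerivAt]
  simp

theorem d2_prod {g s : ℝ → ℝ} (hg : Differentiable ℝ g) (hs : Differentiable ℝ s) :
    d2 (fun z : ℝ × ℝ => g z.1 * s z.2) = fun z => g z.1 * deriv s z.2 := by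
  ext z
  rw [d2, hasFDerivAt_prod (hg z.1).hasDerivAt (hs z.2).hasDerivAt]
  simp

theorem isTest_prod {g s : ℝ → ℝ} (hg : ContDiff ℝ ∞ g) (hgc : HasCompactSupport g)
    (hs : ContDiff ℝ ∞ s) (hsc : HasCompactSupport s) (hss : tsupport s ⊆ Ioo 0 1) :
    IsTest (fun z : ℝ × ℝ => g z.1 * s z.2) := by
  have hsub : tsupport (fun z : ℝ × ℝ => g z.1 * s z.2) ⊆ tsupport g ×ˢ tsupport s := by
    refine closure_minimal (fun z hz => ?_) ((isClosed_tsupport g).prod (isClosed_tsupport s))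
    have : g z.1 * s z.2 ≠ 0 := hz
    exact ⟨subset_tsupport g (left_ne_zero_of_mul this),
      subset_tsupport s (right_ne_zero_of_mul this)⟩
  refine ⟨(hg.comp contDiff_fst).mul (hs.comp contDiff_snd), ?_, ?_⟩
  · exact HasCompactSupport.of_support_subset_isCompact (IsCompact.prod hgc hsc)
      (subset_closure.trans hsub)
  · exact hsub.trans (prod_mono (subset_univ _) hss)

theorem exists_bound_Icc {s : ℝ → ℝ} (hs : Continuous s) :
    ∃ C, 0 ≤ C ∧ ∀ y ∈ Ioo (0 : ℝ) 1, |s y| ≤ C := by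
  obtain ⟨C, hC⟩ := (isCompact_Icc (a := (0 : ℝ)) (b := 1)).exists_bound_of_continuousOn
    hs.continuousOn
  exact ⟨max C 0, le_max_right _ _, fun y hy =>
    (hC y (Ioo_subset_Icc_self hy)).trans (le_max_left _ _)⟩

theorem integrable_mul_snd {k : ℝ × ℝ → ℝ} (hk : Integrable k μ) {s : ℝ → ℝ} (hs : Continuous s) :
    Integrable (fun z => k z * s z.2) μ := by
  obtain ⟨C, -, hC⟩ := exists_bound_Icc hs
  refine hk.mul_bdd (c := C) (hs.comp continuous_snd).aestronglyMeasurable ?_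
  filter_upwards [ae_mem_Ω] with z hz
  exact hC _ (mem_Ω.1 hz)

theorem tendsto_integral_cut {k : ℝ × ℝ → ℝ} (hk : Integrable k μ) :
    Tendsto (fun n => ∫ z, k z * cut n z.2 ∂μ) atTop (𝓝 (∫ z, k z ∂μ)) := by
  refine tendsto_integral_of_dominated_convergence (fun z => ‖k z‖) (fun n => ?_) hk.norm
    (fun n => ae_of_all _ fun z => ?_) ?_
  · exact hk.aestronglyMeasurable.mul
      ((contDiff_cut n).continuous.comp continuous_snd).aestronglyMeasurable
  · rw [norm_mul]
    exact mul_le_of_le_one_right (norm_nonneg _) (abs_cut_le n _)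
  · filter_upwards [ae_mem_Ω] with z hz
    refine tendsto_const_nhds.congr' ?_
    filter_upwards [eventually_cut (mem_Ω.1 hz)] with n hn
    rw [hn.1, mul_one]

/-- Integration by parts in `x₁` against functions of product form. -/
theorem IsWeakDeriv.integral_prod_fst {h h₁ : ℝ × ℝ → ℝ} (H : IsWeakDeriv 1 0 h h₁)
    {g s : ℝ → ℝ} (hg : ContDiff ℝ ∞ g) (hgc : HasCompactSupport g) (hs : ContDiff ℝ ∞ s)
    (i1 : Integrable (fun z => h₁ z * g z.1) μ)
    (i2 : Integrable (fun z => h z * deriv g z.1) μ) :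
    ∫ z, h₁ z * (g z.1 * s z.2) ∂μ = -∫ z, h z * (deriv g z.1 * s z.2) ∂μ := by
  have key : ∀ n, ∫ z, h₁ z * g z.1 * s z.2 * cut n z.2 ∂μ
      = -∫ z, h z * deriv g z.1 * s z.2 * cut n z.2 ∂μ := by
    intro n
    have ht : IsTest (fun z : ℝ × ℝ => g z.1 * (s z.2 * cut n z.2)) :=
      isTest_prod (s := fun y => s y * cut n y) hg hgc (hs.mul (contDiff_cut n))
        (hasCompactSupport_cut n).mul_left
        ((tsupport_mul_subset_right (f := s)).trans (tsupport_cut_subset n))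
    have e := H.integral_eq _ ht
    simp only [Function.iterate_one, Function.iterate_zero, id_eq] at e
    rw [d1_prod (s := fun y => s y * cut n y) (hg.differentiable (by simp))
      ((hs.mul (contDiff_cut n)).differentiable (by simp))] at e
    simp only [mul_assoc]
    rw [e]
    simp
  have t1 := tendsto_integral_cut (integrable_mul_snd i1 hs.continuous)
  have t2 := (tendsto_integral_cut (integrable_mul_snd i2 hs.continuous)).neg
  simp_rw [key] at t1
  have := tendsto_nhds_unique t1 t2
  simpa only [mul_assoc] using this

/-- Integration by parts in `x₂` against functions of product form that vanish on the boundary. -/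
theorem IsWeakDeriv.integral_prod_snd {h h₁ : ℝ × ℝ → ℝ} (H : IsWeakDeriv 0 1 h h₁)
    {g s : ℝ → ℝ} (hg : ContDiff ℝ ∞ g) (hgc : HasCompactSupport g) (hs : ContDiff ℝ ∞ s)
    {C : ℝ} (hC : ∀ y ∈ Ioo (0 : ℝ) 1, |s y| ≤ C * (y * (1 - y)))
    (i1 : Integrable (fun z => h₁ z * g z.1) μ) (i2 : Integrable (fun z => h z * g z.1) μ) :
    ∫ z, h₁ z * (g z.1 * s z.2) ∂μ = -∫ z, h z * (g z.1 * deriv s z.2) ∂μ := by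
  obtain ⟨B, hB0, hB⟩ := exists_bound_deriv_cut
  have hs' : Continuous (deriv s) := hs.continuous_deriv (by simp)
  have hcut' : ∀ n, Continuous (deriv (cut n)) := fun n => (contDiff_cut n).continuous_deriv (by simp)
  have hC0 : 0 ≤ C := by
    have := (abs_nonneg _).trans (hC (1 / 2) ⟨by norm_num, by norm_num⟩)
    by_contra! h
    nlinarith
  have j1 := integrable_mul_snd i2 hs'
  have bd : ∀ n, ∀ y ∈ Ioo (0 : ℝ) 1, |s y * deriv (cut n) y| ≤ C * B := by
    intro n y hy
    rw [abs_mul]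
    calc |s y| * |deriv (cut n) y| ≤ C * (y * (1 - y)) * |deriv (cut n) y| := by
          gcongr
          exact hC y hy
      _ = C * (|deriv (cut n) y| * (y * (1 - y))) := by ring
      _ ≤ C * B := by
          gcongr
          exact hB n y hy
  have j2 : ∀ n, Integrable (fun z => h z * g z.1 * (s z.2 * deriv (cut n) z.2)) μ := fun n =>
    integrable_mul_snd i2 (hs.continuous.mul (hcut' n))
  have j3 : ∀ n, Integrable (fun z => h z * g z.1 * deriv s z.2 * cut n z.2) μ := fun n =>
    integrable_mul_snd j1 (contDiff_cut n).continuous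
  have key : ∀ n, ∫ z, h₁ z * g z.1 * s z.2 * cut n z.2 ∂μ
      = -((∫ z, h z * g z.1 * deriv s z.2 * cut n z.2 ∂μ)
        + ∫ z, h z * g z.1 * (s z.2 * deriv (cut n) z.2) ∂μ) := by
    intro n
    have ht : IsTest (fun z : ℝ × ℝ => g z.1 * (s z.2 * cut n z.2)) :=
      isTest_prod (s := fun y => s y * cut n y) hg hgc (hs.mul (contDiff_cut n))
        (hasCompactSupport_cut n).mul_left
        ((tsupport_mul_subset_right (f := s)).trans (tsupport_cut_subset n))
    have e := H.integral_eq _ ht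
    simp only [Function.iterate_one, Function.iterate_zero, id_eq] at e
    have ed : deriv (fun y => s y * cut n y) = fun y => deriv s y * cut n y + s y * deriv (cut n) y := by
      ext y
      exact deriv_fun_mul (hs.differentiable (by simp) y)
        ((contDiff_cut n).differentiable (by simp) y)
    rw [d2_prod (s := fun y => s y * cut n y) (hg.differentiable (by simp))
      ((hs.mul (contDiff_cut n)).differentiable (by simp)), ed] at e
    rw [← integral_add (j3 n) (j2 n)]
    have e1 : ∫ z, (h z * g z.1 * deriv s z.2 * cut n z.2
        + h z * g z.1 * (s z.2 * deriv (cut n) z.2)) ∂μ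
        = ∫ z, h z * (g z.1 * (deriv s z.2 * cut n z.2 + s z.2 * deriv (cut n) z.2)) ∂μ := by
      congr 1
      ext z
      ring
    rw [e1, e]
    simp only [mul_assoc]
    simp
  have t1 := tendsto_integral_cut (integrable_mul_snd i1 hs.continuous)
  have t2 := tendsto_integral_cut j1
  -- The boundary layer: the integrand is dominated by a multiple of |h g| and is eventually zero at
  -- each point.
  have t3 : Tendsto (fun n => ∫ z, h z * g z.1 * (s z.2 * deriv (cut n) z.2) ∂μ) atTop
      (𝓝 (∫ _, (0 : ℝ) ∂μ)) := by
    refine tendsto_integral_of_dominated_convergence (fun z => ‖h z * g z.1‖ * (C * B))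
      (fun n => (j2 n).aestronglyMeasurable) (i2.norm.mul_const _) (fun n => ?_) ?_
    · filter_upwards [ae_mem_Ω] with z hz
      rw [norm_mul]
      gcongr
      exact bd n _ (mem_Ω.1 hz)
    · filter_upwards [ae_mem_Ω] with z hz
      refine tendsto_const_nhds.congr' ?_
      filter_upwards [eventually_cut (mem_Ω.1 hz)] with n hn
      rw [hn.2, mul_zero, mul_zero]
  simp_rw [key] at t1
  have := tendsto_nhds_unique t1 (t2.add t3).neg
  simpa only [mul_assoc, integral_zero, add_zero] using this

/-- Convergence in `L^p` implies convergence of the pairings with bounded functions of bounded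
support. -/
theorem tendsto_integral_mul_of_tendsto_eLpNorm {p : ℝ≥0∞} {u : ℕ → ℝ × ℝ → ℝ}
    {h w : ℝ × ℝ → ℝ} (hu : ∀ n, MemLp (u n) p μ) (hh : MemLp h p μ)
    (hlim : Tendsto (fun n => eLpNorm (fun z => u n z - h z) p μ) atTop (𝓝 0))
    {q : ℝ≥0∞} [ENNReal.HolderConjugate p q] (hw : MemLp w q μ) :
    Tendsto (fun n => ∫ z, u n z * w z ∂μ) atTop (𝓝 (∫ z, h z * w z ∂μ)) := by
  refine tendsto_integral_of_L1 _ (hh.integrable_mul hw).1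
    (Eventually.of_forall fun n => (hu n).integrable_mul hw) ?_
  have h1 : ∀ n, ∫⁻ z, ‖u n z * w z - h z * w z‖ₑ ∂μ
      ≤ eLpNorm (fun z => u n z - h z) p μ * eLpNorm w q μ := by
    intro n
    have := eLpNorm_smul_le_mul_eLpNorm (p := p) (q := q) (r := 1) hw.1 ((hu n).sub hh).1
    rw [eLpNorm_one_eq_lintegral_enorm] at this
    simpa [sub_mul, Pi.sub_def] using this
  refine tendsto_of_tendsto_of_tendsto_of_le_of_le tendsto_const_nhds ?_ (fun _ => zero_le) h1
  simpa using ENNReal.Tendsto.mul_const hlim (Or.inr hw.2.ne)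

/-- Integration by parts in `x₂` for functions that vanish on the boundary. -/
theorem MemW0.integral_prod_snd {p q : ℝ≥0∞} [ENNReal.HolderConjugate p q]
    {h : ℝ × ℝ → ℝ} (H : MemW0 p h) {g s : ℝ → ℝ} (hg : ContDiff ℝ ∞ g) (hs : ContDiff ℝ ∞ s)
    (hw : MemLp (fun z : ℝ × ℝ => g z.1 * s z.2) q μ)
    (hw' : MemLp (fun z : ℝ × ℝ => g z.1 * deriv s z.2) q μ) :
    ∫ z, weakDeriv 0 1 h z * (g z.1 * s z.2) ∂μ = -∫ z, h z * (g z.1 * deriv s z.2) ∂μ := by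
  obtain ⟨hW, u, hu, l0, -, l2⟩ := H
  have t1 := tendsto_integral_mul_of_tendsto_eLpNorm (fun n => (hu n).memLp p) hW.1 l0 hw'
  have t2 := tendsto_integral_mul_of_tendsto_eLpNorm (fun n => (hu n).d2.memLp p)
    (hW.memLp (i := 0) (j := 1) le_rfl) l2 hw
  -- For the approximating test functions the identity holds whatever the boundary values of s, and
  -- both sides pass to the limit.
  have key : ∀ n, ∫ z, d2 (u n) z * (g z.1 * s z.2) ∂μ
      = -∫ z, u n z * (g z.1 * deriv s z.2) ∂μ := by
    intro n
    have hG : ContDiff ℝ ∞ (fun z : ℝ × ℝ => g z.1 * s z.2) :=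
      (hg.comp contDiff_fst).mul (hs.comp contDiff_snd)
    have hG' : ContDiff ℝ ∞ (fun z : ℝ × ℝ => g z.1 * deriv s z.2) :=
      (hg.comp contDiff_fst).mul (((contDiff_infty_iff_deriv.1 hs).2).comp contDiff_snd)
    have e := d2_prod (hg.differentiable (by simp)) (hs.differentiable (by simp))
    have e1 := congrArg (fun f => fun z => f z * u n z) e
    have ibp := integral_mul_fderiv_eq_neg_fderiv_mul_of_integrable (μ := volume) (𝕜 := ℝ)
      (f := fun z : ℝ × ℝ => g z.1 * s z.2) (g := u n) (v := ((0 : ℝ), (1 : ℝ)))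
      ?_ ?_ ?_ (fun z _ => hG.differentiable (by simp) z) (fun z _ => (hu n).differentiable z)
    · have a1 := (hu n).d2.integral_eq_volume (fun z : ℝ × ℝ => g z.1 * s z.2)
      have a2 := (hu n).integral_eq_volume (fun z : ℝ × ℝ => g z.1 * deriv s z.2)
      simp_rw [mul_comm (d2 (u n) _), mul_comm (u n _)]
      rw [a1, a2]
      refine ibp.trans ?_
      congr 2
    · exact (((hu n).mul_smooth hG').integrable).congr (ae_of_all _ fun z => by
        exact (mul_comm _ _).trans (congrFun e1 z).symm)
    · exact (((hu n).d2.mul_smooth hG).integrable).congr (ae_of_all _ fun z => mul_comm _ _)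
    · exact (((hu n).mul_smooth hG).integrable).congr (ae_of_all _ fun z => mul_comm _ _)
  simp_rw [key] at t2
  exact tendsto_nhds_unique t2 t1.neg

/-! ### Sine modes -/

/-- The sine mode `sin (k π y)`. -/
def sn (k : ℕ) (y : ℝ) : ℝ := Real.sin (k * Real.pi * y)

/-- The cosine mode `cos (k π y)`. -/
def cs (k : ℕ) (y : ℝ) : ℝ := Real.cos (k * Real.pi * y)

theorem contDiff_sn (k : ℕ) : ContDiff ℝ ∞ (sn k) := by unfold sn; fun_prop

theorem contDiff_cs (k : ℕ) : ContDiff ℝ ∞ (cs k) := by unfold cs; fun_prop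

theorem abs_sn_le_one (k : ℕ) (y : ℝ) : |sn k y| ≤ 1 := Real.abs_sin_le_one _

theorem abs_cs_le_one (k : ℕ) (y : ℝ) : |cs k y| ≤ 1 := Real.abs_cos_le_one _

theorem hasDerivAt_sn (k : ℕ) (y : ℝ) : HasDerivAt (sn k) (k * Real.pi * cs k y) y := by
  have := ((hasDerivAt_id y).const_mul (k * Real.pi)).sin
  refine this.congr_deriv ?_
  simp only [id_eq, cs]
  ring

theorem hasDerivAt_cs (k : ℕ) (y : ℝ) : HasDerivAt (cs k) (-(k * Real.pi * sn k y)) y := by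
  have := ((hasDerivAt_id y).const_mul (k * Real.pi)).cos
  refine this.congr_deriv ?_
  simp only [id_eq, sn]
  ring

theorem deriv_sn (k : ℕ) : deriv (sn k) = fun y => k * Real.pi * cs k y :=
  funext fun y => (hasDerivAt_sn k y).deriv

theorem deriv_cs (k : ℕ) : deriv (cs k) = fun y => -(k * Real.pi * sn k y) :=
  funext fun y => (hasDerivAt_cs k y).deriv

/-- The sine is bounded by kπ times the distance to either end point, and min(y, 1 - y) ≤ 2y(1 - y).
This is the linear vanishing required by `IsWeakDeriv.integral_prod_snd`. -/
theorem abs_sn_le (k : ℕ) {y : ℝ} (hy : y ∈ Ioo (0 : ℝ) 1) :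
    |sn k y| ≤ 2 * (k * Real.pi) * (y * (1 - y)) := by
  have hk : 0 ≤ (k : ℝ) * Real.pi := by positivity
  have h1 : |sn k y| ≤ k * Real.pi * y := by
    refine (Real.abs_sin_le_abs).trans ?_
    rw [abs_of_nonneg (mul_nonneg hk hy.1.le)]
  have h2 : |sn k y| ≤ k * Real.pi * (1 - y) := by
    have e : |sn k y| = |Real.sin (k * Real.pi * (1 - y))| := by
      rw [mul_sub, mul_one, Real.sin_sub, Real.sin_nat_mul_pi, zero_mul, zero_sub, abs_neg,
        abs_mul, Real.abs_cos_eq_sqrt_one_sub_sin_sq, Real.sin_nat_mul_pi]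
      simp [sn]
    rw [e]
    refine (Real.abs_sin_le_abs).trans ?_
    rw [abs_of_nonneg (mul_nonneg hk (by linarith [hy.2]))]
  rcases le_total y (1 / 2) with h | h
  · refine h1.trans ?_
    have : 0 ≤ k * Real.pi * (y * (1 - 2 * y)) :=
      mul_nonneg hk (mul_nonneg hy.1.le (by linarith))
    nlinarith
  · refine h2.trans ?_
    have : 0 ≤ k * Real.pi * ((1 - y) * (2 * y - 1)) :=
      mul_nonneg hk (mul_nonneg (by linarith [hy.2]) (by linarith))
    nlinarith

/-! ### Functions of one variable on the strip -/

theorem μ_eq_prod : μ = (volume : Measure ℝ).prod (volume.restrict (Ioo (0 : ℝ) 1)) := by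
  rw [μ, Ω, Measure.volume_eq_prod, ← Measure.prod_restrict, Measure.restrict_univ]

instance : IsProbabilityMeasure (volume.restrict (Ioo (0 : ℝ) 1)) := ⟨by simp⟩

theorem measurePreserving_fst : MeasurePreserving Prod.fst μ (volume : Measure ℝ) := by
  rw [μ_eq_prod]
  exact MeasureTheory.measurePreserving_fst

theorem memLp_fst {p : ℝ≥0∞} {g : ℝ → ℝ} (hg : MemLp g p volume) :
    MemLp (fun z : ℝ × ℝ => g z.1) p μ :=
  hg.comp_measurePreserving measurePreserving_fst

theorem eLpNorm_fst {p : ℝ≥0∞} {g : ℝ → ℝ} (hg : AEStronglyMeasurable g volume) :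
    eLpNorm (fun z : ℝ × ℝ => g z.1) p μ = eLpNorm g p volume :=
  eLpNorm_comp_measurePreserving hg measurePreserving_fst

theorem memLp_prod {p : ℝ≥0∞} {g s : ℝ → ℝ} (hg : MemLp g p volume) (hs : Continuous s) :
    MemLp (fun z : ℝ × ℝ => g z.1 * s z.2) p μ := by
  obtain ⟨C, -, hC⟩ := exists_bound_Icc hs
  refine (memLp_fst hg).of_le_mul (c := C)
    ((memLp_fst hg).1.mul (hs.comp continuous_snd).aestronglyMeasurable) ?_
  filter_upwards [ae_mem_Ω] with z hz
  rw [norm_mul, mul_comm]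
  exact mul_le_mul_of_nonneg_right (hC _ (mem_Ω.1 hz)) (norm_nonneg _)

theorem eLpNorm_prod_le {p : ℝ≥0∞} {g s : ℝ → ℝ} (hg : AEStronglyMeasurable g volume)
    (hs : ∀ y, |s y| ≤ 1) :
    eLpNorm (fun z : ℝ × ℝ => g z.1 * s z.2) p μ ≤ eLpNorm g p volume := by
  rw [← eLpNorm_fst hg]
  refine eLpNorm_mono fun z => ?_
  rw [norm_mul]
  exact mul_le_of_le_one_right (norm_nonneg _) (hs _)

theorem memLp_of_compact {g : ℝ → ℝ} (hg : Continuous g) (hgc : HasCompactSupport g)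
    (p : ℝ≥0∞) : MemLp g p volume := hg.memLp_of_hasCompactSupport hgc

theorem integrable_mul_fst {h : ℝ × ℝ → ℝ} (hh : MemLp h 2 μ) {g : ℝ → ℝ}
    (hg : MemLp g 2 volume) : Integrable (fun z => h z * g z.1) μ :=
  hh.integrable_mul (memLp_fst hg)

theorem integrable_mul₂ {f g : ℝ × ℝ → ℝ} (hf : MemLp f 2 μ) (hg : MemLp g 2 μ) :
    Integrable (fun z => f z * g z) μ := hf.integrable_mul hg

/-- The Laplacian paired with a smooth function of product form, for functions in `H² ∩ H¹₀`. -/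
theorem integral_lap_mul {φ : ℝ × ℝ → ℝ} (h2 : MemW 2 2 φ) (h0 : MemW0 2 φ) {g : ℝ → ℝ}
    (hg : ContDiff ℝ ∞ g) (hgc : HasCompactSupport g) (k : ℕ) :
    ∫ z, lap φ z * (g z.1 * sn k z.2) ∂μ =
      (∫ z, φ z * (deriv (deriv g) z.1 * sn k z.2) ∂μ)
        - (k * Real.pi) ^ 2 * ∫ z, φ z * (g z.1 * sn k z.2) ∂μ := by
  have hg' : ContDiff ℝ ∞ (deriv g) := (contDiff_infty_iff_deriv.1 hg).2
  have hgc' : HasCompactSupport (deriv g) := hgc.deriv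
  have hg'' : ContDiff ℝ ∞ (deriv (deriv g)) := (contDiff_infty_iff_deriv.1 hg').2
  have m0 := memLp_of_compact hg.continuous hgc 2
  have m1 := memLp_of_compact hg'.continuous hgc' 2
  have m2 := memLp_of_compact hg''.continuous hgc'.deriv 2
  have w10 := h2.memLp (i := 1) (j := 0) (by norm_num)
  have w20 := h2.memLp (i := 2) (j := 0) (by norm_num)
  have w01 := h2.memLp (i := 0) (j := 1) (by norm_num)
  have w02 := h2.memLp (i := 0) (j := 2) (by norm_num)
  have d10 := h2.isWeakDeriv (i := 1) (j := 0) (by norm_num)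
  have d20 := h2.isWeakDeriv (i := 2) (j := 0) (by norm_num)
  have d01 := h2.isWeakDeriv (i := 0) (j := 1) (by norm_num)
  have d02 := h2.isWeakDeriv (i := 0) (j := 2) (by norm_num)
  have a1 := (IsWeakDeriv.of_comp_d1 (i := 1) (j := 0) d10 d20).integral_prod_fst hg hgc
    (contDiff_sn k) (integrable_mul_fst w20 m0) (integrable_mul_fst w10 m1)
  have a2 := d10.integral_prod_fst hg' hgc' (contDiff_sn k) (integrable_mul_fst w10 m1)
    (integrable_mul_fst h2.1 m2)
  -- The first vertical integration by parts relies on the sine vanishing at the boundary, the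
  -- second one, against a cosine, on φ vanishing there.
  have a3 := (IsWeakDeriv.of_comp_d2 (j := 1) d01 d02).integral_prod_snd hg hgc
    (contDiff_sn k) (fun y hy => abs_sn_le k hy) (integrable_mul_fst w02 m0)
    (integrable_mul_fst w01 m0)
  have a4 := h0.integral_prod_snd (q := 2) hg (contDiff_cs k)
    (memLp_prod m0 (contDiff_cs k).continuous)
    (memLp_prod m0 ((contDiff_cs k).continuous_deriv (by simp)))
  have e1 : ∫ z, weakDeriv 0 1 φ z * (g z.1 * deriv (sn k) z.2) ∂μ
      = k * Real.pi * ∫ z, weakDeriv 0 1 φ z * (g z.1 * cs k z.2) ∂μ := by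
    rw [← integral_const_mul, deriv_sn]
    congr 1
    ext z
    ring
  have e2 : ∫ z, φ z * (g z.1 * deriv (cs k) z.2) ∂μ
      = -(k * Real.pi * ∫ z, φ z * (g z.1 * sn k z.2) ∂μ) := by
    rw [← integral_const_mul, deriv_cs, ← integral_neg]
    congr 1
    ext z
    ring
  have e3 : ∫ z, lap φ z * (g z.1 * sn k z.2) ∂μ
      = (∫ z, weakDeriv 2 0 φ z * (g z.1 * sn k z.2) ∂μ)
        + ∫ z, weakDeriv 0 2 φ z * (g z.1 * sn k z.2) ∂μ := by
    have ms := memLp_prod m0 (contDiff_sn k).continuous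
    rw [← integral_add (integrable_mul₂ w20 ms) (integrable_mul₂ w02 ms)]
    congr 1
    ext z
    simp only [lap]
    ring
  rw [e3, a1, a2, a3, e1, a4, e2]
  ring

/-! ### Decay of the Fourier coefficients of the data -/

/-- The horizontal wave `cos (κ x + θ)`. -/
def wave (κ θ x : ℝ) : ℝ := Real.cos (κ * x + θ)

theorem contDiff_wave (κ θ : ℝ) : ContDiff ℝ ∞ (wave κ θ) := by unfold wave; fun_prop

theorem abs_wave_le_one (κ θ x : ℝ) : |wave κ θ x| ≤ 1 := Real.abs_cos_le_one _

theorem hasDerivAt_wave (κ θ x : ℝ) :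
    HasDerivAt (wave κ θ) (κ * wave κ (θ + Real.pi / 2) x) x := by
  have := (((hasDerivAt_id x).const_mul κ).add_const θ).cos
  refine this.congr_deriv ?_
  simp only [wave, id_eq, ← add_assoc, Real.cos_add_pi_div_two]
  ring

theorem deriv_wave (κ θ : ℝ) : deriv (wave κ θ) = fun x => κ * wave κ (θ + Real.pi / 2) x :=
  funext fun x => (hasDerivAt_wave κ θ x).deriv

/-- The cutoff function `bump (x / (N + 1))`. -/
def wide (N : ℕ) (x : ℝ) : ℝ := bump (x * (1 / ((N : ℝ) + 1)))

theorem contDiff_wide (N : ℕ) : ContDiff ℝ ∞ (wide N) := contDiff_bump.comp (by fun_prop)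

theorem hasCompactSupport_wide (N : ℕ) : HasCompactSupport (wide N) := by
  refine HasCompactSupport.of_support_subset_isCompact
    (isCompact_Icc (a := -(2 * ((N : ℝ) + 1))) (b := 2 * ((N : ℝ) + 1))) fun x hx => ?_
  rw [mem_Icc, ← abs_le]
  by_contra! h
  refine hx (bump_eq_zero ?_)
  have hN : (0 : ℝ) < N + 1 := by positivity
  rw [abs_mul, abs_of_pos (by positivity : 0 < 1 / ((N : ℝ) + 1)), mul_one_div, lt_div_iff₀ hN]
  exact h

theorem wide_nonneg (N : ℕ) (x : ℝ) : 0 ≤ wide N x := bump_nonneg _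

theorem wide_le_one (N : ℕ) (x : ℝ) : wide N x ≤ 1 := bump_le_one _

theorem abs_wide_le_one (N : ℕ) (x : ℝ) : |wide N x| ≤ 1 := by
  rw [abs_of_nonneg (wide_nonneg N x)]
  exact wide_le_one N x

theorem wide_eq_one {N : ℕ} {x : ℝ} (h : |x| ≤ N + 1) : wide N x = 1 := by
  refine bump_eq_one ?_
  have hN : (0 : ℝ) < N + 1 := by positivity
  rw [abs_mul, abs_of_pos (by positivity : 0 < 1 / ((N : ℝ) + 1)), mul_one_div, div_le_one hN]
  exact h

theorem eventually_wide (x : ℝ) : ∀ᶠ N : ℕ in atTop, wide N x = 1 := by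
  filter_upwards [tendsto_natCast_atTop_atTop.eventually_ge_atTop |x|] with N hN
  exact wide_eq_one (hN.trans (by linarith))

theorem tendsto_integral_wide {k : ℝ × ℝ → ℝ} (hk : Integrable k μ) :
    Tendsto (fun N => ∫ z, k z * wide N z.1 ∂μ) atTop (𝓝 (∫ z, k z ∂μ)) := by
  refine tendsto_integral_of_dominated_convergence (fun z => ‖k z‖) (fun N => ?_) hk.norm
    (fun N => ae_of_all _ fun z => ?_) (ae_of_all _ fun z => ?_)
  · exact hk.aestronglyMeasurable.mul
      ((contDiff_wide N).continuous.comp continuous_fst).aestronglyMeasurable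
  · rw [norm_mul]
    exact mul_le_of_le_one_right (norm_nonneg _) (abs_wide_le_one N _)
  · refine tendsto_const_nhds.congr' ?_
    filter_upwards [eventually_wide z.1] with N hN
    rw [hN, mul_one]

theorem integrable_mul_bdd_fst {h : ℝ × ℝ → ℝ} (hh : Integrable h μ) {g : ℝ → ℝ}
    (hg : Continuous g) {C : ℝ} (hC : ∀ x, |g x| ≤ C) : Integrable (fun z => h z * g z.1) μ :=
  hh.mul_bdd (c := C) (hg.comp continuous_fst).aestronglyMeasurable (ae_of_all _ fun z => hC z.1)

theorem hasDerivAt_wide (N : ℕ) (x : ℝ) : HasDerivAt (wide N)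
    (deriv bump (x * (1 / ((N : ℝ) + 1))) * (1 / ((N : ℝ) + 1))) x := by
  have h1 : HasDerivAt (fun x : ℝ => x * (1 / ((N : ℝ) + 1))) (1 / ((N : ℝ) + 1)) x := by
    simpa using (hasDerivAt_id x).mul_const (1 / ((N : ℝ) + 1))
  exact ((contDiff_bump.differentiable (by simp) _).hasDerivAt).comp x h1

/-- Integration by parts in `x₁` for integrable functions, against bounded functions. -/
theorem IsWeakDeriv.integral_prod_fst_of_bdd {h h₁ : ℝ × ℝ → ℝ} (H : IsWeakDeriv 1 0 h h₁)
    (hh : Integrable h μ) (hh₁ : Integrable h₁ μ)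
    {g s : ℝ → ℝ} (hg : ContDiff ℝ ∞ g) (hs : ContDiff ℝ ∞ s) {C : ℝ} (hC : ∀ x, |g x| ≤ C)
    (hC' : ∀ x, |deriv g x| ≤ C) :
    ∫ z, h₁ z * (g z.1 * s z.2) ∂μ = -∫ z, h z * (deriv g z.1 * s z.2) ∂μ := by
  obtain ⟨B, hB⟩ := hasCompactSupport_bump.deriv.exists_bound_of_continuous
    (contDiff_bump.continuous_deriv (by simp))
  have hg' : Continuous (deriv g) := hg.continuous_deriv (by simp)
  have hwc := fun N => (contDiff_wide N).continuous
  have hwc' : ∀ N, Continuous (deriv (wide N)) :=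
    fun N => (contDiff_wide N).continuous_deriv (by simp)
  have hw' : ∀ N x, |deriv (wide N) x| ≤ B * (1 / ((N : ℝ) + 1)) := by
    intro N x
    rw [(hasDerivAt_wide N x).deriv, abs_mul,
      abs_of_pos (by positivity : 0 < 1 / ((N : ℝ) + 1))]
    exact mul_le_mul_of_nonneg_right (hB _) (by positivity)
  have j0 := integrable_mul_snd (integrable_mul_bdd_fst hh hg.continuous hC) hs.continuous
  have j1 := integrable_mul_snd (integrable_mul_bdd_fst hh₁ hg.continuous hC) hs.continuous
  have j2 := integrable_mul_snd (integrable_mul_bdd_fst hh hg' hC') hs.continuous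
  have j3 : ∀ N, Integrable (fun z : ℝ × ℝ => h z * g z.1 * s z.2 * deriv (wide N) z.1) μ :=
    fun N => integrable_mul_bdd_fst j0 (hwc' N) (hw' N)
  have j4 : ∀ N, Integrable (fun z : ℝ × ℝ => h z * deriv g z.1 * s z.2 * wide N z.1) μ :=
    fun N => integrable_mul_bdd_fst j2 (hwc N) (abs_wide_le_one N)
  have key : ∀ N, ∫ z, h₁ z * g z.1 * s z.2 * wide N z.1 ∂μ
      = -((∫ z, h z * deriv g z.1 * s z.2 * wide N z.1 ∂μ)
        + ∫ z, h z * g z.1 * s z.2 * deriv (wide N) z.1 ∂μ) := by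
    intro N
    have hgN : ContDiff ℝ ∞ (fun x => g x * wide N x) := hg.mul (contDiff_wide N)
    have hgNc : HasCompactSupport (fun x => g x * wide N x) := (hasCompactSupport_wide N).mul_left
    have e := H.integral_prod_fst (s := s) hgN hgNc hs
      (by
        obtain ⟨C', hC'⟩ := hgNc.exists_bound_of_continuous hgN.continuous
        exact integrable_mul_bdd_fst hh₁ hgN.continuous hC')
      (by
        obtain ⟨C', hC'⟩ := hgNc.deriv.exists_bound_of_continuous (hgN.continuous_deriv (by simp))
        exact integrable_mul_bdd_fst hh (hgN.continuous_deriv (by simp)) hC')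
    have ed : deriv (fun x => g x * wide N x)
        = fun x => deriv g x * wide N x + g x * deriv (wide N) x := by
      ext x
      exact deriv_fun_mul (hg.differentiable (by simp) x)
        ((contDiff_wide N).differentiable (by simp) x)
    rw [ed] at e
    rw [← integral_add (j4 N) (j3 N)]
    calc ∫ z, h₁ z * g z.1 * s z.2 * wide N z.1 ∂μ
        = ∫ z, h₁ z * (g z.1 * wide N z.1 * s z.2) ∂μ := by
          congr 1
          ext z
          ring
      _ = _ := by
          rw [e]
          congr 2
          ext z
          ring
  have t1 := tendsto_integral_wide j1
  have t2 := tendsto_integral_wide j2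
  -- The derivative of the wide cutoff is O(1/(N + 1)), so the error vanishes by integrability of h.
  have t3 : Tendsto (fun N => ∫ z, h z * g z.1 * s z.2 * deriv (wide N) z.1 ∂μ) atTop (𝓝 0) := by
    have l : Tendsto (fun N : ℕ => B * (1 / ((N : ℝ) + 1)) * ∫ z, ‖h z * g z.1 * s z.2‖ ∂μ) atTop
        (𝓝 0) := by
      simpa using ((tendsto_one_div_add_atTop_nhds_zero_nat (𝕜 := ℝ)).const_mul B).mul_const
        (∫ z, ‖h z * g z.1 * s z.2‖ ∂μ)
    refine squeeze_zero_norm (fun N => ?_) l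
    rw [← integral_const_mul]
    refine norm_integral_le_of_norm_le (j0.norm.const_mul _) (ae_of_all _ fun z => ?_)
    rw [norm_mul, mul_comm]
    exact mul_le_mul_of_nonneg_right (hw' N _) (norm_nonneg _)
  simp_rw [key] at t1
  have := tendsto_nhds_unique t1 (t2.add t3).neg
  simpa only [mul_assoc, add_zero] using this

/-- The pairing of a function with the mode `cos (κ x + θ) sin (k π y)`. -/
def coeff (f : ℝ × ℝ → ℝ) (κ θ : ℝ) (k : ℕ) : ℝ := ∫ z, f z * (wave κ θ z.1 * sn k z.2) ∂μ

/-- The square root of the Dirichlet eigenvalue `κ² + (k π)²`. -/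
def ell (κ : ℝ) (k : ℕ) : ℝ := √(κ ^ 2 + (k * Real.pi) ^ 2)

theorem abs_integral_mul_le {f w : ℝ × ℝ → ℝ} (hf : Integrable f μ) (hw : ∀ z, |w z| ≤ 1) :
    |∫ z, f z * w z ∂μ| ≤ (eLpNorm f 1 μ).toReal := by
  rw [← Real.norm_eq_abs]
  have : (eLpNorm f 1 μ).toReal = ∫ z, ‖f z‖ ∂μ := by
    rw [eLpNorm_one_eq_lintegral_enorm, integral_norm_eq_lintegral_enorm hf.1]
  rw [this]
  refine norm_integral_le_of_norm_le hf.norm (ae_of_all _ fun z => ?_)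
  rw [norm_mul]
  exact mul_le_of_le_one_right (norm_nonneg _) (hw z)

theorem abs_mul_le_one {a b : ℝ} (ha : |a| ≤ 1) (hb : |b| ≤ 1) : |a * b| ≤ 1 := by
  rw [abs_mul]
  exact mul_le_one₀ ha (abs_nonneg _) hb

theorem weakDeriv_zero_ae_eq {f : ℝ × ℝ → ℝ} (hf : LocallyIntegrableOn f Ω volume) :
    weakDeriv 0 0 f =ᵐ[μ] f :=
  IsWeakDeriv.weakDeriv_ae_eq ⟨hf, hf, fun η _ => by simp⟩

/-- Each integration by parts in x produces a factor κ and shifts the phase by π/2. The phase is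
harmless because all phases are bounded alike, hence the existential θ' in the induction. -/
theorem abs_pow_mul_coeff_le_fst {M m : ℕ} {f : ℝ × ℝ → ℝ} (h : MemW M 1 f) (hm : m ≤ M)
    (κ θ : ℝ) (k : ℕ) :
    |κ| ^ m * |coeff f κ θ k| ≤ (eLpNorm (weakDeriv m 0 f) 1 μ).toReal := by
  have hint : ∀ n, n ≤ M → Integrable (weakDeriv n 0 f) μ := fun n hn =>
    memLp_one_iff_integrable.1 (h.memLp (i := n) (j := 0) (by simpa using hn))
  have step : ∀ n, n ≤ M → ∀ θ, ∃ θ',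
      |κ| ^ n * |coeff f κ θ k| = |coeff (weakDeriv n 0 f) κ θ' k| := by
    intro n
    induction n with
    | zero =>
      intro _ θ
      refine ⟨θ, ?_⟩
      rw [pow_zero, one_mul]
      congr 1
      refine integral_congr_ae ?_
      filter_upwards [weakDeriv_zero_ae_eq (LocallyIntegrableOn.of_memLp le_rfl h.1)] with z hz
      rw [hz]
    | succ n ih =>
      intro hn θ
      obtain ⟨θ', hθ'⟩ := ih (by omega) θ
      refine ⟨θ' - Real.pi / 2, ?_⟩
      have H : IsWeakDeriv 1 0 (weakDeriv n 0 f) (weakDeriv (n + 1) 0 f) :=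
        (h.isWeakDeriv (i := n) (j := 0) (by omega)).of_comp_d1
          (h.isWeakDeriv (i := n + 1) (j := 0) (by omega))
      have hder : deriv (wave κ (θ' - Real.pi / 2)) = fun x => κ * wave κ θ' x := by
        rw [deriv_wave]
        simp
      have e := H.integral_prod_fst_of_bdd (hint n (by omega)) (hint (n + 1) hn)
        (contDiff_wave κ (θ' - Real.pi / 2)) (contDiff_sn k) (C := max 1 |κ|)
        (fun x => (abs_wave_le_one _ _ _).trans (le_max_left _ _))
        (fun x => by
          rw [hder, abs_mul]
          exact (mul_le_of_le_one_right (abs_nonneg _) (abs_wave_le_one _ _ _)).trans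
            (le_max_right _ _))
      have e' : coeff (weakDeriv (n + 1) 0 f) κ (θ' - Real.pi / 2) k
          = -(κ * coeff (weakDeriv n 0 f) κ θ' k) := by
        rw [coeff, e, hder, coeff, ← integral_const_mul]
        congr 2
        ext z
        ring
      rw [e', abs_neg, abs_mul, ← hθ']
      ring
  obtain ⟨θ', hθ'⟩ := step m hm θ
  rw [hθ']
  exact abs_integral_mul_le (hint m hm) fun z =>
    abs_mul_le_one (abs_wave_le_one _ _ _) (abs_sn_le_one _ _)

/-- Integration by parts in y alternates between sines and cosines. From even n to n + 1 the test
factor is a cosine, and the boundary term vanishes by the condition on ∂₂^n f in 𝔇; from odd n it is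
a sine, which vanishes itself. -/
theorem abs_pow_mul_integral_le_snd {M m : ℕ} {f : ℝ × ℝ → ℝ} (h : MemD M 1 f) (hm : m ≤ M)
    {g : ℝ → ℝ} (hg : ContDiff ℝ ∞ g) (hgc : HasCompactSupport g) (hg1 : ∀ x, |g x| ≤ 1)
    (k : ℕ) :
    (k * Real.pi) ^ m * |∫ z, f z * (g z.1 * sn k z.2) ∂μ|
      ≤ (eLpNorm (weakDeriv 0 m f) 1 μ).toReal := by
  have hint : ∀ n, n ≤ M → Integrable (weakDeriv 0 n f) μ := fun n hn =>
    memLp_one_iff_integrable.1 (h.1.memLp (i := 0) (j := n) (by simpa using hn))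
  have hk : 0 ≤ (k : ℝ) * Real.pi := by positivity
  have gtop : MemLp g ⊤ volume := memLp_of_compact hg.continuous hgc ⊤
  have step : ∀ n, n ≤ M → (k * Real.pi) ^ n * |∫ z, f z * (g z.1 * sn k z.2) ∂μ|
      = |∫ z, weakDeriv 0 n f z * (g z.1 * (if Even n then sn k else cs k) z.2) ∂μ| := by
    intro n
    induction n with
    | zero =>
      intro _
      simp only [pow_zero, one_mul, Even.zero, if_true]
      congr 1
      refine integral_congr_ae ?_
      filter_upwards [weakDeriv_zero_ae_eq (LocallyIntegrableOn.of_memLp le_rfl h.1.1)] with z hz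
      rw [hz]
    | succ n ih =>
      intro hn
      have ih := ih (by omega)
      have d0 := h.1.isWeakDeriv (i := 0) (j := n) (by omega)
      have d1 := h.1.isWeakDeriv (i := 0) (j := n + 1) (by omega)
      have H : IsWeakDeriv 0 1 (weakDeriv 0 n f) (weakDeriv 0 (n + 1) f) := d0.of_comp_d2 d1
      have i0 := integrable_mul_bdd_fst (hint n (by omega)) hg.continuous hg1
      have i1 := integrable_mul_bdd_fst (hint (n + 1) hn) hg.continuous hg1
      rw [pow_succ, mul_comm (_ ^ n), mul_assoc, ih]
      by_cases hev : Even n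
      · have hne : ¬ Even (n + 1) := by simpa [Nat.even_add_one] using hev
        rw [if_pos hev, if_neg hne]
        have e := (h.2 n hev (by omega)).integral_prod_snd (q := ⊤) hg (contDiff_cs k)
          (memLp_prod gtop (contDiff_cs k).continuous)
          (memLp_prod gtop ((contDiff_cs k).continuous_deriv (by simp)))
        have e1 : ∫ z, weakDeriv 0 (n + 1) f z * (g z.1 * cs k z.2) ∂μ
            = ∫ z, weakDeriv 0 1 (weakDeriv 0 n f) z * (g z.1 * cs k z.2) ∂μ := by
          refine integral_congr_ae ?_
          filter_upwards [H.weakDeriv_ae_eq] with z hz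
          rw [hz]
        rw [e1, e, abs_neg, ← abs_of_nonneg hk, ← abs_mul, ← integral_const_mul,
          ← abs_neg, ← integral_neg, deriv_cs]
        congr 2
        ext z
        ring
      · have hne : Even (n + 1) := by simpa [Nat.even_add_one] using hev
        rw [if_neg hev, if_pos hne]
        have e := H.integral_prod_snd hg hgc (contDiff_sn k) (fun y hy => abs_sn_le k hy) i1 i0
        rw [e, abs_neg, ← abs_of_nonneg hk, ← abs_mul, ← integral_const_mul,
          deriv_sn]
        congr 2
        ext z
        ring
  rw [step m hm]
  refine abs_integral_mul_le (hint m hm) fun z => abs_mul_le_one (hg1 _) ?_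
  split_ifs
  · exact abs_sn_le_one _ _
  · exact abs_cs_le_one _ _

/-- The compactly supported case is applied to the truncated wave, with a bound that does not depend
on the truncation. -/
theorem abs_pow_mul_coeff_le_snd {M m : ℕ} {f : ℝ × ℝ → ℝ} (h : MemD M 1 f) (hm : m ≤ M)
    (κ θ : ℝ) (k : ℕ) :
    (k * Real.pi) ^ m * |coeff f κ θ k| ≤ (eLpNorm (weakDeriv 0 m f) 1 μ).toReal := by
  have hf : Integrable f μ := memLp_one_iff_integrable.1 h.1.1
  have hint : Integrable (fun z => f z * (wave κ θ z.1 * sn k z.2)) μ :=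
    (integrable_mul_snd (integrable_mul_bdd_fst hf (contDiff_wave κ θ).continuous
      (abs_wave_le_one κ θ)) (contDiff_sn k).continuous).congr
      (ae_of_all _ fun z => mul_assoc _ _ _)
  have lim := ((tendsto_integral_wide hint).abs).const_mul ((k * Real.pi) ^ m)
  refine le_of_tendsto lim (Eventually.of_forall fun N => ?_)
  have := abs_pow_mul_integral_le_snd h hm (g := fun x => wave κ θ x * wide N x)
    ((contDiff_wave κ θ).mul (contDiff_wide N)) (hasCompactSupport_wide N).mul_left
    (fun x => abs_mul_le_one (abs_wave_le_one _ _ _) (abs_wide_le_one _ _)) k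
  refine le_of_eq_of_le ?_ this
  congr 3
  ext z
  ring

theorem le_sum_antidiagonal {m i j : ℕ} (w : ℕ × ℕ → ℝ≥0∞) (hij : i + j = m) :
    w (i, j) ≤ ∑ a ∈ Finset.HasAntidiagonal.antidiagonal m, w a :=
  Finset.single_le_sum (f := w) (fun _ _ => zero_le)
    (Finset.HasAntidiagonal.mem_antidiagonal.2 hij)

theorem eLpNorm_weakDeriv_le_normW {m : ℕ} {p : ℝ≥0∞} {f : ℝ × ℝ → ℝ} {i j : ℕ}
    (hij : i + j = m) : eLpNorm (weakDeriv i j f) p μ ≤ normW m p f := by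
  have := le_sum_antidiagonal (fun a => eLpNorm (weakDeriv a.1 a.2 f) p μ) hij
  rw [normW]
  exact this.trans le_add_self

theorem normW_lt_top {M m : ℕ} {p : ℝ≥0∞} {f : ℝ × ℝ → ℝ} (h : MemW M p f) (hm : m ≤ M) :
    normW m p f < ⊤ := by
  refine ENNReal.add_lt_top.2 ⟨h.1.2, ENNReal.sum_lt_top.2 fun a ha => ?_⟩
  rw [Finset.HasAntidiagonal.mem_antidiagonal] at ha
  exact (h.memLp (by omega)).2

theorem ell_le (κ : ℝ) (k : ℕ) : ell κ k ≤ |κ| + k * Real.pi := by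
  refine Real.sqrt_le_iff.2 ⟨by positivity, ?_⟩
  have : 0 ≤ |κ| * (k * Real.pi) := by positivity
  nlinarith [sq_abs κ]

theorem ell_nonneg (κ : ℝ) (k : ℕ) : 0 ≤ ell κ k := Real.sqrt_nonneg _

/-- Decay of the coefficients of functions in `𝔇^{m,1}`. -/
theorem ell_pow_mul_coeff_le {M m : ℕ} {f : ℝ × ℝ → ℝ} (h : MemD M 1 f) (hm : m ≤ M)
    (κ θ : ℝ) (k : ℕ) :
    ell κ k ^ m * |coeff f κ θ k| ≤ 2 ^ m * (normW m 1 f).toReal := by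
  have h1 := abs_pow_mul_coeff_le_fst h.1 hm κ θ k
  have h2 := abs_pow_mul_coeff_le_snd h hm κ θ k
  have hfin := (normW_lt_top h.1 hm).ne
  have n1 : (eLpNorm (weakDeriv m 0 f) 1 μ).toReal ≤ (normW m 1 f).toReal :=
    ENNReal.toReal_mono hfin (eLpNorm_weakDeriv_le_normW (by simp))
  have n2 : (eLpNorm (weakDeriv 0 m f) 1 μ).toReal ≤ (normW m 1 f).toReal :=
    ENNReal.toReal_mono hfin (eLpNorm_weakDeriv_le_normW (by simp))
  have hk : 0 ≤ (k : ℝ) * Real.pi := by positivity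
  -- Since L ≤ |κ| + kπ, it is at most twice the larger of the two; only the corresponding pure
  -- derivative is needed.
  rcases le_total |κ| (k * Real.pi) with hle | hle
  · have : ell κ k ≤ 2 * (k * Real.pi) := (ell_le κ k).trans (by linarith)
    calc ell κ k ^ m * |coeff f κ θ k| ≤ (2 * (k * Real.pi)) ^ m * |coeff f κ θ k| := by
          gcongr
          exact ell_nonneg κ k
      _ = 2 ^ m * ((k * Real.pi) ^ m * |coeff f κ θ k|) := by rw [mul_pow]; ring
      _ ≤ _ := by
          gcongr
          exact h2.trans n2
  · have : ell κ k ≤ 2 * |κ| := (ell_le κ k).trans (by linarith)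
    calc ell κ k ^ m * |coeff f κ θ k| ≤ (2 * |κ|) ^ m * |coeff f κ θ k| := by
          gcongr
          exact ell_nonneg κ k
      _ = 2 ^ m * (|κ| ^ m * |coeff f κ θ k|) := by rw [mul_pow]; ring
      _ ≤ _ := by
          gcongr
          exact h1.trans n1

/-! ### The Dirichlet problem -/

/-- A test function as an element of `L²`. -/
def IsTest.lp {η : ℝ × ℝ → ℝ} (h : IsTest η) : Lp ℝ 2 μ := (h.memLp 2).toLp η

theorem inner_eq_integral (u v : Lp ℝ 2 μ) : ⟪u, v⟫ = ∫ z, u z * v z ∂μ := by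
  rw [L2.inner_def]
  congr 1
  ext z
  simp [mul_comm]

theorem inner_toLp_eq_integral {f : ℝ × ℝ → ℝ} (hf : MemLp f 2 μ) (u : Lp ℝ 2 μ) :
    ⟪u, hf.toLp f⟫ = ∫ z, u z * f z ∂μ := by
  rw [inner_eq_integral]
  refine integral_congr_ae ?_
  filter_upwards [hf.coeFn_toLp] with z hz
  rw [hz]

theorem inner_toLp_toLp {f g : ℝ × ℝ → ℝ} (hf : MemLp f 2 μ) (hg : MemLp g 2 μ) :
    ⟪hf.toLp f, hg.toLp g⟫ = ∫ z, f z * g z ∂μ := by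
  rw [inner_toLp_eq_integral]
  refine integral_congr_ae ?_
  filter_upwards [hf.coeFn_toLp] with z hz
  rw [hz]

/-- The Poincaré inequality for test functions. -/
theorem IsTest.norm_lp_le {η : ℝ × ℝ → ℝ} (h : IsTest η) : ‖h.lp‖ ≤ 2 * ‖h.d2.lp‖ := by
  have hsnd : ContDiff ℝ ∞ (fun z : ℝ × ℝ => z.2) := contDiff_snd
  -- Integrating ∂₂(yη) η by parts gives ∫η² = -2∫ yη ∂₂η, and y ≤ 1 on the strip.
  have hy : IsTest (fun z => η z * z.2) := h.mul_smooth hsnd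
  have e : ∀ z, fderiv ℝ (fun z => η z * z.2) z (0, 1) = η z + z.2 * Strip.d2 η z := by
    intro z
    have h1 := (h.differentiable z).hasFDerivAt.mul (hasFDerivAt_snd (𝕜 := ℝ) (p := z))
    have h2 : HasFDerivAt (fun z : ℝ × ℝ => η z * z.2) _ z := h1
    rw [h2.fderiv]
    simp [Strip.d2]
  have hsq : ∀ {ζ ξ : ℝ × ℝ → ℝ}, IsTest ζ → IsTest ξ →
      Integrable (fun z => ζ z * ξ z) volume := fun hζ hξ => (hζ.mul_smooth hξ.smooth).integrable
  have ibp := integral_mul_fderiv_eq_neg_fderiv_mul_of_integrable (μ := volume) (𝕜 := ℝ)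
    (f := fun z : ℝ × ℝ => η z * z.2) (g := η) (v := ((0 : ℝ), (1 : ℝ)))
    (hsq (hy.d2) h) (hsq hy h.d2) (hsq hy h) (fun z _ => hy.differentiable z)
    (fun z _ => h.differentiable z)
  simp_rw [e] at ibp
  have i1 := hsq h h
  have i2 := hsq hy h.d2
  have ibp2 : ∫ z, η z * η z = -2 * ∫ z, η z * z.2 * Strip.d2 η z := by
    have e1 : ∫ z, (η z + z.2 * Strip.d2 η z) * η z
        = (∫ z, η z * η z) + ∫ z, η z * z.2 * Strip.d2 η z := by
      rw [← integral_add i1 i2]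
      congr 1
      ext z
      ring
    rw [e1] at ibp
    have e2 : ∫ z, η z * z.2 * fderiv ℝ η z (0, 1) = ∫ z, η z * z.2 * Strip.d2 η z := rfl
    linarith
  have key : ‖h.lp‖ ^ 2 ≤ 2 * (‖h.lp‖ * ‖h.d2.lp‖) := by
    rw [← real_inner_self_eq_norm_sq, IsTest.lp, inner_toLp_toLp, h.integral_eq_volume, ibp2]
    have e3 : ∫ z, η z * z.2 * Strip.d2 η z = ⟪hy.lp, h.d2.lp⟫ := by
      rw [IsTest.lp, IsTest.lp, inner_toLp_toLp, h.d2.integral_eq_volume]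
    have n1 : ‖hy.lp‖ ≤ ‖h.lp‖ := by
      refine Lp.norm_le_norm_of_ae_le ?_
      filter_upwards [(hy.memLp 2).coeFn_toLp, (h.memLp 2).coeFn_toLp, ae_mem_Ω] with z h1 h2 h3
      rw [IsTest.lp, IsTest.lp, h1, h2, norm_mul]
      refine mul_le_of_le_one_right (norm_nonneg _) ?_
      have := mem_Ω.1 h3
      rw [Real.norm_eq_abs, abs_le]
      constructor <;> linarith
    rw [e3]
    have n2 := abs_real_inner_le_norm hy.lp h.d2.lp
    have n3 := neg_abs_le ⟪hy.lp, h.d2.lp⟫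
    have n4 : ‖hy.lp‖ * ‖h.d2.lp‖ ≤ ‖h.lp‖ * ‖h.d2.lp‖ := by gcongr
    have : ‖h.lp‖ = ‖(h.memLp 2).toLp η‖ := rfl
    rw [← this]
    linarith
  by_contra! hlt
  have hpos : 0 < ‖h.lp‖ := lt_of_le_of_lt (by positivity) hlt
  nlinarith

/-- `ψ` is the weak solution of `-Δψ = ∂₁φ` with Dirichlet boundary values, with gradient
`(p₁, p₂)`. -/
structure IsWeakSol (φ ψ p₁ p₂ : Lp ℝ 2 μ) : Prop where
  approx : ∃ (u : ℕ → ℝ × ℝ → ℝ) (hu : ∀ n, IsTest (u n)),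
    Tendsto (fun n => (hu n).lp) atTop (𝓝 ψ) ∧ Tendsto (fun n => (hu n).d1.lp) atTop (𝓝 p₁) ∧
      Tendsto (fun n => (hu n).d2.lp) atTop (𝓝 p₂)
  eq : ∀ η (hη : IsTest η), ⟪p₁, hη.d1.lp⟫ + ⟪p₂, hη.d2.lp⟫ = -⟪φ, hη.d1.lp⟫

theorem IsTest.sub {η ζ : ℝ × ℝ → ℝ} (h : IsTest η) (k : IsTest ζ) :
    IsTest (fun z => η z + -1 * ζ z) := h.add (k.const_mul (-1))

theorem IsTest.lp_sub {η ζ : ℝ × ℝ → ℝ} (h : IsTest η) (k : IsTest ζ) :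
    (h.sub k).lp = h.lp - k.lp := by
  rw [IsTest.lp, IsTest.lp, IsTest.lp, ← MemLp.toLp_sub]
  refine MemLp.toLp_congr _ _ (ae_of_all _ fun z => ?_)
  simp only [Pi.sub_apply]
  ring

theorem IsTest.lp_congr {η ζ : ℝ × ℝ → ℝ} (h : IsTest η) (k : IsTest ζ) (e : η = ζ) :
    h.lp = k.lp := by
  subst e
  rfl

theorem IsWeakSol.sub {φ ψ p₁ p₂ φ' ψ' p₁' p₂' : Lp ℝ 2 μ} (h : IsWeakSol φ ψ p₁ p₂)
    (h' : IsWeakSol φ' ψ' p₁' p₂') : IsWeakSol (φ - φ') (ψ - ψ') (p₁ - p₁') (p₂ - p₂') := by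
  obtain ⟨u, hu, l0, l1, l2⟩ := h.approx
  obtain ⟨u', hu', l0', l1', l2'⟩ := h'.approx
  refine ⟨⟨fun n z => u n z + -1 * u' n z, fun n => (hu n).sub (hu' n), ?_, ?_, ?_⟩, ?_⟩
  · exact (l0.sub l0').congr fun n => (IsTest.lp_sub (hu n) (hu' n)).symm
  · have : ∀ n, ((hu n).sub (hu' n)).d1.lp = (hu n).d1.lp - (hu' n).d1.lp := by
      intro n
      rw [← IsTest.lp_sub]
      refine IsTest.lp_congr _ _ ?_
      rw [d1_add (hu n) ((hu' n).const_mul _), d1_const_mul (hu' n)]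
    exact (l1.sub l1').congr fun n => (this n).symm
  · have : ∀ n, ((hu n).sub (hu' n)).d2.lp = (hu n).d2.lp - (hu' n).d2.lp := by
      intro n
      rw [← IsTest.lp_sub]
      refine IsTest.lp_congr _ _ ?_
      rw [d2_add (hu n) ((hu' n).const_mul _), d2_const_mul (hu' n)]
    exact (l2.sub l2').congr fun n => (this n).symm
  · intro η hη
    have e := h.eq η hη
    have e' := h'.eq η hη
    simp only [inner_sub_left]
    linarith

/-- The energy estimate. -/
theorem IsWeakSol.bounds {φ ψ p₁ p₂ : Lp ℝ 2 μ} (h : IsWeakSol φ ψ p₁ p₂) :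
    ‖p₁‖ ≤ ‖φ‖ ∧ ‖ψ‖ ≤ 2 * ‖φ‖ := by
  obtain ⟨u, hu, l0, l1, l2⟩ := h.approx
  -- The equation is tested with the approximations of ψ itself.
  have e : ‖p₁‖ ^ 2 + ‖p₂‖ ^ 2 = -⟪φ, p₁⟫ := by
    have t1 : Tendsto (fun n => ⟪p₁, (hu n).d1.lp⟫ + ⟪p₂, (hu n).d2.lp⟫) atTop
        (𝓝 (⟪p₁, p₁⟫ + ⟪p₂, p₂⟫)) :=
      (tendsto_const_nhds.inner l1).add (tendsto_const_nhds.inner l2)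
    have t2 : Tendsto (fun n => -⟪φ, (hu n).d1.lp⟫) atTop (𝓝 (-⟪φ, p₁⟫)) :=
      (tendsto_const_nhds.inner l1).neg
    have t1 := t1.congr fun n => h.eq _ (hu n)
    rw [← real_inner_self_eq_norm_sq, ← real_inner_self_eq_norm_sq]
    exact tendsto_nhds_unique t1 t2
  have cs := abs_real_inner_le_norm φ p₁
  have cs' := neg_abs_le ⟪φ, p₁⟫
  have b1 : ‖p₁‖ ≤ ‖φ‖ := by
    by_contra! hlt
    have : 0 < ‖p₁‖ := lt_of_le_of_lt (norm_nonneg _) hlt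
    nlinarith [sq_nonneg ‖p₂‖]
  have b2 : ‖p₂‖ ≤ ‖φ‖ := by
    have : ‖φ‖ * ‖p₁‖ ≤ ‖φ‖ * ‖φ‖ := by gcongr
    refine abs_le_of_sq_le_sq' ?_ (norm_nonneg _) |>.2
    nlinarith [sq_nonneg ‖p₁‖]
  refine ⟨b1, ?_⟩
  have b3 : ‖ψ‖ ≤ 2 * ‖p₂‖ :=
    le_of_tendsto_of_tendsto' l0.norm (l2.norm.const_mul 2) fun n => (hu n).norm_lp_le
  linarith

theorem tendsto_toLp_of_tendsto_eLpNorm {u : ℕ → ℝ × ℝ → ℝ} (hu : ∀ n, IsTest (u n))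
    {f : ℝ × ℝ → ℝ} (hf : MemLp f 2 μ)
    (h : Tendsto (fun n => eLpNorm (fun z => u n z - f z) 2 μ) atTop (𝓝 0)) :
    Tendsto (fun n => (hu n).lp) atTop (𝓝 (hf.toLp f)) :=
  (Lp.tendsto_Lp_iff_tendsto_eLpNorm'' _ (fun n => (hu n).memLp 2) _ hf).2 h

/-- In the weak formulation the derivative ∂₁ falls on the test function, so that the energy
estimate bounds ∂₁ψ by φ rather than by ∂₁φ. -/
theorem IsInvNegLap.isWeakSol {φ : Lp ℝ 2 μ} {ψ : ℝ × ℝ → ℝ} (hφ : MemW 1 2 φ)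
    (h : IsInvNegLap (weakDeriv 1 0 φ) ψ) :
    IsWeakSol φ (h.memH2.1.toLp ψ)
      ((h.memH2.memLp (i := 1) (j := 0) (by norm_num)).toLp (weakDeriv 1 0 ψ))
      ((h.memH2.memLp (i := 0) (j := 1) (by norm_num)).toLp (weakDeriv 0 1 ψ)) := by
  obtain ⟨-, u, hu, l0, l1, l2⟩ := h.memH10
  refine ⟨⟨u, hu, tendsto_toLp_of_tendsto_eLpNorm hu _ l0,
    tendsto_toLp_of_tendsto_eLpNorm (fun n => (hu n).d1) _ l1,
    tendsto_toLp_of_tendsto_eLpNorm (fun n => (hu n).d2) _ l2⟩, fun η hη => ?_⟩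
  have d10 := h.memH2.isWeakDeriv (i := 1) (j := 0) (by norm_num)
  have d20 := h.memH2.isWeakDeriv (i := 2) (j := 0) (by norm_num)
  have d01 := h.memH2.isWeakDeriv (i := 0) (j := 1) (by norm_num)
  have d02 := h.memH2.isWeakDeriv (i := 0) (j := 2) (by norm_num)
  have w20 := h.memH2.memLp (i := 2) (j := 0) (by norm_num)
  have w02 := h.memH2.memLp (i := 0) (j := 2) (by norm_num)
  have a1 := (IsWeakDeriv.of_comp_d1 (i := 1) (j := 0) d10 d20).integral_eq η hη
  have a2 := (IsWeakDeriv.of_comp_d2 (j := 1) d01 d02).integral_eq η hη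
  have a3 := (hφ.isWeakDeriv (i := 1) (j := 0) (by norm_num)).integral_eq η hη
  simp only [Function.iterate_one, Function.iterate_zero, id_eq, add_zero, zero_add, pow_one,
    neg_one_mul] at a1 a2 a3
  rw [IsTest.lp, IsTest.lp, inner_toLp_toLp, inner_toLp_toLp, inner_toLp_eq_integral, a1, a2, a3]
  have i1 := integrable_mul₂ w20 (hη.memLp 2)
  have i2 := integrable_mul₂ w02 (hη.memLp 2)
  rw [← neg_add, ← integral_add i1 i2, neg_neg, ← integral_neg]
  refine integral_congr_ae ?_
  filter_upwards [h.eq] with z hz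
  rw [← hz, lap]
  ring

/-- Multiplication of the Dirichlet problem by a mode. -/
theorem IsInvNegLap.integral_mode {φ ψ : ℝ × ℝ → ℝ} (hφ : MemW 1 2 φ)
    (h : IsInvNegLap (weakDeriv 1 0 φ) ψ) {g : ℝ → ℝ} (hg : ContDiff ℝ ∞ g)
    (hgc : HasCompactSupport g) (k : ℕ) :
    (k * Real.pi) ^ 2 * (∫ z, ψ z * (g z.1 * sn k z.2) ∂μ)
        - (∫ z, ψ z * (deriv (deriv g) z.1 * sn k z.2) ∂μ)
      = -∫ z, φ z * (deriv g z.1 * sn k z.2) ∂μ := by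
  have hg' : ContDiff ℝ ∞ (deriv g) := (contDiff_infty_iff_deriv.1 hg).2
  have m0 := memLp_of_compact hg.continuous hgc 2
  have m1 := memLp_of_compact hg'.continuous hgc.deriv 2
  have e1 := integral_lap_mul h.memH2 h.memH10 hg hgc k
  have e2 := (hφ.isWeakDeriv (i := 1) (j := 0) (by norm_num)).integral_prod_fst hg hgc
    (contDiff_sn k) (integrable_mul_fst (hφ.memLp (i := 1) (j := 0) (by norm_num)) m0)
    (integrable_mul_fst hφ.1 m1)
  have e3 : ∫ z, lap ψ z * (g z.1 * sn k z.2) ∂μ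
      = -∫ z, weakDeriv 1 0 φ z * (g z.1 * sn k z.2) ∂μ := by
    rw [← integral_neg]
    refine integral_congr_ae ?_
    filter_upwards [h.eq] with z hz
    rw [← hz]
    ring
  linarith

/-! ### The equation for the modes of a solution -/

/-- The pairing of a function on the strip with `g(x) sin (k π y)`. -/
def pairing (u : ℝ × ℝ → ℝ) (g : ℝ → ℝ) (k : ℕ) : ℝ := ∫ z, u z * (g z.1 * sn k z.2) ∂μ

theorem memLp_mode {g : ℝ → ℝ} (hg : MemLp g 2 volume) (k : ℕ) :
    MemLp (fun z : ℝ × ℝ => g z.1 * sn k z.2) 2 μ := memLp_prod hg (contDiff_sn k).continuous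

theorem pairing_eq_inner (u : Lp ℝ 2 μ) {g : ℝ → ℝ} (hg : MemLp g 2 volume) (k : ℕ) :
    pairing u g k = ⟪u, (memLp_mode hg k).toLp _⟫ := (inner_toLp_eq_integral _ u).symm

theorem norm_mode_le {g : ℝ → ℝ} (hg : MemLp g 2 volume) (k : ℕ) :
    ‖(memLp_mode hg k).toLp _‖ ≤ (eLpNorm g 2 volume).toReal := by
  rw [Lp.norm_toLp]
  exact ENNReal.toReal_mono hg.2.ne (eLpNorm_prod_le hg.1 (abs_sn_le_one k))

theorem abs_pairing_le (u : Lp ℝ 2 μ) {g : ℝ → ℝ} (hg : MemLp g 2 volume) (k : ℕ) :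
    |pairing u g k| ≤ ‖u‖ * (eLpNorm g 2 volume).toReal := by
  rw [pairing_eq_inner u hg k]
  refine (abs_real_inner_le_norm _ _).trans ?_
  gcongr
  exact norm_mode_le hg k

theorem pairing_congr {u v : ℝ × ℝ → ℝ} (h : u =ᵐ[μ] v) (g : ℝ → ℝ) (k : ℕ) :
    pairing u g k = pairing v g k := by
  refine integral_congr_ae ?_
  filter_upwards [h] with z hz
  rw [hz]

theorem pairing_add_right (u : Lp ℝ 2 μ) {g h : ℝ → ℝ} (hg : MemLp g 2 volume)
    (hh : MemLp h 2 volume) (k : ℕ) :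
    pairing u (fun x => g x + h x) k = pairing u g k + pairing u h k := by
  rw [pairing, pairing, pairing, ← integral_add (integrable_mul₂ (Lp.memLp u) (memLp_mode hg k))
    (integrable_mul₂ (Lp.memLp u) (memLp_mode hh k))]
  congr 1
  ext z
  ring

theorem pairing_const_mul_right (u : ℝ × ℝ → ℝ) (c : ℝ) (g : ℝ → ℝ) (k : ℕ) :
    pairing u (fun x => c * g x) k = c * pairing u g k := by
  rw [pairing, pairing, ← integral_const_mul]
  congr 1
  ext z
  ring

/-- Integration against a bounded continuous function, as a functional on `L¹`. -/
def pairL1 (w : ℝ × ℝ → ℝ) (hw : Continuous w) (C : ℝ) (hC : ∀ z, |w z| ≤ C) :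
    Lp ℝ 1 μ →L[ℝ] ℝ :=
  LinearMap.mkContinuous
    { toFun := fun u => ∫ z, u z * w z ∂μ
      map_add' := fun u v => by
        have i : ∀ u : Lp ℝ 1 μ, Integrable (fun z => u z * w z) μ := fun u =>
          (L1.integrable_coeFn u).mul_bdd hw.aestronglyMeasurable (ae_of_all _ hC)
        rw [← integral_add (i u) (i v)]
        refine integral_congr_ae ?_
        filter_upwards [Lp.coeFn_add u v] with z hz
        rw [hz, Pi.add_apply, add_mul]
      map_smul' := fun c u => by
        rw [RingHom.id_apply, smul_eq_mul, ← integral_const_mul]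
        refine integral_congr_ae ?_
        filter_upwards [Lp.coeFn_smul c u] with z hz
        rw [hz, Pi.smul_apply, smul_eq_mul, mul_assoc] }
    C fun u => by
      have : ‖u‖ = ∫ z, ‖u z‖ ∂μ := L1.norm_eq_integral_norm u
      rw [this, ← integral_const_mul]
      refine norm_integral_le_of_norm_le ((L1.integrable_coeFn u).norm.const_mul C)
        (ae_of_all _ fun z => ?_)
      rw [norm_mul, mul_comm]
      exact mul_le_mul_of_nonneg_right (hC z) (norm_nonneg _)

theorem pairL1_apply (w : ℝ × ℝ → ℝ) (hw : Continuous w) (C : ℝ) (hC : ∀ z, |w z| ≤ C)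
    (u : Lp ℝ 1 μ) : pairL1 w hw C hC u = ∫ z, u z * w z ∂μ := rfl

theorem norm_pairL1_le (w : ℝ × ℝ → ℝ) (hw : Continuous w) (C : ℝ) (hC : ∀ z, |w z| ≤ C)
    (u : Lp ℝ 1 μ) : |∫ z, u z * w z ∂μ| ≤ C * ‖u‖ := by
  have hC0 : 0 ≤ C := (abs_nonneg _).trans (hC 0)
  rw [← pairL1_apply w hw C hC, ← Real.norm_eq_abs]
  exact ((pairL1 w hw C hC).le_opNorm u).trans
    (mul_le_mul_of_nonneg_right (LinearMap.mkContinuous_norm_le _ hC0 _) (norm_nonneg _))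

/-- Local boundedness of a curve in `L¹`. -/
structure IsBddCurve (F : ℝ → Lp ℝ 1 μ) (B : ℝ) : Prop where
  meas : AEStronglyMeasurable F (volume.restrict (Ioi 0))
  bound : ∀ᵐ t ∂(volume.restrict (Ioi (0 : ℝ))), ‖F t‖ ≤ B

theorem restrict_Ioc_le (t : ℝ) : volume.restrict (Ioc (0 : ℝ) t) ≤ volume.restrict (Ioi 0) :=
  Measure.restrict_mono Ioc_subset_Ioi_self le_rfl

theorem IsBddCurve.intervalIntegrable {F : ℝ → Lp ℝ 1 μ} {B : ℝ} (h : IsBddCurve F B)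
    {w : ℝ × ℝ → ℝ} (hw : Continuous w) {C : ℝ} (hC : ∀ z, |w z| ≤ C) {t : ℝ} (ht : 0 ≤ t) :
    IntervalIntegrable (fun τ => ∫ z, F τ z * w z ∂μ) volume 0 t := by
  rw [intervalIntegrable_iff_integrableOn_Ioc_of_le ht]
  refine (integrable_const (C * B)).mono' ?_ ?_
  · exact ((pairL1 w hw C hC).continuous.comp_aestronglyMeasurable h.meas).mono_measure
      (restrict_Ioc_le t)
  · refine ae_mono (restrict_Ioc_le t) ?_
    have hC0 : 0 ≤ C := (abs_nonneg _).trans (hC 0)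
    filter_upwards [h.bound] with τ hτ
    exact (norm_pairL1_le w hw C hC (F τ)).trans (by gcongr)

namespace IsSolution

variable {ν : ℝ} {φ₀ φ₁ : ℝ × ℝ → ℝ} {F : ℝ → Lp ℝ 1 μ} {φ : ℝ → Lp ℝ 2 μ}

theorem hasDerivWithinAt (sol : IsSolution ν φ₀ φ₁ F φ) {t : ℝ} (ht : 0 ≤ t) :
    HasDerivWithinAt φ (dt φ t) (Ici 0) t :=
  ((sol.contDiff.differentiableOn (by simp)) t ht).hasDerivWithinAt

theorem continuousOn (sol : IsSolution ν φ₀ φ₁ F φ) : ContinuousOn φ (Ici 0) :=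
  sol.contDiff.continuousOn

theorem continuousOn_dt (sol : IsSolution ν φ₀ φ₁ F φ) : ContinuousOn (dt φ) (Ici 0) :=
  sol.contDiff.continuousOn_derivWithin (uniqueDiffOn_Ici 0) le_rfl

/-- The field `∂₁ψ`, as a continuous curve in `L²`. -/
theorem exists_gradient (sol : IsSolution ν φ₀ φ₁ F φ) :
    ∃ ψ P : ℝ → Lp ℝ 2 μ, ContinuousOn P (Ici 0) ∧ (∀ t, 0 ≤ t → ‖ψ t‖ ≤ 2 * ‖φ t‖) ∧
      (∀ t, 0 ≤ t → ∀ g : ℝ → ℝ, ContDiff ℝ ∞ g → HasCompactSupport g → ∀ k,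
        pairing (P t) g k = -pairing (ψ t) (deriv g) k ∧
        (k * Real.pi) ^ 2 * pairing (ψ t) g k - pairing (ψ t) (deriv (deriv g)) k
          = -pairing (φ t) (deriv g) k) ∧
      ∀ η : ℝ × ℝ → ℝ, IsTest η → ∀ t, 0 ≤ t →
        (∫ z, dt φ t z * η z ∂μ) - (∫ z, dt φ 0 z * η z ∂μ)
          - ν * ((∫ z, lap (φ t) z * η z ∂μ) - ∫ z, lap (φ 0) z * η z ∂μ)
          - (∫ τ in (0 : ℝ)..t, ∫ z, P τ z * η z ∂μ)
        = ∫ τ in (0 : ℝ)..t, ∫ z, F τ z * η z ∂μ := by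
  obtain ⟨ψ, hψ, heq⟩ := sol.equation
  have hW1 : ∀ t, 0 ≤ t → MemW 1 2 (φ t) := fun t ht =>
    ⟨(sol.memH2 t ht).1, fun i j hij => (sol.memH2 t ht).2 i j (by omega)⟩
  have hmem : ∀ t, 0 ≤ t → MemLp (ψ t) 2 μ := fun t ht => (hψ t ht).memH2.1
  have hmem1 : ∀ t, 0 ≤ t → MemLp (weakDeriv 1 0 (ψ t)) 2 μ := fun t ht =>
    (hψ t ht).memH2.memLp (i := 1) (j := 0) (by norm_num)
  let Ψ : ℝ → Lp ℝ 2 μ := fun t => if ht : 0 ≤ t then (hmem t ht).toLp (ψ t) else 0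
  let P : ℝ → Lp ℝ 2 μ := fun t => if ht : 0 ≤ t then (hmem1 t ht).toLp (weakDeriv 1 0 (ψ t)) else 0
  have hΨ : ∀ t, 0 ≤ t → Ψ t =ᵐ[μ] ψ t := fun t ht => by
    simp only [Ψ, dif_pos ht]
    exact MemLp.coeFn_toLp _
  have hP : ∀ t, 0 ≤ t → P t =ᵐ[μ] weakDeriv 1 0 (ψ t) := fun t ht => by
    simp only [P, dif_pos ht]
    exact MemLp.coeFn_toLp _
  have hws : ∀ t, 0 ≤ t → ∃ p₂, IsWeakSol (φ t) (Ψ t) (P t) p₂ := fun t ht => by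
    simp only [Ψ, P, dif_pos ht]
    exact ⟨_, (hψ t ht).isWeakSol (hW1 t ht)⟩
  refine ⟨Ψ, P, ?_, ?_, ?_, ?_⟩
  -- Continuity of ∂₁ψ in time is not assumed; it follows from that of φ by the energy estimate for
  -- the difference of two times.
  · intro t ht
    refine tendsto_iff_norm_sub_tendsto_zero.2 ?_
    have l := tendsto_iff_norm_sub_tendsto_zero.1 (sol.continuousOn t ht)
    refine squeeze_zero' (Eventually.of_forall fun _ => norm_nonneg _) ?_ l
    filter_upwards [self_mem_nhdsWithin] with τ hτ
    obtain ⟨p, hp⟩ := hws t ht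
    obtain ⟨p', hp'⟩ := hws τ hτ
    exact (hp'.sub hp).bounds.1
  · intro t ht
    obtain ⟨p, hp⟩ := hws t ht
    exact hp.bounds.2
  · intro t ht g hg hgc k
    have hg' : ContDiff ℝ ∞ (deriv g) := (contDiff_infty_iff_deriv.1 hg).2
    rw [pairing_congr (hP t ht), pairing_congr (hΨ t ht), pairing_congr (hΨ t ht),
      pairing_congr (hΨ t ht)]
    refine ⟨?_, (hψ t ht).integral_mode (hW1 t ht) hg hgc k⟩
    exact ((hψ t ht).memH2.isWeakDeriv (i := 1) (j := 0) (by norm_num)).integral_prod_fst hg hgc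
      (contDiff_sn k)
      (integrable_mul_fst (hmem1 t ht) (memLp_of_compact hg.continuous hgc 2))
      (integrable_mul_fst (hmem t ht) (memLp_of_compact hg'.continuous hgc.deriv 2))
  · intro η hη t ht
    rw [← heq η hη t ht]
    congr 1
    refine intervalIntegral.integral_congr fun τ hτ => ?_
    rw [uIcc_of_le ht] at hτ
    refine integral_congr_ae ?_
    filter_upwards [hP τ hτ.1] with z hz
    rw [hz]

/-- The mode g(x) sin(kπy) is not compactly supported in the strip. The equation is tested with its
product with `cut n`, the limit is taken by dominated convergence in space and in time, and the
Laplacian is moved onto the mode only afterwards, where no derivative of the cutoff appears. -/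
theorem modal_equation (sol : IsSolution ν φ₀ φ₁ F φ) {B : ℝ} (hF : IsBddCurve F B)
    {P : ℝ → Lp ℝ 2 μ} (hP : ContinuousOn P (Ici 0))
    (heq : ∀ η : ℝ × ℝ → ℝ, IsTest η → ∀ t, 0 ≤ t →
        (∫ z, dt φ t z * η z ∂μ) - (∫ z, dt φ 0 z * η z ∂μ)
          - ν * ((∫ z, lap (φ t) z * η z ∂μ) - ∫ z, lap (φ 0) z * η z ∂μ)
          - (∫ τ in (0 : ℝ)..t, ∫ z, P τ z * η z ∂μ)
        = ∫ τ in (0 : ℝ)..t, ∫ z, F τ z * η z ∂μ)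
    {g : ℝ → ℝ} (hg : ContDiff ℝ ∞ g) (hgc : HasCompactSupport g) (k : ℕ) {t : ℝ} (ht : 0 ≤ t) :
    pairing (dt φ t) g k - pairing (dt φ 0) g k
        - ν * ((pairing (φ t) (deriv (deriv g)) k - (k * Real.pi) ^ 2 * pairing (φ t) g k)
          - (pairing (φ 0) (deriv (deriv g)) k - (k * Real.pi) ^ 2 * pairing (φ 0) g k))
        - (∫ τ in (0 : ℝ)..t, pairing (P τ) g k)
      = ∫ τ in (0 : ℝ)..t, pairing (F τ) g k := by
  have m0 := memLp_of_compact hg.continuous hgc 2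
  have hG := memLp_mode m0 k
  have hGc : Continuous (fun z : ℝ × ℝ => g z.1 * sn k z.2) :=
    (hg.continuous.comp continuous_fst).mul ((contDiff_sn k).continuous.comp continuous_snd)
  obtain ⟨C, hC⟩ := hgc.exists_bound_of_continuous hg.continuous
  have hC0 : 0 ≤ C := (norm_nonneg _).trans (hC 0)
  have hGC : ∀ z : ℝ × ℝ, |g z.1 * sn k z.2| ≤ C := fun z => by
    rw [abs_mul]
    exact (mul_le_of_le_one_right (abs_nonneg _) (abs_sn_le_one _ _)).trans (hC _)
  have hcc : ∀ n, Continuous (fun z : ℝ × ℝ => g z.1 * sn k z.2 * cut n z.2) := fun n =>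
    hGc.mul ((contDiff_cut n).continuous.comp continuous_snd)
  have hcC : ∀ n, ∀ z : ℝ × ℝ, |g z.1 * sn k z.2 * cut n z.2| ≤ C := fun n z => by
    rw [abs_mul]
    exact (mul_le_of_le_one_right (abs_nonneg _) (abs_cut_le _ _)).trans (hGC _)
  have htest : ∀ n, IsTest (fun z : ℝ × ℝ => g z.1 * sn k z.2 * cut n z.2) := by
    intro n
    have := isTest_prod (s := fun y => sn k y * cut n y) hg hgc
      ((contDiff_sn k).mul (contDiff_cut n)) (hasCompactSupport_cut n).mul_left
      ((tsupport_mul_subset_right (f := sn k)).trans (tsupport_cut_subset n))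
    convert this using 2
    ring
  have lim2 : ∀ u : ℝ × ℝ → ℝ, MemLp u 2 μ →
      Tendsto (fun n => ∫ z, u z * (g z.1 * sn k z.2 * cut n z.2) ∂μ) atTop
        (𝓝 (pairing u g k)) := by
    intro u hu
    refine (tendsto_integral_cut (integrable_mul₂ hu hG)).congr fun n => ?_
    congr 1
    ext z
    ring
  have lim1 : ∀ u : Lp ℝ 1 μ,
      Tendsto (fun n => ∫ z, u z * (g z.1 * sn k z.2 * cut n z.2) ∂μ) atTop
        (𝓝 (pairing u g k)) := by
    intro u
    have hint : Integrable (fun z => u z * (g z.1 * sn k z.2)) μ :=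
      (L1.integrable_coeFn u).mul_bdd hGc.aestronglyMeasurable (ae_of_all _ hGC)
    refine (tendsto_integral_cut hint).congr fun n => ?_
    congr 1
    ext z
    ring
  have hlap : ∀ t, 0 ≤ t → MemLp (lap (φ t)) 2 μ := fun t ht =>
    ((sol.memH2 t ht).memLp (i := 2) (j := 0) (by norm_num)).add
      ((sol.memH2 t ht).memLp (i := 0) (j := 2) (by norm_num))
  have hlapeq : ∀ t, 0 ≤ t → pairing (lap (φ t)) g k
      = pairing (φ t) (deriv (deriv g)) k - (k * Real.pi) ^ 2 * pairing (φ t) g k := fun t ht =>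
    integral_lap_mul (sol.memH2 t ht) (sol.boundary t ht) hg hgc k
  rw [← hlapeq t ht, ← hlapeq 0 le_rfl]
  have hPt : ContinuousOn P (uIcc 0 t) := by
    rw [uIcc_of_le ht]
    exact hP.mono Icc_subset_Ici_self
  have limP : Tendsto (fun n => ∫ τ in (0 : ℝ)..t, ∫ z, P τ z * (g z.1 * sn k z.2 * cut n z.2) ∂μ)
      atTop (𝓝 (∫ τ in (0 : ℝ)..t, pairing (P τ) g k)) := by
    refine intervalIntegral.tendsto_integral_filter_of_dominated_convergence
      (fun τ => ‖P τ‖ * ‖hG.toLp _‖) (Eventually.of_forall fun n => ?_)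
      (Eventually.of_forall fun n => ae_of_all _ fun τ _ => ?_) ?_
      (ae_of_all _ fun τ _ => lim2 _ (Lp.memLp (P τ)))
    · have : ContinuousOn (fun τ => ∫ z, P τ z * (g z.1 * sn k z.2 * cut n z.2) ∂μ) (uIcc 0 t) := by
        simp_rw [← inner_toLp_eq_integral ((htest n).memLp 2)]
        exact hPt.inner continuousOn_const
      exact (this.mono uIoc_subset_uIcc).aestronglyMeasurable measurableSet_uIoc
    · rw [← inner_toLp_eq_integral ((htest n).memLp 2)]
      refine (norm_inner_le_norm _ _).trans ?_
      gcongr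
      refine Lp.norm_le_norm_of_ae_le ?_
      filter_upwards [((htest n).memLp 2).coeFn_toLp, hG.coeFn_toLp] with z h1 h2
      rw [h1, h2, norm_mul]
      exact mul_le_of_le_one_right (norm_nonneg _) (abs_cut_le _ _)
    · exact ContinuousOn.intervalIntegrable (hPt.norm.mul continuousOn_const)
  have limF : Tendsto (fun n => ∫ τ in (0 : ℝ)..t, ∫ z, F τ z * (g z.1 * sn k z.2 * cut n z.2) ∂μ)
      atTop (𝓝 (∫ τ in (0 : ℝ)..t, pairing (F τ) g k)) := by
    refine intervalIntegral.tendsto_integral_filter_of_dominated_convergence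
      (fun τ => C * B) (Eventually.of_forall fun n => ?_)
      (Eventually.of_forall fun n => ?_) intervalIntegrable_const
      (ae_of_all _ fun τ _ => lim1 (F τ))
    · exact (hF.intervalIntegrable (hcc n) (hcC n) ht).def'.1
    · have hb := (ae_restrict_iff' measurableSet_Ioi).1 hF.bound
      filter_upwards [hb] with τ hτ hτ'
      rw [uIoc_of_le ht] at hτ'
      exact (norm_pairL1_le _ (hcc n) C (hcC n) (F τ)).trans
        (mul_le_mul_of_nonneg_left (hτ hτ'.1) hC0)
  have hL := (((lim2 _ (Lp.memLp (dt φ t))).sub (lim2 _ (Lp.memLp (dt φ 0)))).sub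
    (((lim2 _ (hlap t ht)).sub (lim2 _ (hlap 0 le_rfl))).const_mul ν)).sub limP
  exact tendsto_nhds_unique (hL.congr fun n => heq _ (htest n) t ht) limF

end IsSolution

/-! ### Wave packets -/

/-- The horizontal wave `cos (κ x + θ)` with a wide cutoff. -/
def packet (κ θ : ℝ) (N : ℕ) (x : ℝ) : ℝ := wave κ θ x * wide N x

theorem contDiff_packet (κ θ : ℝ) (N : ℕ) : ContDiff ℝ ∞ (packet κ θ N) :=
  (contDiff_wave κ θ).mul (contDiff_wide N)

theorem hasCompactSupport_packet (κ θ : ℝ) (N : ℕ) : HasCompactSupport (packet κ θ N) :=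
  (hasCompactSupport_wide N).mul_left

/-- The defect of a packet as an eigenfunction of `∂₁²`. -/
def defect (κ θ : ℝ) (N : ℕ) (x : ℝ) : ℝ :=
  deriv (deriv (packet κ θ N)) x + κ ^ 2 * packet κ θ N x

theorem contDiff_defect (κ θ : ℝ) (N : ℕ) : ContDiff ℝ ∞ (defect κ θ N) :=
  ((contDiff_infty_iff_deriv.1 (contDiff_infty_iff_deriv.1 (contDiff_packet κ θ N)).2).2).add
    (contDiff_const.mul (contDiff_packet κ θ N))

theorem hasCompactSupport_defect (κ θ : ℝ) (N : ℕ) : HasCompactSupport (defect κ θ N) :=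
  (hasCompactSupport_packet κ θ N).deriv.deriv.add (hasCompactSupport_packet κ θ N).mul_left

/-- The rescaled `j`-th derivative of the cutoff function. -/
def wideD (j : ℕ) (N : ℕ) (x : ℝ) : ℝ :=
  (1 / ((N : ℝ) + 1)) ^ j * deriv^[j] bump (x * (1 / ((N : ℝ) + 1)))

theorem contDiff_deriv_iterate_bump (j : ℕ) : ContDiff ℝ ∞ (deriv^[j] bump) := by
  induction j with
  | zero => exact contDiff_bump
  | succ n ih => rw [Function.iterate_succ_apply']; exact (contDiff_infty_iff_deriv.1 ih).2

theorem hasCompactSupport_deriv_iterate_bump (j : ℕ) : HasCompactSupport (deriv^[j] bump) := by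
  induction j with
  | zero => exact hasCompactSupport_bump
  | succ n ih => rw [Function.iterate_succ_apply']; exact ih.deriv

theorem wideD_zero (N : ℕ) : wideD 0 N = wide N := by
  ext x
  simp [wideD, wide]

theorem hasDerivAt_wideD (j N : ℕ) (x : ℝ) : HasDerivAt (wideD j N) (wideD (j + 1) N x) x := by
  have h1 : HasDerivAt (fun x : ℝ => x * (1 / ((N : ℝ) + 1))) (1 / ((N : ℝ) + 1)) x := by
    simpa using (hasDerivAt_id x).mul_const (1 / ((N : ℝ) + 1))
  have h2 := (((contDiff_deriv_iterate_bump j).differentiable (by simp)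
    (x * (1 / ((N : ℝ) + 1)))).hasDerivAt.comp x h1).const_mul ((1 / ((N : ℝ) + 1)) ^ j)
  refine h2.congr_deriv ?_
  rw [wideD, Function.iterate_succ_apply']
  ring

/-- Three derivatives suffice: the defect contains two, and its derivative, which arises when ∂₁ψ is
tested, contains a third. -/
theorem exists_bound_wideD : ∃ B, 0 ≤ B ∧ ∀ j, 1 ≤ j → j ≤ 3 → ∀ N x,
    |wideD j N x| ≤ B * (1 / ((N : ℝ) + 1)) := by
  have h := fun j => (hasCompactSupport_deriv_iterate_bump j).exists_bound_of_continuous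
    (contDiff_deriv_iterate_bump j).continuous
  choose C hC using h
  have hC0 : ∀ j, 0 ≤ C j := fun j => (norm_nonneg _).trans (hC j 0)
  refine ⟨C 1 + C 2 + C 3, by linarith [hC0 1, hC0 2, hC0 3], fun j hj1 hj3 N x => ?_⟩
  have hε : 0 < 1 / ((N : ℝ) + 1) := by positivity
  have hε1 : 1 / ((N : ℝ) + 1) ≤ 1 := by
    rw [div_le_one (by positivity)]
    linarith [(Nat.cast_nonneg N : (0 : ℝ) ≤ N)]
  have hCj : C j ≤ C 1 + C 2 + C 3 := by
    interval_cases j <;> linarith [hC0 1, hC0 2, hC0 3]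
  rw [wideD, abs_mul, abs_of_pos (pow_pos hε j), mul_comm]
  have hp : (1 / ((N : ℝ) + 1)) ^ j ≤ 1 / ((N : ℝ) + 1) := by
    simpa using pow_le_pow_of_le_one hε.le hε1 hj1
  exact mul_le_mul ((hC j _).trans hCj) hp (pow_pos hε j).le
    (by linarith [hC0 1, hC0 2, hC0 3])

theorem wideD_eq_zero (j N : ℕ) {x : ℝ} (hx : 2 * ((N : ℝ) + 1) < |x|) : wideD j N x = 0 := by
  have hN : (0 : ℝ) < N + 1 := by positivity
  have h2 : ∀ j, ∀ x : ℝ, 2 < |x| → deriv^[j] bump x = 0 := by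
    intro j
    induction j with
    | zero => exact fun x hx => bump_eq_zero hx
    | succ n ih =>
      intro x hx
      rw [Function.iterate_succ_apply']
      have : deriv^[n] bump =ᶠ[𝓝 x] fun _ => 0 := by
        filter_upwards [(isOpen_lt continuous_const continuous_abs).mem_nhds hx] with y hy
        exact ih y hy
      rw [this.deriv_eq, deriv_const]
  rw [wideD, h2, mul_zero]
  rw [abs_mul, abs_of_pos (by positivity : 0 < 1 / ((N : ℝ) + 1)), mul_one_div, lt_div_iff₀ hN]
  exact hx

theorem wave_add_pi (κ θ x : ℝ) : wave κ (θ + Real.pi / 2 + Real.pi / 2) x = -wave κ θ x := by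
  rw [wave, wave, add_assoc, add_halves, ← add_assoc, Real.cos_add_pi]

theorem deriv_packet (κ θ : ℝ) (N : ℕ) : deriv (packet κ θ N) =
    fun x => κ * wave κ (θ + Real.pi / 2) x * wideD 0 N x + wave κ θ x * wideD 1 N x := by
  ext x
  have e : packet κ θ N = fun x => wave κ θ x * wideD 0 N x := by rw [wideD_zero]; rfl
  rw [e]
  exact ((hasDerivAt_wave κ θ x).mul (hasDerivAt_wideD 0 N x)).deriv

theorem defect_eq (κ θ : ℝ) (N : ℕ) : defect κ θ N =
    fun x => 2 * κ * (wave κ (θ + Real.pi / 2) x * wideD 1 N x) + wave κ θ x * wideD 2 N x := by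
  ext x
  have d := ((((hasDerivAt_wave κ (θ + Real.pi / 2) x).const_mul κ).mul
    (hasDerivAt_wideD 0 N x))).add ((hasDerivAt_wave κ θ x).mul (hasDerivAt_wideD 1 N x))
  rw [defect, deriv_packet]
  refine (congrArg (· + κ ^ 2 * packet κ θ N x) d.deriv).trans ?_
  rw [wave_add_pi, packet, ← wideD_zero]
  ring

theorem deriv_defect_eq (κ θ : ℝ) (N : ℕ) : deriv (defect κ θ N) =
    fun x => -(2 * κ ^ 2 * (wave κ θ x * wideD 1 N x))
      + 3 * κ * (wave κ (θ + Real.pi / 2) x * wideD 2 N x) + wave κ θ x * wideD 3 N x := by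
  ext x
  have d := (((hasDerivAt_wave κ (θ + Real.pi / 2) x).mul
    (hasDerivAt_wideD 1 N x)).const_mul (2 * κ)).add
    ((hasDerivAt_wave κ θ x).mul (hasDerivAt_wideD 2 N x))
  rw [defect_eq]
  refine d.deriv.trans ?_
  rw [wave_add_pi]
  ring

/-- Height M/(N + 1) on an interval of length 4(N + 1) gives an L² norm of order (N + 1)^(-1/2). -/
theorem eLpNorm_two_le_of_bdd {r : ℝ → ℝ} {M : ℝ} {N : ℕ} (hM : 0 ≤ M)
    (hr : ∀ x, |r x| ≤ M * (1 / ((N : ℝ) + 1)))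
    (hr0 : ∀ x : ℝ, 2 * ((N : ℝ) + 1) < |x| → r x = 0) :
    (eLpNorm r 2 volume).toReal ≤ 2 * M / √((N : ℝ) + 1) := by
  have hN : (0 : ℝ) < N + 1 := by positivity
  have hsq : √((N : ℝ) + 1) * √((N : ℝ) + 1) = N + 1 := Real.mul_self_sqrt hN.le
  have hs0 : 0 < √((N : ℝ) + 1) := Real.sqrt_pos.2 hN
  have hbd : ∀ᵐ x ∂(volume : Measure ℝ), ‖r x‖ ≤
      ‖(Icc (-(2 * ((N : ℝ) + 1))) (2 * ((N : ℝ) + 1))).indicator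
        (fun _ => M * (1 / ((N : ℝ) + 1))) x‖ := by
    refine ae_of_all _ fun x => ?_
    by_cases hx : x ∈ Icc (-(2 * ((N : ℝ) + 1))) (2 * ((N : ℝ) + 1))
    · rw [indicator_of_mem hx, Real.norm_eq_abs, Real.norm_eq_abs,
        abs_of_nonneg (by positivity : 0 ≤ M * (1 / ((N : ℝ) + 1)))]
      exact hr x
    · rw [indicator_of_notMem hx, hr0]
      rw [mem_Icc, ← abs_le, not_le] at hx
      exact hx
  have h1 := eLpNorm_mono_ae (p := 2) hbd
  rw [eLpNorm_indicator_const measurableSet_Icc (by norm_num) (by norm_num), Real.volume_Icc] at h1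
  have h2 : ‖M * (1 / ((N : ℝ) + 1))‖ₑ *
      ENNReal.ofReal (2 * ((N : ℝ) + 1) - -(2 * ((N : ℝ) + 1))) ^ (1 / (2 : ℝ≥0∞).toReal)
      = ENNReal.ofReal (2 * M / √((N : ℝ) + 1)) := by
    rw [← ofReal_norm, Real.norm_of_nonneg (by positivity),
      ENNReal.ofReal_rpow_of_nonneg (by linarith) (by positivity),
      ← ENNReal.ofReal_mul (by positivity)]
    congr 1
    have : (2 * ((N : ℝ) + 1) - -(2 * ((N : ℝ) + 1))) ^ (1 / (2 : ℝ≥0∞).toReal)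
        = 2 * √((N : ℝ) + 1) := by
      rw [ENNReal.toReal_ofNat, ← Real.sqrt_eq_rpow]
      have : 2 * ((N : ℝ) + 1) - -(2 * ((N : ℝ) + 1)) = 2 ^ 2 * ((N : ℝ) + 1) := by ring
      rw [this, Real.sqrt_mul (by positivity), Real.sqrt_sq (by norm_num)]
    rw [this]
    nth_rewrite 1 [← hsq]
    field_simp
  rw [h2] at h1
  exact ENNReal.toReal_le_of_le_ofReal (by positivity) h1

/-- Every term of the defect contains at least one derivative of the wide cutoff; the remaining
derivatives of the wave account for the powers of |κ|. -/
theorem exists_defect_bound : ∃ B, 0 ≤ B ∧ ∀ κ θ N,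
    (eLpNorm (defect κ θ N) 2 volume).toReal ≤ B * (1 + |κ|) ^ 2 / √((N : ℝ) + 1) ∧
    (eLpNorm (deriv (defect κ θ N)) 2 volume).toReal ≤ B * (1 + |κ|) ^ 2 / √((N : ℝ) + 1) := by
  obtain ⟨B, hB0, hB⟩ := exists_bound_wideD
  refine ⟨8 * B, by positivity, fun κ θ N => ?_⟩
  have hε : 0 < 1 / ((N : ℝ) + 1) := by positivity
  have hk := abs_nonneg κ
  have term : ∀ (θ x : ℝ) (j : ℕ), 1 ≤ j → j ≤ 3 →
      |wave κ θ x * wideD j N x| ≤ B * (1 / ((N : ℝ) + 1)) := by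
    intro θ x j h1 h3
    rw [abs_mul]
    calc |wave κ θ x| * |wideD j N x| ≤ 1 * (B * (1 / ((N : ℝ) + 1))) :=
          mul_le_mul (abs_wave_le_one _ _ _) (hB j h1 h3 N x) (abs_nonneg _) zero_le_one
      _ = _ := one_mul _
  have hbe : 0 ≤ B * (1 / ((N : ℝ) + 1)) := by positivity
  have e : 8 * B * (1 + |κ|) ^ 2 / √((N : ℝ) + 1) = 2 * (4 * B * (1 + |κ|) ^ 2) / √((N : ℝ) + 1) := by
    ring
  rw [e]
  constructor
  · refine eLpNorm_two_le_of_bdd (by positivity) (fun x => ?_) fun x hx => ?_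
    · rw [defect_eq]
      have t1 := term (θ + Real.pi / 2) x 1 le_rfl (by norm_num)
      have t2 := term θ x 2 (by norm_num) (by norm_num)
      refine (abs_add_le _ _).trans ?_
      rw [abs_mul (2 * κ), abs_mul 2 κ, abs_two]
      have t3 : 2 * |κ| * |wave κ (θ + Real.pi / 2) x * wideD 1 N x|
          ≤ 2 * |κ| * (B * (1 / ((N : ℝ) + 1))) := by gcongr
      nlinarith [mul_nonneg hk hbe, mul_nonneg (mul_nonneg hk hk) hbe]
    · rw [defect_eq]
      simp only [wideD_eq_zero 1 N hx, wideD_eq_zero 2 N hx]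
      ring
  · refine eLpNorm_two_le_of_bdd (by positivity) (fun x => ?_) fun x hx => ?_
    · rw [deriv_defect_eq]
      have t1 := term θ x 1 le_rfl (by norm_num)
      have t2 := term (θ + Real.pi / 2) x 2 (by norm_num) (by norm_num)
      have t3 := term θ x 3 (by norm_num) (by norm_num)
      refine (abs_add_three _ _ _).trans ?_
      rw [abs_neg, abs_mul (2 * κ ^ 2), abs_mul 2 (κ ^ 2), abs_two, abs_pow, abs_mul (3 * κ),
        abs_mul 3 κ, abs_of_pos (by norm_num : (0 : ℝ) < 3)]
      have t4 : 2 * |κ| ^ 2 * |wave κ θ x * wideD 1 N x|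
          ≤ 2 * |κ| ^ 2 * (B * (1 / ((N : ℝ) + 1))) := by gcongr
      have t5 : 3 * |κ| * |wave κ (θ + Real.pi / 2) x * wideD 2 N x|
          ≤ 3 * |κ| * (B * (1 / ((N : ℝ) + 1))) := by gcongr
      nlinarith [mul_nonneg hk hbe, mul_nonneg (mul_nonneg hk hk) hbe]
    · rw [deriv_defect_eq]
      simp only [wideD_eq_zero 1 N hx, wideD_eq_zero 2 N hx, wideD_eq_zero 3 N hx]
      ring

/-! ### Tails of integrable functions -/

/-- The mass of an integrable function away from the support of the cutoff function. -/
def tail (N : ℕ) (f : ℝ × ℝ → ℝ) : ℝ := ∫ z, |f z| * (1 - wide N z.1) ∂μ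

theorem integrable_tail {f : ℝ × ℝ → ℝ} (hf : Integrable f μ) (N : ℕ) :
    Integrable (fun z => |f z| * (1 - wide N z.1)) μ :=
  integrable_mul_bdd_fst (g := fun x => 1 - wide N x) hf.abs
    (continuous_const.sub (contDiff_wide N).continuous) (C := 1) fun x => by
      rw [abs_le]
      constructor <;> linarith [wide_nonneg N x, wide_le_one N x]

theorem tail_nonneg (N : ℕ) (f : ℝ × ℝ → ℝ) : 0 ≤ tail N f :=
  integral_nonneg fun z => mul_nonneg (abs_nonneg _) (by simp [wide_le_one])

theorem tendsto_tail {f : ℝ × ℝ → ℝ} (hf : Integrable f μ) :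
    Tendsto (fun N => tail N f) atTop (𝓝 0) := by
  have h := tendsto_integral_wide hf.abs
  have h2 := (tendsto_const_nhds (x := ∫ z, |f z| ∂μ)).sub h
  rw [sub_self] at h2
  refine h2.congr fun N => ?_
  rw [tail, ← integral_sub hf.abs (integrable_mul_bdd_fst hf.abs (contDiff_wide N).continuous
    (abs_wide_le_one N))]
  congr 1
  ext z
  ring

theorem tail_le_norm (N : ℕ) (u : Lp ℝ 1 μ) : tail N u ≤ ‖u‖ := by
  rw [L1.norm_eq_integral_norm]
  refine integral_mono (integrable_tail (L1.integrable_coeFn u) N) (L1.integrable_coeFn u).norm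
    fun z => ?_
  exact mul_le_of_le_one_right (abs_nonneg _) (by linarith [wide_nonneg N z.1])

/-- This gives the measurability in time of the tails of the force. -/
theorem continuous_tail (N : ℕ) : Continuous fun u : Lp ℝ 1 μ => tail N u := by
  have key : ∀ u v : Lp ℝ 1 μ, tail N u ≤ tail N v + dist u v := by
    intro u v
    have iu := integrable_tail (L1.integrable_coeFn u) N
    have iv := integrable_tail (L1.integrable_coeFn v) N
    have iuv := L1.integrable_coeFn (u - v)
    rw [dist_eq_norm, L1.norm_eq_integral_norm, tail, tail, ← integral_add iv iuv.norm]
    refine integral_mono_ae iu (iv.add iuv.norm) ?_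
    filter_upwards [Lp.coeFn_sub u v] with z hz
    simp only [hz, Pi.sub_apply, Real.norm_eq_abs]
    have h1 := wide_nonneg N z.1
    have h2 := wide_le_one N z.1
    have h3 : |u z| ≤ |v z| + |u z - v z| := by
      have := abs_add_le (v z) (u z - v z)
      simpa using this
    nlinarith [abs_nonneg (u z - v z)]
  exact (LipschitzWith.of_le_add key).continuous

/-- Replacing the packet by the pure wave costs at most the mass of f where the cutoff differs from
one, uniformly in κ, θ and k. -/
theorem abs_pairing_packet_le {f : ℝ × ℝ → ℝ} (hf : Integrable f μ) (κ θ : ℝ) (N k : ℕ) :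
    |pairing f (packet κ θ N) k| ≤ |coeff f κ θ k| + tail N f := by
  have i1 : Integrable (fun z => f z * (wave κ θ z.1 * sn k z.2)) μ :=
    (integrable_mul_snd (integrable_mul_bdd_fst hf (contDiff_wave κ θ).continuous
      (abs_wave_le_one κ θ)) (contDiff_sn k).continuous).congr
      (ae_of_all _ fun z => mul_assoc _ _ _)
  have i2 := integrable_mul_bdd_fst i1 (contDiff_wide N).continuous (abs_wide_le_one N)
  have e : pairing f (packet κ θ N) k
      = coeff f κ θ k - ∫ z, f z * (wave κ θ z.1 * sn k z.2) * (1 - wide N z.1) ∂μ := by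
    have : ∫ z, f z * (wave κ θ z.1 * sn k z.2) * (1 - wide N z.1) ∂μ
        = coeff f κ θ k - ∫ z, f z * (wave κ θ z.1 * sn k z.2) * wide N z.1 ∂μ := by
      rw [coeff, ← integral_sub i1 i2]
      congr 1
      ext z
      ring
    rw [this, sub_sub_cancel, pairing]
    congr 1
    ext z
    rw [packet]
    ring
  rw [e]
  refine (abs_sub _ _).trans ?_
  gcongr
  rw [← Real.norm_eq_abs]
  refine norm_integral_le_of_norm_le (integrable_tail hf N) (ae_of_all _ fun z => ?_)
  have h2 := wide_le_one N z.1
  rw [norm_mul, norm_mul, Real.norm_eq_abs, Real.norm_eq_abs, Real.norm_eq_abs,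
    abs_of_nonneg (by linarith : 0 ≤ 1 - wide N z.1)]
  refine mul_le_mul_of_nonneg_right ?_ (by linarith)
  exact mul_le_of_le_one_right (abs_nonneg _)
    (abs_mul_le_one (abs_wave_le_one _ _ _) (abs_sn_le_one _ _))

/-! ### Decay of the modes of a solution -/

theorem ell_sq (κ : ℝ) (k : ℕ) : ell κ k ^ 2 = κ ^ 2 + (k * Real.pi) ^ 2 :=
  Real.sq_sqrt (by positivity)

theorem nat_le_ell (κ : ℝ) (k : ℕ) : (k : ℝ) ≤ ell κ k := by
  refine Real.le_sqrt_of_sq_le ?_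
  have h1 : (1 : ℝ) ≤ Real.pi := by linarith [Real.pi_gt_three]
  have h2 : (k : ℝ) ≤ k * Real.pi := le_mul_of_one_le_right (by positivity) h1
  have h3 : (k : ℝ) ^ 2 ≤ (k * Real.pi) ^ 2 := by gcongr
  nlinarith [sq_nonneg κ]

theorem one_le_ell (κ : ℝ) {k : ℕ} (hk : 1 ≤ k) : 1 ≤ ell κ k :=
  le_trans (by exact_mod_cast hk) (nat_le_ell κ k)

theorem abs_le_ell (κ : ℝ) (k : ℕ) : |κ| ≤ ell κ k := by
  refine Real.le_sqrt_of_sq_le ?_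
  rw [sq_abs]
  nlinarith [sq_nonneg ((k : ℝ) * Real.pi)]

theorem mul_pi_le_ell (κ : ℝ) (k : ℕ) : k * Real.pi ≤ ell κ k := by
  refine Real.le_sqrt_of_sq_le ?_
  nlinarith [sq_nonneg κ]

/-- The constant in the exponent of the decay of the modes. -/
def dec (ν : ℝ) : ℝ := min (1 / 4) (ν ^ 2 / 4)

theorem dec_pos {ν : ℝ} (hν : 0 < ν) : 0 < dec ν := lt_min (by norm_num) (by positivity)

/-- The decay factor of the modes. -/
def damp (ν κ : ℝ) (k : ℕ) (t : ℝ) : ℝ :=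
  Real.exp (-(dec ν * (κ ^ 2 / ell κ k ^ 2) / (ν * ell κ k ^ 2) * t))

theorem damp_pos (ν κ : ℝ) (k : ℕ) (t : ℝ) : 0 < damp ν κ k t := Real.exp_pos _

theorem damp_le_one {ν : ℝ} (hν : 0 < ν) (κ : ℝ) (k : ℕ) {t : ℝ} (ht : 0 ≤ t) :
    damp ν κ k t ≤ 1 := by
  refine Real.exp_le_one_iff.2 ?_
  have := dec_pos hν
  have : 0 ≤ dec ν * (κ ^ 2 / ell κ k ^ 2) / (ν * ell κ k ^ 2) * t := by positivity
  linarith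

/-- The kernel that bounds the modes of a solution. -/
def kerY (ν : ℝ) (m : ℕ) (κ : ℝ) (k : ℕ) (t : ℝ) : ℝ := (ell κ k ^ (m + 2))⁻¹ * damp ν κ k t

/-- The kernel that bounds the modes of the time derivative of a solution. -/
def kerW (ν : ℝ) (m : ℕ) (κ : ℝ) (k : ℕ) (t : ℝ) : ℝ :=
  (ell κ k ^ m)⁻¹ * (Real.exp (-(ν * ell κ k ^ 2 * t)) + κ ^ 2 / ell κ k ^ 6 * damp ν κ k t)

theorem kerY_nonneg (ν : ℝ) (m : ℕ) (κ : ℝ) (k : ℕ) (t : ℝ) : 0 ≤ kerY ν m κ k t :=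
  mul_nonneg (inv_nonneg.2 (pow_nonneg (ell_nonneg _ _) _)) (damp_pos _ _ _ _).le

theorem kerW_nonneg (ν : ℝ) (m : ℕ) (κ : ℝ) (k : ℕ) (t : ℝ) : 0 ≤ kerW ν m κ k t := by
  have := ell_nonneg κ k
  have := (damp_pos ν κ k t).le
  rw [kerW]
  positivity

theorem continuous_damp (ν κ : ℝ) (k : ℕ) : Continuous (damp ν κ k) := by
  unfold damp
  fun_prop

theorem continuous_kerY (ν : ℝ) (m : ℕ) (κ : ℝ) (k : ℕ) : Continuous (kerY ν m κ k) :=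
  continuous_const.mul (continuous_damp ν κ k)

theorem continuous_kerW (ν : ℝ) (m : ℕ) (κ : ℝ) (k : ℕ) : Continuous (kerW ν m κ k) :=
  continuous_const.mul (Continuous.add (by fun_prop)
    (continuous_const.mul (continuous_damp ν κ k)))

theorem one_le_bracket (t : ℝ) : 1 ≤ bracket t := le_max_left _ _

theorem bracket_pos (t : ℝ) : 0 < bracket t := lt_of_lt_of_le one_pos (one_le_bracket t)

theorem continuous_bracket_rpow (s : ℝ) : Continuous fun t => bracket t ^ s := by
  have : Continuous bracket := continuous_const.max continuous_id
  exact this.rpow_const fun t => Or.inl (bracket_pos t).ne'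

namespace IsSolution

variable {ν : ℝ} {φ₀ φ₁ : ℝ × ℝ → ℝ} {F : ℝ → Lp ℝ 1 μ} {φ : ℝ → Lp ℝ 2 μ}

theorem exists_norm_bound (sol : IsSolution ν φ₀ φ₁ F φ) (t : ℝ) :
    ∃ D, 0 ≤ D ∧ ∀ τ ∈ Icc 0 t, ‖φ τ‖ ≤ D ∧ ‖dt φ τ‖ ≤ D := by
  obtain ⟨D1, h1⟩ := (isCompact_Icc (a := (0 : ℝ)) (b := t)).exists_bound_of_continuousOn
    (sol.continuousOn.mono Icc_subset_Ici_self)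
  obtain ⟨D2, h2⟩ := (isCompact_Icc (a := (0 : ℝ)) (b := t)).exists_bound_of_continuousOn
    (sol.continuousOn_dt.mono Icc_subset_Ici_self)
  refine ⟨max (max D1 D2) 0, le_max_right _ _, fun τ hτ => ⟨?_, ?_⟩⟩
  · exact (h1 τ hτ).trans ((le_max_left _ _).trans (le_max_left _ _))
  · exact (h2 τ hτ).trans ((le_max_right _ _).trans (le_max_left _ _))

theorem hasDerivWithinAt_pairing (sol : IsSolution ν φ₀ φ₁ F φ) {g : ℝ → ℝ}
    (hg : MemLp g 2 volume) (k : ℕ) {t τ : ℝ} (hτ : τ ∈ Icc 0 t) :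
    HasDerivWithinAt (fun τ => pairing (φ τ) g k) (pairing (dt φ τ) g k) (Icc 0 t) τ := by
  simp_rw [pairing_eq_inner _ hg k]
  have h1 := (sol.hasDerivWithinAt hτ.1).mono (Icc_subset_Ici_self : Icc 0 t ⊆ Ici 0)
  have h2 := h1.inner ℝ (hasDerivWithinAt_const τ (Icc 0 t) ((memLp_mode hg k).toLp _))
  simpa using h2

theorem continuousOn_pairing {P : ℝ → Lp ℝ 2 μ} (hP : ContinuousOn P (Ici 0)) {g : ℝ → ℝ}
    (hg : MemLp g 2 volume) (k : ℕ) (t : ℝ) :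
    ContinuousOn (fun τ => pairing (P τ) g k) (Icc 0 t) := by
  simp_rw [pairing_eq_inner _ hg k]
  exact (hP.mono Icc_subset_Ici_self).inner continuousOn_const

/-- The pairing of a solution with a wave packet solves a damped oscillator equation, up to
a small error. -/
theorem packet_equation (sol : IsSolution ν φ₀ φ₁ F φ) (hν : 0 < ν) {B : ℝ} (hF : IsBddCurve F B)
    {t D δ : ℝ} (ht : 0 ≤ t) (hD : ∀ τ ∈ Icc 0 t, ‖φ τ‖ ≤ D ∧ ‖dt φ τ‖ ≤ D) (hD0 : 0 ≤ D)
    (κ θ : ℝ) (N : ℕ) {k : ℕ} (hk : 1 ≤ k)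
    (hδ : (eLpNorm (defect κ θ N) 2 volume).toReal ≤ δ)
    (hδ' : (eLpNorm (deriv (defect κ θ N)) 2 volume).toReal ≤ δ) :
    ∃ f : ℝ → ℝ, IntervalIntegrable f volume 0 t ∧
      (∀ τ ∈ Icc 0 t, |f τ| ≤ |pairing (F τ) (packet κ θ N) k| + (3 + ν) * D * δ) ∧
      ∀ τ ∈ Icc 0 t, pairing (dt φ τ) (packet κ θ N) k
          + ν * ell κ k ^ 2 * pairing (φ τ) (packet κ θ N) k
        = pairing (dt φ 0) (packet κ θ N) k + ν * ell κ k ^ 2 * pairing (φ 0) (packet κ θ N) k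
          + ∫ σ in (0 : ℝ)..τ,
            (f σ - κ ^ 2 / ell κ k ^ 2 * pairing (φ σ) (packet κ θ N) k) := by
  obtain ⟨ψ, P, hP, hψ, hmode, heq⟩ := sol.exists_gradient
  set g := packet κ θ N with hgdef
  have hg : ContDiff ℝ ∞ g := contDiff_packet κ θ N
  have hgc : HasCompactSupport g := hasCompactSupport_packet κ θ N
  have hg' : ContDiff ℝ ∞ (deriv g) := (contDiff_infty_iff_deriv.1 hg).2
  have hg'' : ContDiff ℝ ∞ (deriv (deriv g)) := (contDiff_infty_iff_deriv.1 hg').2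
  set r := defect κ θ N with hrdef
  have hr : ContDiff ℝ ∞ r := contDiff_defect κ θ N
  have hrc : HasCompactSupport r := hasCompactSupport_defect κ θ N
  have hr' : ContDiff ℝ ∞ (deriv r) := (contDiff_infty_iff_deriv.1 hr).2
  have mg := memLp_of_compact hg.continuous hgc 2
  have mg' := memLp_of_compact hg'.continuous hgc.deriv 2
  have mr := memLp_of_compact hr.continuous hrc 2
  have mr' := memLp_of_compact hr'.continuous hrc.deriv 2
  set L := ell κ k with hL
  have hL1 : 1 ≤ L := one_le_ell κ hk
  have hL2 : L ^ 2 = κ ^ 2 + (k * Real.pi) ^ 2 := ell_sq κ k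
  have hLpos : 0 < L ^ 2 := by positivity
  have hL21 : 1 ≤ L ^ 2 := one_le_pow₀ hL1
  have e2 : deriv (deriv g) = fun x => r x + -κ ^ 2 * g x := by
    ext x
    simp only [hrdef, defect, hgdef]
    ring
  have e3 : deriv (deriv (deriv g)) = fun x => deriv r x + -κ ^ 2 * deriv g x := by
    rw [e2]
    ext x
    exact ((hr.differentiable (by simp) x).hasDerivAt.add
      ((hg.differentiable (by simp) x).hasDerivAt.const_mul (-κ ^ 2))).deriv
  have p2 : ∀ u : Lp ℝ 2 μ, pairing u (deriv (deriv g)) k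
      = pairing u r k - κ ^ 2 * pairing u g k := by
    intro u
    rw [e2, pairing_add_right u mr (mg.const_mul _), pairing_const_mul_right]
    ring
  have p3 : ∀ u : Lp ℝ 2 μ, pairing u (deriv (deriv (deriv g))) k
      = pairing u (deriv r) k - κ ^ 2 * pairing u (deriv g) k := by
    intro u
    rw [e3, pairing_add_right u mr' (mg'.const_mul _), pairing_const_mul_right]
    ring
  -- The Dirichlet problem is tested with g' instead of g. Since g''' = r' - κ² g', this reads L²⟨ψ,
  -- g'⟩ = ⟨ψ, r'⟩ - ⟨φ, r⟩ + κ²⟨φ, g⟩, where r is the defect.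
  have hPg : ∀ τ, 0 ≤ τ → pairing (P τ) g k + κ ^ 2 / L ^ 2 * pairing (φ τ) g k
      = (pairing (φ τ) r k - pairing (ψ τ) (deriv r) k) / L ^ 2 := by
    intro τ hτ
    have h1 := (hmode τ hτ g hg hgc k).1
    have h2 := (hmode τ hτ (deriv g) hg' hgc.deriv k).2
    rw [p2, p3] at h2
    rw [h1, eq_div_iff hLpos.ne', add_mul, div_mul_eq_mul_div, div_mul_cancel₀ _ hLpos.ne', hL2]
    linarith
  have gnice : ∃ C, ∀ z : ℝ × ℝ, |g z.1 * sn k z.2| ≤ C := by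
    obtain ⟨C, hC⟩ := hgc.exists_bound_of_continuous hg.continuous
    refine ⟨C, fun z => ?_⟩
    rw [abs_mul]
    exact (mul_le_of_le_one_right (abs_nonneg _) (abs_sn_le_one _ _)).trans (hC _)
  have hGc : Continuous (fun z : ℝ × ℝ => g z.1 * sn k z.2) :=
    (hg.continuous.comp continuous_fst).mul ((contDiff_sn k).continuous.comp continuous_snd)
  obtain ⟨C, hC⟩ := gnice
  have cP := continuousOn_pairing hP mg k t
  have cφ := continuousOn_pairing sol.continuousOn mg k t
  have cr := continuousOn_pairing sol.continuousOn_dt mr k t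
  have hIF : ∀ τ, 0 ≤ τ → IntervalIntegrable (fun τ => pairing (F τ) g k) volume 0 τ :=
    fun τ hτ => hF.intervalIntegrable hGc hC hτ
  -- The error of the nonlocal term plus that of the viscous term. The latter first appears as
  -- ν(⟨φ(τ), r⟩ - ⟨φ(0), r⟩) and is written as a time integral, so that it acts as a force. The
  -- constant 3 + ν below consists of 1 from φ, 2 from ‖ψ‖ ≤ 2‖φ‖, and ν from ∂ₜφ.
  let e : ℝ → ℝ := fun τ => (pairing (P τ) g k + κ ^ 2 / L ^ 2 * pairing (φ τ) g k)
    + ν * pairing (dt φ τ) r k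
  have ce : ContinuousOn e (Icc 0 t) :=
    (cP.add (continuousOn_const.mul cφ)).add (continuousOn_const.mul cr)
  have hsub : ∀ τ ∈ Icc 0 t, uIcc 0 τ ⊆ Icc 0 t := fun τ hτ => by
    rw [uIcc_of_le hτ.1]
    exact Icc_subset_Icc le_rfl hτ.2
  have ie : ∀ τ ∈ Icc 0 t, IntervalIntegrable e volume 0 τ := fun τ hτ =>
    (ce.mono (hsub τ hτ)).intervalIntegrable
  have iP : ∀ τ ∈ Icc 0 t, IntervalIntegrable (fun τ => pairing (P τ) g k) volume 0 τ :=
    fun τ hτ => (cP.mono (hsub τ hτ)).intervalIntegrable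
  have ir : ∀ τ ∈ Icc 0 t, IntervalIntegrable (fun τ => pairing (dt φ τ) r k) volume 0 τ :=
    fun τ hτ => (cr.mono (hsub τ hτ)).intervalIntegrable
  refine ⟨fun τ => pairing (F τ) g k + e τ, (hIF t ht).add (ie t (right_mem_Icc.2 ht)), ?_, ?_⟩
  · intro τ hτ
    refine (abs_add_le _ _).trans ?_
    gcongr
    have hδ0 : 0 ≤ δ := ENNReal.toReal_nonneg.trans hδ
    have b1 : |pairing (φ τ) r k| ≤ D * δ := (abs_pairing_le _ mr k).trans
      (mul_le_mul (hD τ hτ).1 hδ ENNReal.toReal_nonneg hD0)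
    have b2 : |pairing (dt φ τ) r k| ≤ D * δ := (abs_pairing_le _ mr k).trans
      (mul_le_mul (hD τ hτ).2 hδ ENNReal.toReal_nonneg hD0)
    have b3 : |pairing (ψ τ) (deriv r) k| ≤ 2 * D * δ := (abs_pairing_le _ mr' k).trans
      (mul_le_mul ((hψ τ hτ.1).trans (by linarith [(hD τ hτ).1])) hδ' ENNReal.toReal_nonneg
        (by positivity))
    have b4 : |(pairing (φ τ) r k - pairing (ψ τ) (deriv r) k) / L ^ 2| ≤ 3 * D * δ := by
      rw [abs_div, abs_of_pos hLpos]
      refine (div_le_self (abs_nonneg _) hL21).trans ((abs_sub _ _).trans ?_)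
      linarith
    have b5 : |ν * pairing (dt φ τ) r k| ≤ ν * (D * δ) := by
      rw [abs_mul, abs_of_pos hν]
      gcongr
    simp only [e, hPg τ hτ.1]
    refine (abs_add_le _ _).trans ?_
    linarith
  · intro τ hτ
    have M := sol.modal_equation hF hP heq hg hgc k hτ.1
    rw [p2, p2] at M
    have ftc : ∫ σ in (0 : ℝ)..τ, pairing (dt φ σ) r k
        = pairing (φ τ) r k - pairing (φ 0) r k := by
      refine intervalIntegral.integral_eq_sub_of_hasDerivAt_of_le hτ.1
        (continuousOn_pairing sol.continuousOn mr k τ) (fun σ hσ => ?_) (ir τ hτ)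
      exact (sol.hasDerivWithinAt_pairing mr k (Ioo_subset_Icc_self hσ)).hasDerivAt
        (Icc_mem_nhds hσ.1 hσ.2)
    have e4 : ∫ σ in (0 : ℝ)..τ, (pairing (F σ) g k + e σ - κ ^ 2 / L ^ 2 * pairing (φ σ) g k)
        = (∫ σ in (0 : ℝ)..τ, pairing (F σ) g k) + ((∫ σ in (0 : ℝ)..τ, pairing (P σ) g k)
          + ν * ∫ σ in (0 : ℝ)..τ, pairing (dt φ σ) r k) := by
      rw [← intervalIntegral.integral_const_mul, ← intervalIntegral.integral_add (iP τ hτ)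
        ((ir τ hτ).const_mul ν), ← intervalIntegral.integral_add (hIF τ hτ.1)
        ((iP τ hτ).add ((ir τ hτ).const_mul ν))]
      congr 1
      ext σ
      simp only [e]
      ring
    rw [e4, ftc, ← M, hL2]
    ring

end IsSolution

theorem IsBddCurve.intervalIntegrable_tail {F : ℝ → Lp ℝ 1 μ} {B : ℝ} (h : IsBddCurve F B)
    (N : ℕ) {t : ℝ} (ht : 0 ≤ t) : IntervalIntegrable (fun τ => tail N (F τ)) volume 0 t := by
  rw [intervalIntegrable_iff_integrableOn_Ioc_of_le ht]
  refine (integrable_const B).mono' ?_ ?_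
  · exact ((continuous_tail N).comp_aestronglyMeasurable h.meas).mono_measure (restrict_Ioc_le t)
  · refine ae_mono (restrict_Ioc_le t) ?_
    filter_upwards [h.bound] with τ hτ
    rw [Real.norm_of_nonneg (tail_nonneg _ _)]
    exact (tail_le_norm N (F τ)).trans hτ

theorem IsBddCurve.tendsto_integral_tail {F : ℝ → Lp ℝ 1 μ} {B : ℝ} (h : IsBddCurve F B)
    {t : ℝ} (ht : 0 ≤ t) :
    Tendsto (fun N => ∫ τ in (0 : ℝ)..t, tail N (F τ)) atTop (𝓝 0) := by
  have : Tendsto (fun N => ∫ τ in (0 : ℝ)..t, tail N (F τ)) atTop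
      (𝓝 (∫ _ in (0 : ℝ)..t, (0 : ℝ))) := by
    refine intervalIntegral.tendsto_integral_filter_of_dominated_convergence (fun _ => B)
      (Eventually.of_forall fun N => (h.intervalIntegrable_tail N ht).def'.1)
      (Eventually.of_forall fun N => ?_) intervalIntegrable_const
      (ae_of_all _ fun τ _ => tendsto_tail (L1.integrable_coeFn (F τ)))
    have hb := (ae_restrict_iff' measurableSet_Ioi).1 h.bound
    filter_upwards [hb] with τ hτ hτ'
    rw [uIoc_of_le ht] at hτ'
    rw [Real.norm_of_nonneg (tail_nonneg _ _)]
    exact (tail_le_norm N (F τ)).trans (hτ hτ'.1)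
  simpa using this

/-- The time integrals in Duhamel's formula. -/
theorem integral_kernel_le {K ker f h tl : ℝ → ℝ} {t A C M l ε : ℝ} (ht : 0 ≤ t) (hA : 0 ≤ A)
    (hK : Continuous K) (hker : Continuous ker) (hh : Continuous h) (hh0 : ∀ τ, 0 ≤ h τ)
    (hK0 : ∀ τ, 0 ≤ τ → 0 ≤ K τ) (hKM : ∀ τ, 0 ≤ τ → K τ ≤ M) (hε : 0 ≤ ε)
    (hKl : ∀ τ, 0 ≤ τ → K τ * l ≤ C * ker τ) (hf : IntervalIntegrable f volume 0 t)
    (htl : IntervalIntegrable tl volume 0 t) (htl0 : ∀ τ, 0 ≤ tl τ)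
    (hfb : ∀ᵐ τ, τ ∈ Ioc 0 t → |f τ| ≤ A * h τ * l + tl τ + ε) :
    ∫ τ in (0 : ℝ)..t, K (t - τ) * |f τ|
      ≤ C * A * (∫ τ in (0 : ℝ)..t, ker (t - τ) * h τ)
        + M * ((∫ τ in (0 : ℝ)..t, tl τ) + t * ε) := by
  have i1 : IntervalIntegrable (fun τ => ker (t - τ) * h τ) volume 0 t :=
    ((hker.comp (by fun_prop)).mul hh).intervalIntegrable _ _
  have i2 : IntervalIntegrable (fun _ : ℝ => ε) volume 0 t := intervalIntegrable_const
  have e : C * A * (∫ τ in (0 : ℝ)..t, ker (t - τ) * h τ)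
        + M * ((∫ τ in (0 : ℝ)..t, tl τ) + t * ε)
      = ∫ τ in (0 : ℝ)..t, (C * A * (ker (t - τ) * h τ) + M * (tl τ + ε)) := by
    rw [intervalIntegral.integral_add (i1.const_mul _) ((htl.add i2).const_mul _),
      intervalIntegral.integral_const_mul, intervalIntegral.integral_const_mul,
      intervalIntegral.integral_add htl i2, intervalIntegral.integral_const]
    simp
  rw [e]
  refine intervalIntegral.integral_mono_ae_restrict ht
    (hf.abs.continuousOn_mul (hK.comp (by fun_prop)).continuousOn)
    ((i1.const_mul _).add ((htl.add i2).const_mul _)) ?_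
  rw [← Measure.restrict_congr_set Ioc_ae_eq_Icc]
  change ∀ᵐ τ ∂(volume.restrict (Ioc 0 t)), _
  rw [ae_restrict_iff' measurableSet_Ioc]
  filter_upwards [hfb] with τ hτ hτ'
  have h0 : 0 ≤ t - τ := by linarith [hτ'.2]
  calc K (t - τ) * |f τ| ≤ K (t - τ) * (A * h τ * l + tl τ + ε) :=
        mul_le_mul_of_nonneg_left (hτ hτ') (hK0 _ h0)
    _ = (K (t - τ) * l) * (A * h τ) + K (t - τ) * (tl τ + ε) := by ring
    _ ≤ C * ker (t - τ) * (A * h τ) + M * (tl τ + ε) := by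
        refine add_le_add (mul_le_mul_of_nonneg_right (hKl _ h0) (mul_nonneg hA (hh0 τ)))
          (mul_le_mul_of_nonneg_right (hKM _ h0) (add_nonneg (htl0 τ) hε))
    _ = _ := by ring

/-- The constant in the bounds for the modes. -/
def modeConst (ν : ℝ) : ℝ := 3 + 4 / ν ^ 2 + 2 / ν

theorem modeConst_pos {ν : ℝ} (hν : 0 < ν) : 0 < modeConst ν := by
  rw [modeConst]
  positivity

-- The oscillator bound applied to the packet equation. The coefficients of the data are assumed
-- small only for pure waves, and the tails make up the difference. The error is uniform in θ and k
-- and at most quadratic in κ, hence harmless against the rapidly decaying transforms of test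
-- functions.
set_option maxHeartbeats 1600000 in
theorem IsSolution.packet_bound {ν : ℝ} {φ₀ φ₁ : ℝ × ℝ → ℝ} {F : ℝ → Lp ℝ 1 μ}
    {φ : ℝ → Lp ℝ 2 μ} (sol : IsSolution ν φ₀ φ₁ F φ) (hν : 0 < ν) {B : ℝ}
    (hF : IsBddCurve F B) {t A s : ℝ} {m : ℕ} (ht : 0 ≤ t) (hA : 0 ≤ A)
    (i0 : Integrable φ₀ μ) (i1 : Integrable φ₁ μ)
    (h0 : ∀ κ θ k, 1 ≤ k → |coeff φ₀ κ θ k| ≤ A * (ell κ k ^ (m + 2))⁻¹)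
    (h1 : ∀ κ θ k, 1 ≤ k → |coeff φ₁ κ θ k| ≤ A * (ell κ k ^ m)⁻¹)
    (h2 : ∀ᵐ τ ∂(volume.restrict (Ioi (0 : ℝ))), ∀ κ θ k, 1 ≤ k →
      |coeff (F τ) κ θ k| ≤ A * bracket τ ^ (-s) * (ell κ k ^ m)⁻¹) :
    ∃ δ : ℕ → ℝ, Tendsto δ atTop (𝓝 0) ∧ ∀ N κ θ k, 1 ≤ k →
      |pairing (φ t) (packet κ θ N) k| ≤ modeConst ν * A * (kerY ν m κ k t
        + ∫ τ in (0 : ℝ)..t, kerY ν m κ k (t - τ) * bracket τ ^ (-s)) + δ N * (1 + |κ|) ^ 2 ∧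
      |pairing (dt φ t) (packet κ θ N) k| ≤ modeConst ν * A * (kerW ν m κ k t
        + ∫ τ in (0 : ℝ)..t, kerW ν m κ k (t - τ) * bracket τ ^ (-s)) + δ N * (1 + |κ|) ^ 2 := by
  obtain ⟨D, hD0, hD⟩ := sol.exists_norm_bound t
  obtain ⟨B₀, hB₀, hdef⟩ := exists_defect_bound
  set C₀ := modeConst ν with hC₀
  let Q : ℝ := (3 + ν) * D * B₀ * t
  -- The tails of the two initial data and of the force, plus the total effect up to time t of the
  -- packet defect, which is of order (N + 1)^(-1/2).
  refine ⟨fun N => C₀ * (tail N φ₁ + tail N φ₀ + (∫ τ in (0 : ℝ)..t, tail N (F τ))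
    + Q * (1 / √((N : ℝ) + 1))), ?_, ?_⟩
  · have l1 : Tendsto (fun N : ℕ => 1 / √((N : ℝ) + 1)) atTop (𝓝 0) := by
      have := (Real.continuous_sqrt.tendsto 0).comp
        (tendsto_one_div_add_atTop_nhds_zero_nat (𝕜 := ℝ))
      simpa [Function.comp_def] using this
    have := ((((tendsto_tail i1).add (tendsto_tail i0)).add (hF.tendsto_integral_tail ht)).add
      (l1.const_mul Q)).const_mul C₀
    simpa using this
  intro N κ θ k hk
  set L := ell κ k with hL
  have hL1 : 1 ≤ L := one_le_ell κ hk
  have hL0 : 0 < L := by linarith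
  have hL21 : 1 ≤ L ^ 2 := one_le_pow₀ hL1
  have hκL : κ ^ 2 ≤ L ^ 2 := by rw [ell_sq]; nlinarith [sq_nonneg ((k : ℝ) * Real.pi)]
  set a := ν * L ^ 2 with ha
  set b := κ ^ 2 / L ^ 2 with hb
  have ha0 : 0 < a := by positivity
  have hb0 : 0 ≤ b := by positivity
  have hb1 : b ≤ 1 := by rw [hb, div_le_one (by positivity)]; exact hκL
  have hνa : ν ≤ a := by rw [ha]; nlinarith
  have hνa2 : ν ^ 2 ≤ a ^ 2 := by gcongr
  have hc0 := dec_pos hν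
  have hc1 : dec ν ≤ 1 / 4 := min_le_left _ _
  have hc2 : dec ν ≤ ν ^ 2 / 4 := min_le_right _ _
  -- Since a ≥ ν and b ≤ 1, the bound dec ν ≤ 1/4 absorbs the a² term and dec ν ≤ ν²/4 the b terms;
  -- this is the reason for the minimum in `dec`.
  have c1 : 2 * dec ν * (a ^ 2 + b) ≤ a ^ 2 := by nlinarith [mul_nonneg hc0.le hb0]
  have c2 : 3 * dec ν * b ≤ a ^ 2 := by nlinarith
  set δ := B₀ * (1 + |κ|) ^ 2 / √((N : ℝ) + 1) with hδ
  have hδ0 : 0 ≤ δ := by positivity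
  obtain ⟨f, hfi, hfb, hfe⟩ := sol.packet_equation hν hF ht hD hD0 κ θ N hk (hdef κ θ N).1
    (hdef κ θ N).2
  have mg := memLp_of_compact (contDiff_packet κ θ N).continuous (hasCompactSupport_packet κ θ N) 2
  obtain ⟨O1, O2⟩ := oscillator_bound ha0 hb0 hc0.le c1 c2 ht
    (fun τ hτ => sol.hasDerivWithinAt_pairing mg k hτ)
    (continuousOn_pairing sol.continuousOn_dt mg k t) hfi hfe
  have hE : ∀ τ, Real.exp (-(dec ν * b / a * τ)) = damp ν κ k τ := fun τ => rfl
  simp only [hE] at O1 O2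
  set ε := (3 + ν) * D * δ with hε
  have hε0 : 0 ≤ ε := by positivity
  have hT0 := tail_nonneg N φ₀
  have hT1 := tail_nonneg N φ₁
  have hTF : 0 ≤ ∫ τ in (0 : ℝ)..t, tail N (F τ) :=
    intervalIntegral.integral_nonneg ht fun τ _ => tail_nonneg _ _
  have hw0 : |pairing (dt φ 0) (packet κ θ N) k| ≤ A * (L ^ m)⁻¹ + tail N φ₁ := by
    rw [pairing_congr sol.init_dt]
    exact (abs_pairing_packet_le i1 κ θ N k).trans (by gcongr; exact h1 κ θ k hk)
  have hy0 : |pairing (φ 0) (packet κ θ N) k| ≤ A * (L ^ (m + 2))⁻¹ + tail N φ₀ := by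
    rw [pairing_congr sol.init]
    exact (abs_pairing_packet_le i0 κ θ N k).trans (by gcongr; exact h0 κ θ k hk)
  have hfb' : ∀ᵐ τ, τ ∈ Ioc 0 t →
      |f τ| ≤ A * bracket τ ^ (-s) * (L ^ m)⁻¹ + tail N (F τ) + ε := by
    have h2' := (ae_restrict_iff' measurableSet_Ioi).1 h2
    filter_upwards [h2'] with τ hτ hτ'
    have e1 := hfb τ (Ioc_subset_Icc_self hτ')
    have e2 := abs_pairing_packet_le (L1.integrable_coeFn (F τ)) κ θ N k
    have e3 := hτ hτ'.1 κ θ k hk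
    linarith only [e1, e2, e3]
  clear_value ε δ b a L C₀
  have hbr : ∀ τ, 0 ≤ bracket τ ^ (-s) := fun τ => Real.rpow_nonneg (bracket_pos τ).le _
  have hIt := hF.intervalIntegrable_tail N ht
  have hpow : (L ^ (m + 2))⁻¹ = (L ^ m)⁻¹ * (L ^ 2)⁻¹ := by rw [pow_add, mul_inv]
  have h4 : 0 ≤ 4 / ν ^ 2 := by positivity
  have h5 : 0 ≤ 2 / ν := by positivity
  have hC1 : 2 / ν + 2 ≤ C₀ := by rw [hC₀, modeConst]; linarith
  have hC2 : 1 + 4 / ν ^ 2 + 2 / ν ≤ C₀ := by rw [hC₀, modeConst]; linarith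
  have hC00 : 0 ≤ C₀ := hC₀ ▸ (modeConst_pos hν).le
  have hk1 : 1 ≤ (1 + |κ|) ^ 2 := one_le_pow₀ (by linarith [abs_nonneg κ])
  have htε : t * ε = Q * (1 / √((N : ℝ) + 1)) * (1 + |κ|) ^ 2 := by
    simp only [hε, hδ, Q]
    ring
  have hErr : C₀ * (tail N φ₁ + tail N φ₀ + ((∫ τ in (0 : ℝ)..t, tail N (F τ)) + t * ε))
      ≤ C₀ * (tail N φ₁ + tail N φ₀ + (∫ τ in (0 : ℝ)..t, tail N (F τ))
        + Q * (1 / √((N : ℝ) + 1))) * (1 + |κ|) ^ 2 := by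
    rw [htε, mul_assoc C₀]
    refine mul_le_mul_of_nonneg_left ?_ hC00
    linarith only [mul_le_mul_of_nonneg_left hk1 (add_nonneg (add_nonneg hT1 hT0) hTF)]
  clear_value Q
  have hker : ∀ (ker : ℝ → ℝ), (∀ τ, 0 ≤ ker τ) →
      0 ≤ ∫ τ in (0 : ℝ)..t, ker (t - τ) * bracket τ ^ (-s) := fun ker hk0 =>
    intervalIntegral.integral_nonneg ht fun τ _ => mul_nonneg (hk0 _) (hbr τ)
  have hd1 : ∀ τ, 0 ≤ τ → damp ν κ k τ ≤ 1 := fun τ hτ => damp_le_one hν κ k hτ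
  have hd0 : ∀ τ, 0 < damp ν κ k τ := fun τ => damp_pos ν κ k τ
  have h2a : 2 / a = 2 / ν * (L ^ 2)⁻¹ := by rw [ha]; field_simp
  have h2a' : 2 / a ≤ 2 / ν := by gcongr
  constructor
  · have I := integral_kernel_le (K := fun τ => 2 / a * damp ν κ k τ) (ker := kerY ν m κ k)
      (f := f) (h := fun τ => bracket τ ^ (-s)) (tl := fun τ => tail N (F τ)) (t := t) (A := A)
      (C := 2 / ν) (M := 2 / ν) (l := (L ^ m)⁻¹) (ε := ε) ht hA
      (continuous_const.mul (continuous_damp ν κ k)) (continuous_kerY ν m κ k)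
      (continuous_bracket_rpow _) hbr (fun τ _ => mul_nonneg (by positivity) (hd0 τ).le)
      (fun τ hτ => (mul_le_of_le_one_right (by positivity) (hd1 τ hτ)).trans h2a') hε0
      (fun τ _ => le_of_eq (by rw [kerY, ← hL, hpow, h2a]; ring)) hfi hIt
      (fun τ => tail_nonneg _ _) hfb'
    set J := ∫ τ in (0 : ℝ)..t, kerY ν m κ k (t - τ) * bracket τ ^ (-s) with hJ
    have hJ0 : 0 ≤ J := hker _ (kerY_nonneg ν m κ k)
    have hkY : kerY ν m κ k t = (L ^ m)⁻¹ * (L ^ 2)⁻¹ * damp ν κ k t := by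
      rw [kerY, ← hL, hpow]
    have hkY0 := kerY_nonneg ν m κ k t
    have a1 : 2 / a * damp ν κ k t * |pairing (dt φ 0) (packet κ θ N) k|
        ≤ 2 / ν * A * kerY ν m κ k t + 2 / ν * tail N φ₁ := by
      calc _ ≤ 2 / a * damp ν κ k t * (A * (L ^ m)⁻¹ + tail N φ₁) := by
            gcongr
            exact mul_nonneg (by positivity) (hd0 t).le
        _ = 2 / ν * A * kerY ν m κ k t + 2 / a * damp ν κ k t * tail N φ₁ := by
            rw [hkY, h2a]; ring
        _ ≤ _ := by
            gcongr
            exact (mul_le_of_le_one_right (by positivity) (hd1 t ht)).trans h2a'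
    have a2 : 2 * damp ν κ k t * |pairing (φ 0) (packet κ θ N) k|
        ≤ 2 * A * kerY ν m κ k t + 2 * tail N φ₀ := by
      calc _ ≤ 2 * damp ν κ k t * (A * (L ^ (m + 2))⁻¹ + tail N φ₀) := by
            gcongr
            exact mul_nonneg (by positivity) (hd0 t).le
        _ = 2 * A * kerY ν m κ k t + 2 * damp ν κ k t * tail N φ₀ := by
            rw [hkY, hpow]; ring
        _ ≤ _ := by
            gcongr
            exact mul_le_of_le_one_right (by positivity) (hd1 t ht)
    have a3 : (2 / ν + 2) * (A * kerY ν m κ k t) ≤ C₀ * (A * kerY ν m κ k t) :=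
      mul_le_mul_of_nonneg_right hC1 (mul_nonneg hA hkY0)
    have a4 : 2 / ν * (A * J) ≤ C₀ * (A * J) :=
      mul_le_mul_of_nonneg_right (by linarith only [hC1, hC2, h4, h5]) (mul_nonneg hA hJ0)
    have a5 : 2 / ν * tail N φ₁ ≤ C₀ * tail N φ₁ :=
      mul_le_mul_of_nonneg_right (by linarith only [hC1, hC2, h4, h5]) hT1
    have a6 : 2 * tail N φ₀ ≤ C₀ * tail N φ₀ := mul_le_mul_of_nonneg_right (by linarith only [hC1, hC2, h4, h5]) hT0
    have a7 : 2 / ν * ((∫ τ in (0 : ℝ)..t, tail N (F τ)) + t * ε)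
        ≤ C₀ * ((∫ τ in (0 : ℝ)..t, tail N (F τ)) + t * ε) :=
      mul_le_mul_of_nonneg_right (by linarith only [hC1, hC2, h4, h5]) (add_nonneg hTF (mul_nonneg ht hε0))
    linarith only [O1, I, a1, a2, a3, a4, a5, a6, a7, hErr]
  · have h4b : 4 * b / a ^ 2 = 4 / ν ^ 2 * (κ ^ 2 / L ^ 6) := by
      rw [ha, hb]; field_simp
    have h4b' : 4 * b / a ^ 2 ≤ 4 / ν ^ 2 := by
      calc 4 * b / a ^ 2 ≤ 4 * 1 / ν ^ 2 := by gcongr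
        _ = _ := by rw [mul_one]
    have hex : ∀ τ, 0 ≤ τ → Real.exp (-(a * τ)) ≤ 1 := fun τ hτ =>
      Real.exp_le_one_iff.2 (neg_nonpos.2 (mul_nonneg ha0.le hτ))
    have hKl : ∀ τ, 0 ≤ τ → (Real.exp (-(a * τ)) + 4 * b / a ^ 2 * damp ν κ k τ) * (L ^ m)⁻¹
        ≤ (1 + 4 / ν ^ 2) * kerW ν m κ k τ := by
      intro τ hτ
      rw [kerW, ← hL, ← ha, h4b]
      have e1 : 0 ≤ (L ^ m)⁻¹ * Real.exp (-(a * τ)) := by positivity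
      have e2 : 0 ≤ (L ^ m)⁻¹ * (κ ^ 2 / L ^ 6 * damp ν κ k τ) := by
        have := (hd0 τ).le
        positivity
      linarith only [mul_nonneg h4 e1, e2]
    have hKM : ∀ τ, 0 ≤ τ → Real.exp (-(a * τ)) + 4 * b / a ^ 2 * damp ν κ k τ
        ≤ 1 + 4 / ν ^ 2 := fun τ hτ =>
      add_le_add (hex τ hτ) ((mul_le_of_le_one_right (by positivity) (hd1 τ hτ)).trans h4b')
    have hK0 : ∀ τ, 0 ≤ Real.exp (-(a * τ)) + 4 * b / a ^ 2 * damp ν κ k τ := fun τ =>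
      add_nonneg (Real.exp_pos _).le (mul_nonneg (by positivity) (hd0 τ).le)
    have I := integral_kernel_le
      (K := fun τ => Real.exp (-(a * τ)) + 4 * b / a ^ 2 * damp ν κ k τ) (ker := kerW ν m κ k)
      (f := f) (h := fun τ => bracket τ ^ (-s)) (tl := fun τ => tail N (F τ)) (t := t) (A := A)
      (C := 1 + 4 / ν ^ 2) (M := 1 + 4 / ν ^ 2) (l := (L ^ m)⁻¹) (ε := ε) ht hA
      (Continuous.add (by fun_prop) (continuous_const.mul (continuous_damp ν κ k)))
      (continuous_kerW ν m κ k)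
      (continuous_bracket_rpow _) hbr (fun τ _ => hK0 τ) hKM hε0 hKl hfi hIt
      (fun τ => tail_nonneg _ _) hfb'
    set J := ∫ τ in (0 : ℝ)..t, kerW ν m κ k (t - τ) * bracket τ ^ (-s) with hJ
    have hJ0 : 0 ≤ J := hker _ (kerW_nonneg ν m κ k)
    have hkW0 := kerW_nonneg ν m κ k t
    have a1 : (Real.exp (-(a * t)) + 4 * b / a ^ 2 * damp ν κ k t)
          * |pairing (dt φ 0) (packet κ θ N) k|
        ≤ (1 + 4 / ν ^ 2) * (A * kerW ν m κ k t) + (1 + 4 / ν ^ 2) * tail N φ₁ := by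
      calc _ ≤ (Real.exp (-(a * t)) + 4 * b / a ^ 2 * damp ν κ k t)
              * (A * (L ^ m)⁻¹ + tail N φ₁) := by
            gcongr
            exact hK0 t
        _ = A * ((Real.exp (-(a * t)) + 4 * b / a ^ 2 * damp ν κ k t) * (L ^ m)⁻¹)
            + (Real.exp (-(a * t)) + 4 * b / a ^ 2 * damp ν κ k t) * tail N φ₁ := by ring
        _ ≤ A * ((1 + 4 / ν ^ 2) * kerW ν m κ k t) + (1 + 4 / ν ^ 2) * tail N φ₁ :=
            add_le_add (mul_le_mul_of_nonneg_left (hKl t ht) hA)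
              (mul_le_mul_of_nonneg_right (hKM t ht) hT1)
        _ = _ := by ring
    have h2b : 2 * b / a = 2 / ν * (κ ^ 2 / L ^ 4) := by rw [ha, hb]; field_simp
    have h2b' : 2 * b / a ≤ 2 / ν := by
      calc 2 * b / a ≤ 2 * 1 / ν := by gcongr
        _ = _ := by rw [mul_one]
    have a2 : 2 * b / a * damp ν κ k t * |pairing (φ 0) (packet κ θ N) k|
        ≤ 2 / ν * (A * kerW ν m κ k t) + 2 / ν * tail N φ₀ := by
      calc _ ≤ 2 * b / a * damp ν κ k t * (A * (L ^ (m + 2))⁻¹ + tail N φ₀) := by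
            gcongr
            exact mul_nonneg (by positivity) (hd0 t).le
        _ = 2 / ν * (A * ((L ^ m)⁻¹ * (κ ^ 2 / L ^ 6 * damp ν κ k t)))
            + 2 * b / a * damp ν κ k t * tail N φ₀ := by
            rw [h2b, hpow]; field_simp
        _ ≤ _ := by
            gcongr
            · rw [kerW, ← hL]
              gcongr
              linarith [Real.exp_pos (-(ν * L ^ 2 * t))]
            · exact (mul_le_of_le_one_right (by positivity) (hd1 t ht)).trans h2b'
    have a3 : (1 + 4 / ν ^ 2 + 2 / ν) * (A * kerW ν m κ k t) ≤ C₀ * (A * kerW ν m κ k t) :=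
      mul_le_mul_of_nonneg_right hC2 (mul_nonneg hA hkW0)
    have a4 : (1 + 4 / ν ^ 2) * (A * J) ≤ C₀ * (A * J) :=
      mul_le_mul_of_nonneg_right (by linarith only [hC1, hC2, h4, h5]) (mul_nonneg hA hJ0)
    have a5 : (1 + 4 / ν ^ 2) * tail N φ₁ ≤ C₀ * tail N φ₁ :=
      mul_le_mul_of_nonneg_right (by linarith only [hC1, hC2, h4, h5]) hT1
    have a6 : 2 / ν * tail N φ₀ ≤ C₀ * tail N φ₀ := mul_le_mul_of_nonneg_right (by linarith only [hC1, hC2, h4, h5]) hT0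
    have a7 : (1 + 4 / ν ^ 2) * ((∫ τ in (0 : ℝ)..t, tail N (F τ)) + t * ε)
        ≤ C₀ * ((∫ τ in (0 : ℝ)..t, tail N (F τ)) + t * ε) :=
      mul_le_mul_of_nonneg_right (by linarith only [hC1, hC2, h4, h5]) (add_nonneg hTF (mul_nonneg ht hε0))
    linarith only [O2, I, a1, a2, a3, a4, a5, a6, a7, hErr]

/-! ### ### Vertical Fourier coefficients of test functions -/

/-- The integral of `D(x, ·) w` over `(0, 1)`. -/
def slice (w : ℝ → ℝ) (D : ℝ × ℝ → ℝ) (x : ℝ) : ℝ := ∫ y in (0 : ℝ)..1, D (x, y) * w y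

section slice

variable {D : ℝ × ℝ → ℝ} {w : ℝ → ℝ}

theorem IsTest.hasDerivAt_fst (h : IsTest D) (x y : ℝ) :
    HasDerivAt (fun x => D (x, y)) (Strip.d1 D (x, y)) x :=
  ((h.differentiable (x, y)).hasFDerivAt).comp_hasDerivAt x
    ((hasDerivAt_id x).prodMk (hasDerivAt_const x y))

theorem IsTest.hasDerivAt_snd (h : IsTest D) (x y : ℝ) :
    HasDerivAt (fun y => D (x, y)) (Strip.d2 D (x, y)) y :=
  ((h.differentiable (x, y)).hasFDerivAt).comp_hasDerivAt y
    ((hasDerivAt_const y x).prodMk (hasDerivAt_id y))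

theorem IsTest.continuous_snd (h : IsTest D) (x : ℝ) : Continuous fun y => D (x, y) :=
  h.continuous.comp (by fun_prop)

theorem IsTest.hasDerivAt_slice (h : IsTest D) (hw : Continuous w) (x : ℝ) :
    HasDerivAt (slice w D) (slice w (Strip.d1 D) x) x := by
  obtain ⟨C, hC⟩ := h.d1.exists_bound
  refine (intervalIntegral.hasDerivAt_integral_of_dominated_loc_of_deriv_le
    (F := fun x y => D (x, y) * w y) (F' := fun x y => Strip.d1 D (x, y) * w y)
    (bound := fun y => C * |w y|) (s := univ) univ_mem ?_ ?_ ?_ ?_ ?_ ?_).2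
  · exact Eventually.of_forall fun x => ((h.continuous_snd x).mul hw).aestronglyMeasurable
  · exact ((h.continuous_snd x).mul hw).intervalIntegrable _ _
  · exact ((h.d1.continuous_snd x).mul hw).aestronglyMeasurable
  · refine ae_of_all _ fun y _ x _ => ?_
    rw [Real.norm_eq_abs, abs_mul]
    gcongr
    exact hC _
  · exact (continuous_const.mul hw.abs).intervalIntegrable _ _
  · exact ae_of_all _ fun y _ x _ => (h.hasDerivAt_fst x y).mul_const _

theorem IsTest.deriv_slice (h : IsTest D) (hw : Continuous w) :
    deriv (slice w D) = slice w (Strip.d1 D) :=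
  funext fun x => (h.hasDerivAt_slice hw x).deriv

theorem IsTest.contDiff_slice (h : IsTest D) (hw : Continuous w) :
    ContDiff ℝ ∞ (slice w D) := by
  rw [contDiff_infty]
  intro n
  induction n generalizing D with
  | zero =>
    exact contDiff_zero.2 (continuous_iff_continuousAt.2 fun x =>
      (h.hasDerivAt_slice hw x).continuousAt)
  | succ n ih =>
    push_cast
    rw [contDiff_succ_iff_deriv]
    refine ⟨fun x => (h.hasDerivAt_slice hw x).differentiableAt, by simp, ?_⟩
    rw [h.deriv_slice hw]
    exact ih h.d1

theorem IsTest.hasCompactSupport_slice (h : IsTest D) (w : ℝ → ℝ) :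
    HasCompactSupport (slice w D) := by
  refine HasCompactSupport.intro (h.compact.isCompact.image continuous_fst) fun x hx => ?_
  have : ∀ y, D (x, y) = 0 := fun y => by
    by_contra hy
    exact hx ⟨(x, y), subset_tsupport _ hy, rfl⟩
  simp [slice, this]

theorem IsTest.slice_d2 (h : IsTest D) {w' : ℝ → ℝ} (hw : ∀ y, HasDerivAt w (w' y) y)
    (hw' : Continuous w') (x : ℝ) : slice w (Strip.d2 D) x = -slice w' D x := by
  have := intervalIntegral.integral_mul_deriv_eq_deriv_mul (a := 0) (b := 1)
    (u := w) (u' := w') (v := fun y => D (x, y)) (v' := fun y => Strip.d2 D (x, y))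
    (fun y _ => hw y) (fun y _ => h.hasDerivAt_snd x y) (hw'.intervalIntegrable _ _)
    ((h.d2.continuous_snd x).intervalIntegrable _ _)
  rw [h.eq_zero (z := (x, 1)) (by simp [mem_Ω]), h.eq_zero (z := (x, 0)) (by simp [mem_Ω])] at this
  simp only [slice]
  simp only [mul_zero, sub_zero, zero_sub] at this
  rw [intervalIntegral.integral_congr (fun y _ => mul_comm (Strip.d2 D (x, y)) (w y)), this]
  simp [mul_comm]

theorem slice_const_mul (c : ℝ) (w : ℝ → ℝ) (D : ℝ × ℝ → ℝ) (x : ℝ) :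
    slice (fun y => c * w y) D x = c * slice w D x := by
  rw [slice, slice, ← intervalIntegral.integral_const_mul]
  congr 1
  ext y
  ring

/-- `sin(kπy)` for even `j`, `cos(kπy)` for odd `j`. -/
def trig (k j : ℕ) (y : ℝ) : ℝ := if Even j then sn k y else cs k y

theorem continuous_trig (k j : ℕ) : Continuous (trig k j) := by
  by_cases hj : Even j
  · have e : trig k j = sn k := by ext; simp [trig, hj]
    exact e ▸ (contDiff_sn k).continuous
  · have e : trig k j = cs k := by ext; simp [trig, hj]
    exact e ▸ (contDiff_cs k).continuous

theorem abs_trig_le_one (k j : ℕ) (y : ℝ) : |trig k j y| ≤ 1 := by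
  rw [trig]
  split_ifs
  · exact abs_sn_le_one k y
  · exact abs_cs_le_one k y

theorem exists_hasDerivAt_trig (k j : ℕ) : ∃ c : ℝ, |c| = k * Real.pi ∧
    ∀ y, HasDerivAt (trig k j) (c * trig k (j + 1) y) y := by
  have hk : 0 ≤ (k : ℝ) * Real.pi := by positivity
  by_cases hj : Even j
  · refine ⟨k * Real.pi, abs_of_nonneg hk, fun y => ?_⟩
    have e : trig k j = sn k := by ext; simp [trig, hj]
    have e' : ¬ Even (j + 1) := by simpa [Nat.even_add_one] using hj
    simpa [e, trig, e'] using hasDerivAt_sn k y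
  · refine ⟨-(k * Real.pi), by rw [abs_neg, abs_of_nonneg hk], fun y => ?_⟩
    have e : trig k j = cs k := by ext; simp [trig, hj]
    have e' : Even (j + 1) := by simpa [Nat.even_add_one] using hj
    simpa [e, trig, e'] using hasDerivAt_cs k y

/-- Vertical derivatives are moved onto the sine, which becomes a cosine for odd j. The sign of the
constant is irrelevant, so only its modulus is recorded. -/
theorem IsTest.slice_partials (h : IsTest D) (k j : ℕ) : ∃ c : ℝ, |c| = (k * Real.pi) ^ j ∧
    ∀ x, slice (sn k) (Strip.d2^[j] D) x = c * slice (trig k j) D x := by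
  induction j generalizing D with
  | zero =>
    refine ⟨1, by simp, fun x => ?_⟩
    have : trig k 0 = sn k := by ext; simp [trig]
    simp [this]
  | succ j ih =>
    obtain ⟨c, hc, e⟩ := ih h.d2
    obtain ⟨c', hc', e'⟩ := exists_hasDerivAt_trig k j
    refine ⟨-(c * c'), ?_, fun x => ?_⟩
    · rw [abs_neg, abs_mul, hc, hc', pow_succ]
    · rw [Function.iterate_succ_apply, e,
        h.slice_d2 e' (continuous_const.mul (continuous_trig k (j + 1))), slice_const_mul]
      ring

theorem IsTest.abs_slice_le (h : IsTest D) (hw : Continuous w) (hw1 : ∀ y, |w y| ≤ 1) (x : ℝ) :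
    |slice w D x| ≤ ∫ y in (0 : ℝ)..1, |D (x, y)| := by
  refine (intervalIntegral.abs_integral_le_integral_abs zero_le_one).trans ?_
  refine intervalIntegral.integral_mono_on zero_le_one
    (((h.continuous_snd x).mul hw).abs.intervalIntegrable _ _)
    ((h.continuous_snd x).abs.intervalIntegrable _ _) fun y _ => ?_
  rw [abs_mul]
  exact mul_le_of_le_one_right (abs_nonneg _) (hw1 y)

theorem integral_Ioo_eq_intervalIntegral (g : ℝ → ℝ) :
    ∫ y in Ioo (0 : ℝ) 1, g y = ∫ y in (0 : ℝ)..1, g y := by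
  rw [intervalIntegral.integral_of_le zero_le_one, integral_Ioc_eq_integral_Ioo]

theorem integral_μ_eq {f : ℝ × ℝ → ℝ} (hf : Integrable f μ) :
    ∫ z, f z ∂μ = ∫ x, ∫ y in (0 : ℝ)..1, f (x, y) := by
  rw [μ_eq_prod] at hf ⊢
  rw [integral_prod _ hf]
  simp_rw [integral_Ioo_eq_intervalIntegral]

theorem integrable_integral_of_μ {f : ℝ × ℝ → ℝ} (hf : Integrable f μ) :
    Integrable fun x => ∫ y in (0 : ℝ)..1, f (x, y) := by
  rw [μ_eq_prod] at hf
  simpa only [integral_Ioo_eq_intervalIntegral] using hf.integral_prod_left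

theorem IsTest.integral_abs_slice_le (h : IsTest D) (hw : Continuous w) (hw1 : ∀ y, |w y| ≤ 1) :
    ∫ x, |slice w D x| ≤ ∫ z, |D z| ∂μ := by
  have hi : Integrable (fun z => |D z|) μ := (memLp_one_iff_integrable.1 (h.memLp 1)).abs
  rw [integral_μ_eq hi]
  exact integral_mono ((h.contDiff_slice hw).continuous.integrable_of_hasCompactSupport
    (h.hasCompactSupport_slice w)).abs (integrable_integral_of_μ hi) (h.abs_slice_le hw hw1)

end slice

/-! ### ### Fourier series on (0, 1) through extension by zero -/

section series

variable {h : ℝ → ℝ}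

theorem integral_eq_of_support (hs : ∀ y, y ∉ Ioo (0 : ℝ) 1 → h y = 0) {g : ℝ → ℂ} :
    ∫ y in (-1 : ℝ)..(-1 + 2), g y * h y = ∫ y in (0 : ℝ)..1, g y * h y := by
  have e : (-1 + 2 : ℝ) = 1 := by norm_num
  rw [e, intervalIntegral.integral_of_le (by norm_num), intervalIntegral.integral_of_le zero_le_one]
  refine setIntegral_eq_of_subset_of_forall_sdiff_eq_zero measurableSet_Ioc
    (Ioc_subset_Ioc_left (by norm_num)) fun y hy => ?_
  rw [hs y (fun hy' => hy.2 (Ioo_subset_Ioc_self hy'))]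
  simp

theorem fourierCoeffOn_eq (hc : Continuous h) (hs : ∀ y, y ∉ Ioo (0 : ℝ) 1 → h y = 0) (n : ℤ) :
    fourierCoeffOn (lt_add_of_pos_right (-1 : ℝ) two_pos) (fun y => (h y : ℂ)) n
      = (1 / 2) * (((∫ y in (0 : ℝ)..1, h y * Real.cos (n * Real.pi * y) : ℝ) : ℂ)
        - Complex.I * ((∫ y in (0 : ℝ)..1, h y * Real.sin (n * Real.pi * y) : ℝ) : ℂ)) := by
  rw [fourierCoeffOn_eq_integral]
  simp only [fourier_coe_apply, smul_eq_mul]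
  rw [integral_eq_of_support hs, ← intervalIntegral.integral_ofReal,
    ← intervalIntegral.integral_ofReal, ← intervalIntegral.integral_const_mul,
    ← intervalIntegral.integral_sub]
  · rw [Complex.real_smul]
    congr 1
    · push_cast; norm_num
    refine intervalIntegral.integral_congr fun y _ => ?_
    have e : (2 * Real.pi * Complex.I * ((-n : ℤ) : ℂ) * (y : ℂ) / ((-1 + 2 - -1 : ℝ) : ℂ))
        = ((-(n * Real.pi * y) : ℝ) : ℂ) * Complex.I := by
      push_cast
      ring
    simp only [e]
    rw [Complex.exp_mul_I, ← Complex.ofReal_cos, ← Complex.ofReal_sin, Real.cos_neg, Real.sin_neg]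
    push_cast
    ring
  · exact Continuous.intervalIntegrable (by fun_prop) _ _
  · exact Continuous.intervalIntegrable (by fun_prop) _ _

theorem norm_sq_fourierCoeffOn (hc : Continuous h) (hs : ∀ y, y ∉ Ioo (0 : ℝ) 1 → h y = 0)
    (n : ℤ) : ‖fourierCoeffOn (lt_add_of_pos_right (-1 : ℝ) two_pos) (fun y => (h y : ℂ)) n‖ ^ 2
      = ((∫ y in (0 : ℝ)..1, h y * Real.cos (n * Real.pi * y)) ^ 2
        + (∫ y in (0 : ℝ)..1, h y * Real.sin (n * Real.pi * y)) ^ 2) / 4 := by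
  rw [fourierCoeffOn_eq hc hs, ← Complex.normSq_eq_norm_sq, Complex.normSq_apply]
  simp
  ring

/-- Parseval for the extension by zero to the period (-1, 1). One exponential coefficient contains
both the sine and the cosine coefficient, so the two parities of j are treated at once; discarding
the negative frequencies costs nothing. -/
theorem tsum_sq_slice_le (hc : Continuous h) (hs : ∀ y, y ∉ Ioo (0 : ℝ) 1 → h y = 0) (j : ℕ) :
    ∑' k : ℕ, ENNReal.ofReal ((∫ y in (0 : ℝ)..1, h y * trig k j y) ^ 2)
      ≤ ENNReal.ofReal (2 * ∫ y in (0 : ℝ)..1, h y ^ 2) := by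
  have hcc : Continuous fun y => (h y : ℂ) := by fun_prop
  have key := hasSum_sq_fourierCoeffOn (lt_add_of_pos_right (-1 : ℝ) two_pos)
    (f := fun y => (h y : ℂ))
    ((hcc.memLp_of_hasCompactSupport (HasCompactSupport.intro (isCompact_Icc (a := 0) (b := 1))
      fun y hy => by rw [hs y fun hy' => hy (Ioo_subset_Icc_self hy'), Complex.ofReal_zero])).restrict
      _)
  simp only [norm_sq_fourierCoeffOn hc hs] at key
  have e : ((-1 + 2 - -1 : ℝ))⁻¹ • ∫ x in (-1 : ℝ)..(-1 + 2), ‖(h x : ℂ)‖ ^ 2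
      = (∫ y in (0 : ℝ)..1, h y ^ 2) / 2 := by
    have e1 : (-1 + 2 : ℝ) = 1 := by norm_num
    have e2 : ∫ x in (-1 : ℝ)..1, ‖(h x : ℂ)‖ ^ 2 = ∫ y in (0 : ℝ)..1, h y ^ 2 := by
      simp only [Complex.norm_real, Real.norm_eq_abs, sq_abs]
      rw [intervalIntegral.integral_of_le (by norm_num),
        intervalIntegral.integral_of_le zero_le_one]
      refine setIntegral_eq_of_subset_of_forall_sdiff_eq_zero measurableSet_Ioc
        (Ioc_subset_Ioc_left (by norm_num)) fun y hy => ?_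
      rw [hs y (fun hy' => hy.2 (Ioo_subset_Ioc_self hy'))]
      simp
    rw [e1, e2, smul_eq_mul]
    ring
  rw [e] at key
  have key2 := (key.summable.comp_injective Nat.cast_injective)
  have hle : ∑' k : ℕ, (((∫ y in (0 : ℝ)..1, h y * Real.cos (((k : ℕ) : ℤ) * Real.pi * y)) ^ 2
        + (∫ y in (0 : ℝ)..1, h y * Real.sin (((k : ℕ) : ℤ) * Real.pi * y)) ^ 2) / 4)
      ≤ (∫ y in (0 : ℝ)..1, h y ^ 2) / 2 := by
    rw [← key.tsum_eq]
    exact tsum_comp_le_tsum_of_inj key.summable (fun n => by positivity) Nat.cast_injective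
  have hb : ∀ k : ℕ, (∫ y in (0 : ℝ)..1, h y * trig k j y) ^ 2
      ≤ 4 * (((∫ y in (0 : ℝ)..1, h y * Real.cos (((k : ℕ) : ℤ) * Real.pi * y)) ^ 2
        + (∫ y in (0 : ℝ)..1, h y * Real.sin (((k : ℕ) : ℤ) * Real.pi * y)) ^ 2) / 4) := by
    intro k
    simp only [trig, sn, cs, Int.cast_natCast]
    split_ifs <;> nlinarith [sq_nonneg (∫ y in (0 : ℝ)..1, h y * Real.cos (k * Real.pi * y)),
      sq_nonneg (∫ y in (0 : ℝ)..1, h y * Real.sin (k * Real.pi * y))]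
  calc _ ≤ ∑' k : ℕ, ENNReal.ofReal (4 * (((∫ y in (0 : ℝ)..1,
          h y * Real.cos (((k : ℕ) : ℤ) * Real.pi * y)) ^ 2
        + (∫ y in (0 : ℝ)..1, h y * Real.sin (((k : ℕ) : ℤ) * Real.pi * y)) ^ 2) / 4)) :=
        ENNReal.tsum_le_tsum fun k => ENNReal.ofReal_le_ofReal (hb k)
    _ = ENNReal.ofReal (∑' k : ℕ, 4 * (((∫ y in (0 : ℝ)..1,
          h y * Real.cos (((k : ℕ) : ℤ) * Real.pi * y)) ^ 2
        + (∫ y in (0 : ℝ)..1, h y * Real.sin (((k : ℕ) : ℤ) * Real.pi * y)) ^ 2) / 4)) :=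
        (ENNReal.ofReal_tsum_of_nonneg (fun k => mul_nonneg (by norm_num)
          (div_nonneg (add_nonneg (sq_nonneg _) (sq_nonneg _)) (by norm_num)))
          (key2.mul_left 4)).symm
    _ ≤ _ := by
        rw [tsum_mul_left]
        exact ENNReal.ofReal_le_ofReal (by linarith)

/-- The sine series of a function on `(0, 1)` with quickly decaying coefficients. -/
theorem hasSum_sine_series (hc : Continuous h) (hs : ∀ y, y ∉ Ioo (0 : ℝ) 1 → h y = 0) {B : ℝ}
    (hS : ∀ k : ℕ, |∫ y in (0 : ℝ)..1, h y * sn k y| * (k : ℝ) ^ 2 ≤ B)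
    (hC : ∀ k : ℕ, |∫ y in (0 : ℝ)..1, h y * cs k y| * (k : ℝ) ^ 2 ≤ B) {y : ℝ}
    (hy : y ∈ Ioo (0 : ℝ) 1) :
    HasSum (fun k : ℕ => 2 * ((∫ y in (0 : ℝ)..1, h y * sn k y) * sn k y)) (h y) := by
  have : Fact ((0 : ℝ) < 2) := ⟨two_pos⟩
  have hcc : Continuous fun y => (h y : ℂ) := by fun_prop
  have h1 : h (-1) = 0 := hs _ (by norm_num)
  have h2 : h (-1 + 2) = 0 := hs _ (by norm_num)
  let H : C(AddCircle (2 : ℝ), ℂ) := ⟨AddCircle.liftIco 2 (-1) fun y => (h y : ℂ),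
    AddCircle.liftIco_continuous (by simp [h1, h2]) hcc.continuousOn⟩
  have hco : ∀ n : ℤ, fourierCoeff H n
      = (1 / 2) * (((∫ y in (0 : ℝ)..1, h y * Real.cos (n * Real.pi * y) : ℝ) : ℂ)
        - Complex.I * ((∫ y in (0 : ℝ)..1, h y * Real.sin (n * Real.pi * y) : ℝ) : ℂ)) := by
    intro n
    rw [← fourierCoeffOn_eq hc hs]
    exact fourierCoeff_liftIco_eq _ n
  have hB0 : 0 ≤ B := le_trans (by positivity) (hS 0)
  have hnat : ∀ n : ℤ, |∫ y in (0 : ℝ)..1, h y * Real.cos (n * Real.pi * y)| * (n : ℝ) ^ 2 ≤ B ∧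
      |∫ y in (0 : ℝ)..1, h y * Real.sin (n * Real.pi * y)| * (n : ℝ) ^ 2 ≤ B := by
    intro n
    obtain ⟨k, rfl | rfl⟩ := n.eq_nat_or_neg
    · exact ⟨by simpa [cs] using hC k, by simpa [sn] using hS k⟩
    · exact ⟨by simpa [cs] using hC k, by simpa [sn] using hS k⟩
  -- The cosine coefficients disappear from the final series; their decay is used only for this
  -- absolute convergence.
  have hsum : Summable (fourierCoeff H) := by
    have hs2 : Summable fun n : ℤ => B * (1 / (n : ℝ) ^ 2) :=
      (Real.summable_one_div_int_pow.2 one_lt_two).mul_left B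
    refine .of_norm_bounded_eventually hs2 ?_
    have : ({0} : Set ℤ)ᶜ ∈ cofinite := (finite_singleton _).compl_mem_cofinite
    filter_upwards [this] with n hn
    have hn0 : (n : ℝ) ≠ 0 := by simpa using hn
    have hn2 : 0 < (n : ℝ) ^ 2 := by positivity
    obtain ⟨b1, b2⟩ := hnat n
    rw [mul_one_div, le_div_iff₀ hn2, hco]
    calc _ ≤ (1 / 2 * (|∫ y in (0 : ℝ)..1, h y * Real.cos (n * Real.pi * y)|
            + |∫ y in (0 : ℝ)..1, h y * Real.sin (n * Real.pi * y)|)) * (n : ℝ) ^ 2 := by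
          gcongr
          rw [norm_mul]
          refine mul_le_mul (by norm_num) ((norm_sub_le _ _).trans ?_) (norm_nonneg _) (by norm_num)
          rw [norm_mul, Complex.norm_I, one_mul, Complex.norm_real, Complex.norm_real,
            Real.norm_eq_abs, Real.norm_eq_abs]
      _ ≤ B := by linarith
  -- The extension by zero vanishes at -y. Subtracting the series at -y from the series at y removes
  -- the cosines and doubles the sines, whence the factor 2.
  have p1 := has_pointwise_sum_fourier_series_of_summable hsum ((y : ℝ) : AddCircle (2 : ℝ))
  have p2 := has_pointwise_sum_fourier_series_of_summable hsum ((-y : ℝ) : AddCircle (2 : ℝ))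
  have v : ∀ x ∈ Ico (-1 : ℝ) (-1 + 2), H (x : AddCircle (2 : ℝ)) = (h x : ℂ) := fun x hx =>
    AddCircle.liftIco_coe_apply (p := 2) (a := -1) (f := fun y => (h y : ℂ)) hx
  have v1 : H ((y : ℝ) : AddCircle (2 : ℝ)) = (h y : ℂ) :=
    v y ⟨by linarith [hy.1], by linarith [hy.2]⟩
  have v2 : H ((-y : ℝ) : AddCircle (2 : ℝ)) = (0 : ℂ) := by
    have := v (-y) ⟨by linarith [hy.2], by linarith [hy.1]⟩
    rw [this, hs _ (fun h' => by linarith [h'.1, hy.1])]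
    simp
  rw [v1] at p1
  rw [v2] at p2
  have p3 := (p1.sub p2).nat_add_neg
  rw [← Complex.hasSum_ofReal]
  have hf : ∀ (n : ℤ) (x : ℝ), fourier n ((x : ℝ) : AddCircle (2 : ℝ))
      = ((Real.cos (n * Real.pi * x) : ℝ) : ℂ) + ((Real.sin (n * Real.pi * x) : ℝ) : ℂ)
        * Complex.I := by
    intro n x
    have e : (2 * Real.pi * Complex.I * (n : ℂ) * (x : ℂ) / ((2 : ℝ) : ℂ))
        = ((n * Real.pi * x : ℝ) : ℂ) * Complex.I := by
      push_cast
      ring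
    rw [fourier_coe_apply, e, Complex.exp_mul_I, ← Complex.ofReal_cos, ← Complex.ofReal_sin]
  -- Pairing n with -n counts n = 0 twice. The surplus term is zero because the zeroth mode takes
  -- the same value at y and -y.
  have e0 : (h y : ℂ) = (h y : ℂ) - 0 + (fourierCoeff H 0 • fourier 0 ((y : ℝ) : AddCircle (2 : ℝ))
      - fourierCoeff H 0 • fourier 0 ((-y : ℝ) : AddCircle (2 : ℝ))) := by
    rw [hf, hf]
    simp
  rw [e0]
  refine (congrArg (HasSum · _) (funext fun k => ?_)).mpr p3
  simp only [smul_eq_mul, hco, hf]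
  push_cast [sn]
  have c1 : ∀ a : ℝ, (-(k : ℝ) * Real.pi * a) = -(k * Real.pi * a) := fun a => by ring
  simp only [c1, Real.cos_neg, Real.sin_neg, mul_neg, intervalIntegral.integral_neg]
  push_cast
  ring_nf
  rw [Complex.I_sq, Complex.cos_neg, Complex.sin_neg]
  ring

end series

/-! ### ### Fourier transform of the horizontal profiles -/

/-- The Fourier transform of a real function. -/
def four (S : ℝ → ℝ) : ℝ → ℂ := 𝓕 fun x => (S x : ℂ)

section four

variable {S : ℝ → ℝ}

/-- A smooth function of compact support as a complex valued Schwartz function. -/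
def schwartz (hS : ContDiff ℝ ∞ S) (hc : HasCompactSupport S) : SchwartzMap ℝ ℂ :=
  HasCompactSupport.toSchwartzMap (f := fun x => (S x : ℂ))
    (hc.comp_left (g := fun a : ℝ => (a : ℂ)) Complex.ofReal_zero)
    (Complex.ofRealCLM.contDiff.comp hS)

theorem coe_fourier_schwartz (hS : ContDiff ℝ ∞ S) (hc : HasCompactSupport S) :
    ⇑(𝓕 (schwartz hS hc) : SchwartzMap ℝ ℂ) = four S := by
  rw [SchwartzMap.fourier_coe]
  rfl

theorem continuous_four (hS : ContDiff ℝ ∞ S) (hc : HasCompactSupport S) :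
    Continuous (four S) := by
  rw [← coe_fourier_schwartz hS hc]
  exact SchwartzMap.continuous _

theorem integrable_four (hS : ContDiff ℝ ∞ S) (hc : HasCompactSupport S) :
    Integrable (four S) := by
  rw [← coe_fourier_schwartz hS hc]
  exact SchwartzMap.integrable _

theorem integrable_pow_mul_four (hS : ContDiff ℝ ∞ S) (hc : HasCompactSupport S) (n : ℕ) :
    Integrable fun κ => |κ| ^ n * ‖four S κ‖ := by
  rw [← coe_fourier_schwartz hS hc]
  exact SchwartzMap.integrable_pow_mul volume _ n

theorem eq_integral_four (hS : ContDiff ℝ ∞ S) (hc : HasCompactSupport S) (x : ℝ) :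
    (S x : ℂ) = ∫ κ : ℝ, Complex.exp (2 * Real.pi * κ * x * Complex.I) * four S κ := by
  have hc' : Continuous fun x => (S x : ℂ) := by have := hS.continuous; fun_prop
  have h := congrFun (hc'.fourierInv_fourier_eq
    (hc'.integrable_of_hasCompactSupport
      (hc.comp_left (g := fun a : ℝ => (a : ℂ)) Complex.ofReal_zero))
    (integrable_four hS hc)) x
  rw [← h, Real.fourierInv_eq']
  congr 1
  ext κ
  simp only [smul_eq_mul, RCLike.inner_apply, conj_trivial]
  congr 2
  push_cast
  ring

theorem integral_norm_sq_four (hS : ContDiff ℝ ∞ S) (hc : HasCompactSupport S) :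
    ∫ κ, ‖four S κ‖ ^ 2 = ∫ x, S x ^ 2 := by
  have := SchwartzMap.integral_norm_sq_fourier (schwartz hS hc)
  rw [coe_fourier_schwartz] at this
  rw [this]
  congr 1
  ext x
  change ‖(S x : ℂ)‖ ^ 2 = _
  rw [Complex.norm_real, Real.norm_eq_abs, sq_abs]

theorem norm_four_le (S : ℝ → ℝ) (κ : ℝ) : ‖four S κ‖ ≤ ∫ x, |S x| := by
  rw [four, Real.fourier_eq]
  refine (norm_integral_le_integral_norm _).trans (le_of_eq ?_)
  congr 1
  ext x
  simp

theorem norm_four_deriv (hS : ContDiff ℝ ∞ S) (hc : HasCompactSupport S) (κ : ℝ) :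
    ‖four (deriv S) κ‖ = |2 * Real.pi * κ| * ‖four S κ‖ := by
  have hd : Differentiable ℝ S := hS.differentiable (by simp)
  have hS' : ContDiff ℝ ∞ (deriv S) := contDiff_infty_iff_deriv.1 hS |>.2
  have hi : Integrable (fun x => (S x : ℂ)) volume :=
    (hS.continuous.integrable_of_hasCompactSupport hc).ofReal
  have hi' : Integrable (fun x => ((deriv S x : ℝ) : ℂ)) volume :=
    (hS'.continuous.integrable_of_hasCompactSupport hc.deriv).ofReal
  have e : deriv (fun x => (S x : ℂ)) = fun x => ((deriv S x : ℝ) : ℂ) :=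
    funext fun x => (hd x).hasDerivAt.ofReal_comp.deriv
  have := congrFun (Real.fourier_deriv hi
    (fun x => (hd x).hasDerivAt.ofReal_comp.differentiableAt) (e ▸ hi')) κ
  rw [e] at this
  rw [four, this, norm_smul, four]
  simp [abs_mul]

theorem norm_four_const_mul (c : ℝ) (S : ℝ → ℝ) (κ : ℝ) :
    ‖four (fun x => c * S x) κ‖ = |c| * ‖four S κ‖ := by
  have : (fun x => ((c * S x : ℝ) : ℂ)) = (c : ℂ) • fun x => (S x : ℂ) := by
    ext x
    simp
  rw [four, this, Real.fourier_eq, four, Real.fourier_eq]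
  have e : ∀ v : ℝ, 𝐞 (-inner ℝ v κ) • ((c : ℂ) • fun x => (S x : ℂ)) v
      = (c : ℂ) * (𝐞 (-inner ℝ v κ) • (S v : ℂ)) := fun v => by
    simp only [Pi.smul_apply, Circle.smul_def, smul_eq_mul]
    ring
  simp_rw [e]
  rw [integral_const_mul, norm_mul, Complex.norm_real, Real.norm_eq_abs]

end four

/-! ### ### From packet coefficients to test functions -/

/-- A bound for the wave packet coefficients of `f` bounds its integrals against products. -/
theorem ofReal_abs_integral_mul_prod_le {f : ℝ × ℝ → ℝ} (hf : MemLp f 2 μ) {k : ℕ} {M : ℝ → ℝ}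
    {δ : ℕ → ℝ} (hM : Measurable M) (hδ : Tendsto δ atTop (𝓝 0))
    (hb : ∀ N κ θ, |pairing f (packet κ θ N) k| ≤ M κ + δ N * (1 + |κ|) ^ 2)
    {S : ℝ → ℝ} (hS : ContDiff ℝ ∞ S) (hc : HasCompactSupport S) :
    ENNReal.ofReal |∫ z, f z * (S z.1 * sn k z.2) ∂μ|
      ≤ ∫⁻ κ, ENNReal.ofReal (M (2 * Real.pi * κ)) * ENNReal.ofReal ‖four S κ‖ := by
  -- the bound with the error term
  have main : ∀ᶠ N in atTop, ENNReal.ofReal |∫ z, f z * (S z.1 * sn k z.2) ∂μ|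
      ≤ (∫⁻ κ, ENNReal.ofReal (M (2 * Real.pi * κ)) * ENNReal.ofReal ‖four S κ‖)
        + ENNReal.ofReal (δ N) *
          ∫⁻ κ, ENNReal.ofReal ((1 + |2 * Real.pi * κ|) ^ 2 * ‖four S κ‖) := by
    -- For large N the wide cutoff equals one on the support of S, so it can be inserted; f times
    -- the cutoff is integrable, as Fubini requires.
    obtain ⟨R, hR⟩ := hc.isCompact.isBounded.subset_closedBall 0
    filter_upwards [eventually_ge_atTop ⌈R⌉₊] with N hN
    have hRN : R ≤ N := (Nat.le_ceil R).trans (by exact_mod_cast hN)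
    have hw : ∀ x, S x = wide N x * S x := by
      intro x
      by_cases hx : x ∈ tsupport S
      · have := hR hx
        rw [mem_closedBall_zero_iff, Real.norm_eq_abs] at this
        rw [wide_eq_one (by linarith), one_mul]
      · rw [image_eq_zero_of_notMem_tsupport hx, mul_zero]
    let a : ℝ × ℝ → ℝ := fun z => f z * (wide N z.1 * sn k z.2)
    have ha : Integrable a μ := integrable_mul₂ hf (memLp_mode
      (memLp_of_compact (contDiff_wide N).continuous (hasCompactSupport_wide N) 2) k)
    let P : ℝ → ℂ := fun κ => ∫ z, (a z : ℂ) * Complex.exp (2 * Real.pi * κ * z.1 * Complex.I) ∂μ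
    have hP : ∀ κ, ‖P κ‖ ≤ M (2 * Real.pi * κ) + δ N * (1 + |2 * Real.pi * κ|) ^ 2 := by
      intro κ
      -- The phase θ = -arg P(κ) turns the modulus of the complex coefficient into a real pairing
      -- with a packet, which is why the bounds are kept for all phases.
      refine le_trans ?_ ((le_abs_self _).trans (hb N (2 * Real.pi * κ) (-(P κ).arg)))
      have h1 : ((‖P κ‖ : ℝ) : ℂ) = P κ * Complex.exp (-(P κ).arg * Complex.I) := by
        nth_rewrite 2 [← Complex.norm_mul_exp_arg_mul_I (P κ)]
        rw [mul_assoc, ← Complex.exp_add]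
        simp
      have h2 : ‖P κ‖ = (P κ * Complex.exp (-(P κ).arg * Complex.I)).re := by
        rw [← h1, Complex.ofReal_re]
      rw [h2]
      have hI : Integrable (fun z => (a z : ℂ) * Complex.exp (2 * Real.pi * κ * z.1 * Complex.I)
          * Complex.exp (-(P κ).arg * Complex.I)) μ := by
        refine Integrable.mul_const ?_ _
        refine ha.ofReal.mul_bdd (c := 1) (by fun_prop) (ae_of_all _ fun z => ?_)
        have : (2 * Real.pi * κ * z.1 * Complex.I : ℂ)
            = ((2 * Real.pi * κ * z.1 : ℝ) : ℂ) * Complex.I := by push_cast; ring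
        rw [this, Complex.norm_exp_ofReal_mul_I]
      change ((∫ z, (a z : ℂ) * Complex.exp (2 * Real.pi * κ * z.1 * Complex.I) ∂μ) * _).re ≤ _
      rw [← integral_mul_const]
      have h3 := (integral_re hI).symm
      simp only [RCLike.re_to_complex] at h3
      rw [h3, pairing]
      refine le_of_eq (integral_congr_ae (ae_of_all _ fun z => ?_))
      have e : Complex.exp (2 * Real.pi * κ * z.1 * Complex.I)
            * Complex.exp (-(P κ).arg * Complex.I)
          = Complex.exp (((2 * Real.pi * κ * z.1 + -(P κ).arg : ℝ) : ℂ) * Complex.I) := by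
        rw [← Complex.exp_add]
        congr 1
        push_cast
        ring
      simp only
      rw [mul_assoc, e, Complex.re_ofReal_mul, Complex.exp_ofReal_mul_I_re]
      simp only [a, packet, wave]
      ring
    have hfub : ((∫ z, f z * (S z.1 * sn k z.2) ∂μ : ℝ) : ℂ) = ∫ κ, P κ * four S κ := by
      have e1 : ((∫ z, f z * (S z.1 * sn k z.2) ∂μ : ℝ) : ℂ)
          = ∫ z, (∫ κ : ℝ, (a z : ℂ) * (Complex.exp (2 * Real.pi * κ * z.1 * Complex.I)
            * four S κ)) ∂μ := by
        rw [← integral_complex_ofReal]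
        refine integral_congr_ae (ae_of_all _ fun z => ?_)
        simp only
        rw [integral_const_mul, ← eq_integral_four hS hc]
        simp only [a]
        nth_rewrite 1 [hw z.1]
        push_cast
        ring
      rw [e1, integral_integral_swap]
      · refine integral_congr_ae (ae_of_all _ fun κ => ?_)
        simp only [P]
        rw [← integral_mul_const]
        congr 1
        ext z
        ring
      · have hac : Integrable (fun z => (a z : ℂ)) μ := ha.ofReal
        have := hac.mul_prod (integrable_four hS hc)
        have h2 := this.mul_bdd (c := 1)
          (g := fun p : (ℝ × ℝ) × ℝ => Complex.exp (2 * Real.pi * p.2 * p.1.1 * Complex.I))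
          (by fun_prop) (ae_of_all _ fun p => by
            have : (2 * Real.pi * p.2 * p.1.1 * Complex.I : ℂ)
              = ((2 * Real.pi * p.2 * p.1.1 : ℝ) : ℂ) * Complex.I := by push_cast; ring
            rw [this, Complex.norm_exp_ofReal_mul_I])
        refine h2.congr (ae_of_all _ fun p => ?_)
        simp only [Function.uncurry]
        ring
    have hm : Measurable fun κ => ENNReal.ofReal (M (2 * Real.pi * κ))
        * ENNReal.ofReal ‖four S κ‖ :=
      ((hM.comp (measurable_const_mul _)).ennreal_ofReal).mul
        (continuous_four hS hc).norm.measurable.ennreal_ofReal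
    calc ENNReal.ofReal |∫ z, f z * (S z.1 * sn k z.2) ∂μ|
        = ‖∫ κ, P κ * four S κ‖ₑ := by
          rw [← hfub, ← ofReal_norm, Complex.norm_real, Real.norm_eq_abs]
      _ ≤ ∫⁻ κ, ‖P κ * four S κ‖ₑ := enorm_integral_le_lintegral_enorm _
      _ ≤ ∫⁻ κ, (ENNReal.ofReal (M (2 * Real.pi * κ)) * ENNReal.ofReal ‖four S κ‖
            + ENNReal.ofReal (δ N)
              * ENNReal.ofReal ((1 + |2 * Real.pi * κ|) ^ 2 * ‖four S κ‖)) := by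
          refine lintegral_mono fun κ => ?_
          rw [ENNReal.ofReal_mul (by positivity), ← mul_assoc, ← add_mul,
            ← ENNReal.ofReal_mul' (by positivity), enorm_mul, ← ofReal_norm, ← ofReal_norm]
          gcongr
          exact (ENNReal.ofReal_le_ofReal (hP κ)).trans ENNReal.ofReal_add_le
      _ = _ := by
          rw [lintegral_add_left hm, lintegral_const_mul']
          exact ENNReal.ofReal_ne_top
  have hfin : ∫⁻ κ, ENNReal.ofReal ((1 + |2 * Real.pi * κ|) ^ 2 * ‖four S κ‖) ≠ ⊤ := by
    have hi : Integrable fun κ => (1 + |2 * Real.pi * κ|) ^ 2 * ‖four S κ‖ := by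
      have := ((integrable_pow_mul_four hS hc 0).add
        ((integrable_pow_mul_four hS hc 1).const_mul (4 * Real.pi))).add
        ((integrable_pow_mul_four hS hc 2).const_mul ((2 * Real.pi) ^ 2))
      refine this.congr (ae_of_all _ fun κ => ?_)
      simp only [Pi.add_apply]
      rw [abs_mul, abs_of_pos (by positivity : 0 < 2 * Real.pi)]
      ring
    exact (hi.lintegral_lt_top).ne
  refine ge_of_tendsto (x := atTop) ?_ main
  have l1 : Tendsto (fun N => ENNReal.ofReal (δ N)) atTop (𝓝 0) := by
    simpa using ENNReal.tendsto_ofReal hδ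
  simpa using tendsto_const_nhds.add (ENNReal.Tendsto.mul_const l1 (Or.inr hfin))

theorem trig_zero (k : ℕ) : trig k 0 = sn k := by ext; simp [trig]

theorem trig_one (k : ℕ) : trig k 1 = cs k := by ext; simp [trig]

theorem trig_add_two (k j : ℕ) : trig k (j + 2) = trig k j := by
  ext y
  simp [trig, Nat.even_add]

section modes

variable {D : ℝ × ℝ → ℝ}

/-- Two vertical integrations by parts, without boundary terms as D vanishes at the boundary, give
decay k^(-2), enough for absolute convergence of the sine series. -/
theorem IsTest.exists_slice_bound (h : IsTest D) :
    ∃ B, ∀ j k x, |slice (trig k j) D x| * (k : ℝ) ^ 2 ≤ B := by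
  obtain ⟨B, hB⟩ := h.d2.d2.exists_bound
  refine ⟨B, fun j k x => ?_⟩
  have h1 : |slice (trig k j) (Strip.d2 (Strip.d2 D)) x| ≤ B := by
    refine (h.d2.d2.abs_slice_le (continuous_trig k j) (abs_trig_le_one k j) x).trans ?_
    have := intervalIntegral.integral_mono_on (μ := volume) zero_le_one
      ((h.d2.d2.continuous_snd x).abs.intervalIntegrable 0 1)
      (intervalIntegrable_const (c := B)) fun y _ => hB (x, y)
    simpa using this
  obtain ⟨c, hc, e⟩ := exists_hasDerivAt_trig k j
  obtain ⟨c', hc', e'⟩ := exists_hasDerivAt_trig k (j + 1)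
  rw [h.d2.slice_d2 e (continuous_const.mul (continuous_trig k _)), slice_const_mul,
    h.slice_d2 e' (continuous_const.mul (continuous_trig k _)), slice_const_mul, trig_add_two,
    abs_neg, abs_mul, abs_neg, abs_mul, hc, hc'] at h1
  have hpi : 1 ≤ Real.pi := by linarith [Real.pi_gt_three]
  refine le_trans ?_ h1
  calc |slice (trig k j) D x| * (k : ℝ) ^ 2
      = (k * 1 * (k * 1 * |slice (trig k j) D x|)) := by ring
    _ ≤ _ := by gcongr

theorem IsTest.hasSum_slice (h : IsTest D) {z : ℝ × ℝ} (hz : z ∈ Ω) :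
    HasSum (fun k : ℕ => 2 * (slice (sn k) D z.1 * sn k z.2)) (D z) := by
  obtain ⟨B, hB⟩ := h.exists_slice_bound
  refine hasSum_sine_series (h := fun y => D (z.1, y)) (h.continuous_snd z.1)
    (fun y hy => h.eq_zero fun hy' => hy (mem_Ω.1 hy')) (B := B) (fun k => ?_) (fun k => ?_)
    (mem_Ω.1 hz)
  · simpa only [trig_zero, slice] using hB 0 k z.1
  · simpa only [trig_one, slice] using hB 1 k z.1

/-- All derivatives become multipliers, so that the estimates involve the test function only through
its undifferentiated coefficients. -/
theorem IsTest.norm_four_slice_partials (h : IsTest D) (k i j : ℕ) (κ : ℝ) :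
    ‖four (slice (sn k) (Strip.d1^[i] (Strip.d2^[j] D))) κ‖
      = |2 * Real.pi * κ| ^ i * (k * Real.pi) ^ j * ‖four (slice (trig k j) D) κ‖ := by
  induction i with
  | zero =>
    obtain ⟨c, hc, e⟩ := h.slice_partials k j
    have : slice (sn k) (Strip.d2^[j] D) = fun x => c * slice (trig k j) D x := funext e
    rw [Function.iterate_zero, id, this, norm_four_const_mul, hc]
    ring
  | succ i ih =>
    have ht := h.partials i j
    have hw := (contDiff_sn k).continuous
    rw [Function.iterate_succ_apply', ← ht.deriv_slice hw,
      norm_four_deriv (ht.contDiff_slice hw) (ht.hasCompactSupport_slice _), ih]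
    ring

/-- Expansion of a test function into modes. -/
theorem IsTest.ofReal_abs_integral_mul_le (h : IsTest D) {f : ℝ × ℝ → ℝ} (hf : MemLp f 2 μ) :
    ENNReal.ofReal |∫ z, f z * D z ∂μ| ≤ 2 * ∑' k : ℕ,
      ENNReal.ofReal |∫ z, f z * (slice (sn (k + 1)) D z.1 * sn (k + 1) z.2) ∂μ| := by
  obtain ⟨B, hB⟩ := h.exists_slice_bound
  have hB0 : 0 ≤ B := le_trans (by positivity) (hB 0 0 0)
  obtain ⟨R, hR⟩ := h.compact.isCompact.isBounded.subset_closedBall 0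
  obtain ⟨N, hN⟩ := exists_nat_ge R
  -- As f is only in L² on an unbounded strip, a cutoff is inserted to make the dominating function
  -- integrable.
  have hw : ∀ k x, slice (sn k) D x = wide N x * slice (sn k) D x := by
    intro k x
    by_cases hx : |x| ≤ N + 1
    · rw [wide_eq_one hx, one_mul]
    · have : ∀ y, D (x, y) = 0 := by
        intro y
        by_contra hy
        have := hR (subset_tsupport _ hy)
        rw [mem_closedBall_zero_iff] at this
        have h2 : |x| ≤ ‖(x, y)‖ := norm_fst_le (x, y)
        linarith
      simp [slice, this]
  have hg : Integrable (fun z => f z * wide N z.1) μ :=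
    integrable_mul₂ hf (memLp_fst (memLp_of_compact (contDiff_wide N).continuous
      (hasCompactSupport_wide N) 2))
  let F : ℕ → ℝ × ℝ → ℝ := fun k z => 2 * (f z * (slice (sn k) D z.1 * sn k z.2))
  have hFi : ∀ k, Integrable (F k) μ := fun k => (integrable_mul₂ hf (memLp_mode
    (memLp_of_compact (h.contDiff_slice (contDiff_sn k).continuous).continuous
      (h.hasCompactSupport_slice _) 2) k)).const_mul 2
  have hFb : ∀ k z, ‖F k z‖ ≤ 2 * B * (1 / (k : ℝ) ^ 2) * |f z * wide N z.1| := by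
    intro k z
    rcases Nat.eq_zero_or_pos k with rfl | hk
    · simp [F, sn]
    have hk2 : 0 < (k : ℝ) ^ 2 := by positivity
    have h1 : |slice (sn k) D z.1| ≤ B * (1 / (k : ℝ) ^ 2) := by
      rw [mul_one_div, le_div_iff₀ hk2]
      simpa only [trig_zero] using hB 0 k z.1
    calc ‖F k z‖ = 2 * (|f z * wide N z.1| * (|slice (sn k) D z.1| * |sn k z.2|)) := by
          rw [← abs_mul, ← abs_mul, ← abs_two, ← abs_mul, Real.norm_eq_abs]
          simp only [F]
          congr 2
          nth_rewrite 1 [hw k z.1]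
          ring
      _ ≤ 2 * (|f z * wide N z.1| * (B * (1 / (k : ℝ) ^ 2) * 1)) := by
          gcongr
          exact abs_sn_le_one _ _
      _ = _ := by ring
  have hFs : Summable fun k => ∫ z, ‖F k z‖ ∂μ := by
    refine Summable.of_nonneg_of_le (fun k => integral_nonneg fun z => norm_nonneg _)
      (fun k => ?_) (((Real.summable_one_div_nat_pow.2 one_lt_two).mul_left (2 * B)).mul_right
        (∫ z, |f z * wide N z.1| ∂μ))
    rw [← integral_const_mul]
    exact integral_mono (hFi k).norm (hg.abs.const_mul _) (hFb k)
  have hs := hasSum_integral_of_summable_integral_norm hFi hFs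
  have e : ∫ z, ∑' k, F k z ∂μ = ∫ z, f z * D z ∂μ := by
    refine integral_congr_ae ?_
    filter_upwards [ae_mem_Ω] with z hz
    have := ((h.hasSum_slice hz).mul_left (f z)).tsum_eq
    rw [← this]
    refine tsum_congr fun k => ?_
    simp only [F]
    ring
  rw [e] at hs
  rw [← Real.enorm_eq_ofReal_abs, ← hs.tsum_eq]
  refine enorm_tsum_le_tsum_enorm.trans ?_
  rw [tsum_eq_zero_add' ENNReal.summable, ← ENNReal.tsum_mul_left]
  -- The mode k = 0 is identically zero, so the sums start at k + 1, where L ≥ 1.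
  have z0 : ∫ z, F 0 z ∂μ = 0 := by simp [F, sn]
  rw [z0, enorm_zero, zero_add]
  refine ENNReal.tsum_le_tsum fun k => le_of_eq ?_
  simp only [F]
  rw [integral_const_mul, enorm_mul, Real.enorm_eq_ofReal_abs, Real.enorm_eq_ofReal_abs]
  simp

/-- Plancherel in x for each coefficient, then Parseval in y on each line x = const. -/
theorem IsTest.tsum_lintegral_four_sq_le (h : IsTest D) (j : ℕ) :
    ∑' k : ℕ, ∫⁻ κ, ENNReal.ofReal (‖four (slice (trig k j) D) κ‖ ^ 2)
      ≤ ENNReal.ofReal (2 * ∫ z, D z ^ 2 ∂μ) := by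
  have hsm : ∀ k, ContDiff ℝ ∞ (slice (trig k j) D) := fun k =>
    h.contDiff_slice (continuous_trig k j)
  have hsc : ∀ k, HasCompactSupport (slice (trig k j) D) := fun k => h.hasCompactSupport_slice _
  have e1 : ∀ k, ∫⁻ κ, ENNReal.ofReal (‖four (slice (trig k j) D) κ‖ ^ 2)
      = ∫⁻ x, ENNReal.ofReal (slice (trig k j) D x ^ 2) := by
    intro k
    have hi : Integrable fun κ => ‖four (slice (trig k j) D) κ‖ ^ 2 := by
      have : MemLp (four (slice (trig k j) D)) 2 volume := by
        rw [← coe_fourier_schwartz (hsm k) (hsc k)]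
        exact SchwartzMap.memLp _ 2 volume
      exact this.integrable_norm_pow (by norm_num)
    have hi' : Integrable fun x => slice (trig k j) D x ^ 2 :=
      (memLp_two_iff_integrable_sq (hsm k).continuous.aestronglyMeasurable).1
        (memLp_of_compact (hsm k).continuous (hsc k) 2)
    rw [← ofReal_integral_eq_lintegral_ofReal hi (ae_of_all _ fun _ => by positivity),
      ← ofReal_integral_eq_lintegral_ofReal hi' (ae_of_all _ fun _ => sq_nonneg _),
      integral_norm_sq_four (hsm k) (hsc k)]
  simp_rw [e1]
  have hme : ∀ k, AEMeasurable (fun x => ENNReal.ofReal (slice (trig k j) D x ^ 2)) volume :=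
    fun k => ((hsm k).continuous.pow 2).measurable.ennreal_ofReal.aemeasurable
  rw [← lintegral_tsum hme]
  have hi : Integrable (fun z => D z ^ 2) μ :=
    (memLp_two_iff_integrable_sq (h.memLp 2).1).1 (h.memLp 2)
  rw [integral_μ_eq hi, ← integral_const_mul, ofReal_integral_eq_lintegral_ofReal
    ((integrable_integral_of_μ hi).const_mul 2) (ae_of_all _ fun x =>
      mul_nonneg zero_le_two (intervalIntegral.integral_nonneg zero_le_one fun y _ => sq_nonneg _))]
  exact lintegral_mono fun x => tsum_sq_slice_le (h.continuous_snd x)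
    (fun y hy => h.eq_zero fun hz => hy (mem_Ω.1 hz)) j

/-- Bounds for the wave packet coefficients of `f` bound its derivatives in the sense of
distributions. -/
theorem ofReal_abs_integral_mul_partials_le {f : ℝ × ℝ → ℝ} (hf : MemLp f 2 μ) {M : ℕ → ℝ → ℝ}
    {δ : ℕ → ℝ} (hM : ∀ k, Measurable (M k)) (hδ : Tendsto δ atTop (𝓝 0))
    (hb : ∀ N κ θ k, 1 ≤ k → |pairing f (packet κ θ N) k| ≤ M k κ + δ N * (1 + |κ|) ^ 2)
    (h : IsTest D) (i j : ℕ) :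
    ENNReal.ofReal |∫ z, f z * d1^[i] (d2^[j] D) z ∂μ| ≤ 2 * ∑' k : ℕ,
      ∫⁻ κ, ENNReal.ofReal (M (k + 1) (2 * Real.pi * κ))
        * ENNReal.ofReal (|2 * Real.pi * κ| ^ i * ((k + 1 : ℕ) * Real.pi) ^ j
          * ‖four (slice (trig (k + 1) j) D) κ‖) := by
  refine ((h.partials i j).ofReal_abs_integral_mul_le hf).trans ?_
  gcongr with k
  simp_rw [← h.norm_four_slice_partials]
  exact ofReal_abs_integral_mul_prod_le hf (hM _) hδ
    (fun N κ θ => hb N κ θ (k + 1) (Nat.le_add_left 1 k))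
    ((h.partials i j).contDiff_slice (contDiff_sn _).continuous)
    ((h.partials i j).hasCompactSupport_slice _)

end modes

/-! ### ### Convolution in time and Duhamel's formula -/

theorem bracket_neg_rpow_le {s : ℝ} (hs : 0 ≤ s) {t : ℝ} (ht : 0 ≤ t) :
    bracket t ^ (-s) ≤ 2 ^ s * (1 + ‖t‖) ^ (-s) := by
  have h1 : (1 + ‖t‖) / 2 ≤ bracket t := by
    rw [Real.norm_of_nonneg ht, bracket]
    rcases le_total 1 t with h | h
    · rw [max_eq_right h]; linarith
    · rw [max_eq_left h]; linarith
  calc bracket t ^ (-s) ≤ ((1 + ‖t‖) / 2) ^ (-s) :=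
        Real.rpow_le_rpow_of_nonpos (by positivity) h1 (by linarith)
    _ = _ := by
        rw [Real.div_rpow (by positivity) zero_le_two, Real.rpow_neg zero_le_two, div_inv_eq_mul,
          mul_comm]

/-- Either τ ≤ t/2, and then ⟨t - τ⟩ is comparable to ⟨t⟩; or τ ≥ t/2, and then ⟨τ⟩^(-r) supplies
the decay in t while the remaining power s - r ≥ 0 of ⟨τ⟩ is exchanged for the same power of the
smaller ⟨t - τ⟩. -/
theorem bracket_mul_bracket_le {s r t τ : ℝ} (hr : 0 ≤ r) (hrs : r ≤ s) :
    bracket τ ^ (-s) * bracket (t - τ) ^ (-r)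
      ≤ 2 ^ r * bracket t ^ (-r) * (bracket τ ^ (-s) + bracket (t - τ) ^ (-s)) := by
  have half : ∀ u, t / 2 ≤ u → bracket u ^ (-r) ≤ 2 ^ r * bracket t ^ (-r) := by
    intro u hu
    have h1 : bracket t / 2 ≤ bracket u := by
      simp only [bracket]
      rcases le_total 1 t with h | h
      · rw [max_eq_right h]; exact le_trans hu (le_max_right _ _)
      · rw [max_eq_left h]; exact le_trans (by norm_num) (le_max_left _ _)
    calc bracket u ^ (-r) ≤ (bracket t / 2) ^ (-r) :=
          Real.rpow_le_rpow_of_nonpos (by linarith [bracket_pos t]) h1 (by linarith)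
      _ = _ := by
          rw [Real.div_rpow (bracket_pos t).le zero_le_two, Real.rpow_neg zero_le_two,
            div_inv_eq_mul, mul_comm]
  have p1 : 0 ≤ bracket τ ^ (-s) := Real.rpow_nonneg (bracket_pos _).le _
  have p2 : 0 ≤ bracket (t - τ) ^ (-s) := Real.rpow_nonneg (bracket_pos _).le _
  have p3 : 0 ≤ bracket τ ^ (-r) := Real.rpow_nonneg (bracket_pos _).le _
  have p4 : 0 ≤ bracket (t - τ) ^ (-r) := Real.rpow_nonneg (bracket_pos _).le _
  have p5 : 0 ≤ 2 ^ r * bracket t ^ (-r) :=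
    mul_nonneg (Real.rpow_nonneg zero_le_two _) (Real.rpow_nonneg (bracket_pos _).le _)
  rcases le_total τ (t / 2) with h | h
  · have := half (t - τ) (by linarith)
    nlinarith [mul_nonneg p5 p2, mul_le_mul_of_nonneg_left this p1]
  · have h1 := half τ h
    have hle : bracket (t - τ) ≤ bracket τ := max_le_max le_rfl (by linarith)
    have h2 : bracket τ ^ (-s) * bracket (t - τ) ^ (-r) ≤ bracket τ ^ (-r) * bracket (t - τ) ^ (-s) := by
      have e1 : bracket τ ^ (-s) = bracket τ ^ (-r) * bracket τ ^ (-(s - r)) := by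
        rw [← Real.rpow_add (bracket_pos _)]; congr 1; ring
      have e2 : bracket (t - τ) ^ (-s) = bracket (t - τ) ^ (-r) * bracket (t - τ) ^ (-(s - r)) := by
        rw [← Real.rpow_add (bracket_pos _)]; congr 1; ring
      have h3 : bracket τ ^ (-(s - r)) ≤ bracket (t - τ) ^ (-(s - r)) :=
        Real.rpow_le_rpow_of_nonpos (bracket_pos _) hle (by linarith)
      rw [e1, e2]
      calc _ = bracket τ ^ (-r) * (bracket (t - τ) ^ (-r) * bracket τ ^ (-(s - r))) := by ring
        _ ≤ _ := by gcongr
    nlinarith [mul_nonneg p5 p1, mul_le_mul_of_nonneg_right h1 p2]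

/-- After the pointwise splitting, both terms are integrable because s > 1, and the reflection τ ↦ t
- τ shows that they have the same integral. -/
theorem exists_convolution_bound {s r : ℝ} (hs : 1 < s) (hr : 0 ≤ r) (hrs : r ≤ s) :
    ∃ K : ℝ≥0, ∀ t, 0 ≤ t → ∫⁻ τ in Ioc 0 t, rate τ (-s) * rate (t - τ) (-r)
      ≤ K * rate t (-r) := by
  have hs0 : 0 ≤ s := by linarith
  set J := ∫⁻ τ : ℝ, ENNReal.ofReal (2 ^ s * (1 + ‖τ‖) ^ (-s)) with hJ
  have hJfin : J < ⊤ :=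
    ((integrable_one_add_norm (μ := (volume : Measure ℝ)) (by simpa using hs)).const_mul
      _).lintegral_lt_top
  refine ⟨(ENNReal.ofReal (2 ^ r) * (J + J)).toNNReal, fun t ht => ?_⟩
  rw [ENNReal.coe_toNNReal (ENNReal.mul_ne_top ENNReal.ofReal_ne_top
    (ENNReal.add_ne_top.2 ⟨hJfin.ne, hJfin.ne⟩))]
  have hme : Measurable fun τ : ℝ => ENNReal.ofReal (2 ^ s * (1 + ‖τ‖) ^ (-s)) := by fun_prop
  calc ∫⁻ τ in Ioc 0 t, rate τ (-s) * rate (t - τ) (-r)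
      ≤ ∫⁻ τ in Ioc 0 t, ENNReal.ofReal (2 ^ r) * rate t (-r)
          * (ENNReal.ofReal (2 ^ s * (1 + ‖τ‖) ^ (-s))
            + ENNReal.ofReal (2 ^ s * (1 + ‖t - τ‖) ^ (-s))) := by
        refine setLIntegral_mono' measurableSet_Ioc fun τ hτ => ?_
        simp only [rate]
        rw [← ENNReal.ofReal_mul (Real.rpow_nonneg (bracket_pos _).le _),
          ← ENNReal.ofReal_mul (Real.rpow_nonneg zero_le_two _),
          ← ENNReal.ofReal_add (by positivity) (by positivity), ← ENNReal.ofReal_mul (mul_nonneg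
            (Real.rpow_nonneg zero_le_two _) (Real.rpow_nonneg (bracket_pos _).le _))]
        refine ENNReal.ofReal_le_ofReal ((bracket_mul_bracket_le hr hrs).trans ?_)
        refine mul_le_mul_of_nonneg_left (add_le_add (bracket_neg_rpow_le hs0 hτ.1.le)
          (bracket_neg_rpow_le hs0 (by linarith [hτ.2]))) (mul_nonneg
            (Real.rpow_nonneg zero_le_two _) (Real.rpow_nonneg (bracket_pos _).le _))
    _ ≤ ∫⁻ τ, ENNReal.ofReal (2 ^ r) * rate t (-r)
          * (ENNReal.ofReal (2 ^ s * (1 + ‖τ‖) ^ (-s))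
            + ENNReal.ofReal (2 ^ s * (1 + ‖t - τ‖) ^ (-s))) := setLIntegral_le_lintegral _ _
    _ = ENNReal.ofReal (2 ^ r) * rate t (-r) * (J + J) := by
        have hne : ENNReal.ofReal (2 ^ r) * rate t (-r) ≠ ⊤ :=
          ENNReal.mul_ne_top ENNReal.ofReal_ne_top ENNReal.ofReal_ne_top
        rw [lintegral_const_mul' _ _ hne, lintegral_add_left hme, lintegral_sub_left_eq_self
            (fun τ : ℝ => ENNReal.ofReal (2 ^ s * (1 + ‖τ‖) ^ (-s))) t]
    _ = _ := by ring

/-- The bound for a mode that Duhamel's formula yields from a bound for the propagator. -/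
def duhamelKernel (ker : ℝ → ℝ) (s t : ℝ) : ℝ :=
  ker t + ∫ τ in (0 : ℝ)..t, ker (t - τ) * bracket τ ^ (-s)

theorem ofReal_duhamelKernel {ker : ℝ → ℝ} (hc : Continuous ker) (h0 : ∀ t, 0 ≤ ker t) (s : ℝ)
    {t : ℝ} (ht : 0 ≤ t) : ENNReal.ofReal (duhamelKernel ker s t)
      = ENNReal.ofReal (ker t)
        + ∫⁻ τ in Ioc 0 t, rate τ (-s) * ENNReal.ofReal (ker (t - τ)) := by
  have hn : ∀ τ, 0 ≤ ker (t - τ) * bracket τ ^ (-s) := fun τ =>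
    mul_nonneg (h0 _) (Real.rpow_nonneg (bracket_pos _).le _)
  have hi : IntervalIntegrable (fun τ => ker (t - τ) * bracket τ ^ (-s)) volume 0 t :=
    ((hc.comp (by fun_prop)).mul (continuous_bracket_rpow _)).intervalIntegrable _ _
  rw [duhamelKernel, ENNReal.ofReal_add (h0 t) (intervalIntegral.integral_nonneg ht fun τ _ => hn τ),
    intervalIntegral.integral_of_le ht, ofReal_integral_eq_lintegral_ofReal
      ((intervalIntegrable_iff_integrableOn_Ioc_of_le ht).1 hi) (ae_of_all _ hn)]
  congr 1
  refine lintegral_congr fun τ => ?_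
  rw [mul_comm, ENNReal.ofReal_mul (Real.rpow_nonneg (bracket_pos _).le _), rate]

theorem duhamelKernel_nonneg {ker : ℝ → ℝ} (h0 : ∀ t, 0 ≤ ker t) (s : ℝ) {t : ℝ} (ht : 0 ≤ t) :
    0 ≤ duhamelKernel ker s t :=
  add_nonneg (h0 t) (intervalIntegral.integral_nonneg ht fun _ _ =>
    mul_nonneg (h0 _) (Real.rpow_nonneg (bracket_pos _).le _))

/-- Rewritten with a lower Lebesgue integral, whose measurability in the parameter is part of
Tonelli's theorem. -/
theorem measurable_duhamelKernel {ker : ℝ → ℝ → ℝ} (hm : Measurable fun p : ℝ × ℝ => ker p.1 p.2)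
    (hc : ∀ κ, Continuous (ker κ)) (h0 : ∀ κ t, 0 ≤ ker κ t) (s : ℝ) {t : ℝ} (ht : 0 ≤ t) :
    Measurable fun κ => duhamelKernel (ker κ) s t := by
  have e : (fun κ => duhamelKernel (ker κ) s t) = fun κ => (ENNReal.ofReal (ker κ t)
      + ∫⁻ τ in Ioc 0 t, rate τ (-s) * ENNReal.ofReal (ker κ (t - τ))).toReal := by
    ext κ
    rw [← ofReal_duhamelKernel (hc κ) (h0 κ) s ht,
      ENNReal.toReal_ofReal (duhamelKernel_nonneg (h0 κ) s ht)]
  rw [e]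
  refine Measurable.ennreal_toReal (Measurable.fun_add ?_ ?_)
  · exact (hm.comp (measurable_id.prodMk measurable_const)).ennreal_ofReal
  · refine Measurable.lintegral_prod_right' (f := fun p : ℝ × ℝ =>
      rate p.2 (-s) * ENNReal.ofReal (ker p.1 (t - p.2))) ?_
    exact ((continuous_bracket_rpow (-s)).measurable.comp measurable_snd).ennreal_ofReal.mul
      (hm.comp (measurable_fst.prodMk (measurable_const.sub measurable_snd))).ennreal_ofReal

/-- Decay of the propagator is inherited by Duhamel's formula. -/
theorem tsum_lintegral_duhamelKernel_le {ker : ℕ → ℝ → ℝ → ℝ}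
    (hm : ∀ k, Measurable fun p : ℝ × ℝ => ker k p.1 p.2) (hc : ∀ k κ, Continuous (ker k κ))
    (h0 : ∀ k κ t, 0 ≤ ker k κ t) {G : ℕ → ℝ → ℝ≥0∞} (hG : ∀ k, Measurable (G k)) {X : ℝ≥0∞}
    {s r : ℝ} {K : ℝ≥0}
    (hK : ∀ t, 0 ≤ t → ∫⁻ τ in Ioc 0 t, rate τ (-s) * rate (t - τ) (-r) ≤ K * rate t (-r))
    (hX : ∀ t, 0 ≤ t → ∑' k, ∫⁻ κ, ENNReal.ofReal (ker k κ t) * G k κ ≤ X * rate t (-r))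
    {t : ℝ} (ht : 0 ≤ t) :
    ∑' k, ∫⁻ κ, ENNReal.ofReal (duhamelKernel (ker k κ) s t) * G k κ
      ≤ (1 + K) * X * rate t (-r) := by
  have hrm : Measurable fun τ => rate τ (-s) :=
    (continuous_bracket_rpow (-s)).measurable.ennreal_ofReal
  have hm1 : ∀ k t, Measurable fun κ => ENNReal.ofReal (ker k κ t) := fun k t =>
    ((hm k).comp (measurable_id.prodMk measurable_const)).ennreal_ofReal
  have hm2 : ∀ k, Measurable fun p : ℝ × ℝ =>
      rate p.2 (-s) * ENNReal.ofReal (ker k p.1 (t - p.2)) * G k p.1 := fun k =>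
    ((hrm.comp measurable_snd).mul ((hm k).comp (measurable_fst.prodMk
      (measurable_const.sub measurable_snd))).ennreal_ofReal).mul ((hG k).comp measurable_fst)
  have e : ∀ k, ∫⁻ κ, ENNReal.ofReal (duhamelKernel (ker k κ) s t) * G k κ
      = (∫⁻ κ, ENNReal.ofReal (ker k κ t) * G k κ)
        + ∫⁻ τ in Ioc 0 t, rate τ (-s) * ∫⁻ κ, ENNReal.ofReal (ker k κ (t - τ)) * G k κ := by
    intro k
    simp_rw [ofReal_duhamelKernel (hc k _) (h0 k _) s ht, add_mul]
    have hm0 : Measurable fun κ => ENNReal.ofReal (ker k κ t) * G k κ := (hm1 k t).mul (hG k)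
    rw [lintegral_add_left hm0]
    congr 1
    have e1 : ∀ κ, (∫⁻ τ in Ioc 0 t, rate τ (-s) * ENNReal.ofReal (ker k κ (t - τ))) * G k κ
        = ∫⁻ τ in Ioc 0 t, rate τ (-s) * ENNReal.ofReal (ker k κ (t - τ)) * G k κ := fun κ =>
      (lintegral_mul_const _ (hrm.mul ((hm k).comp (measurable_const.prodMk
        (measurable_const.sub measurable_id))).ennreal_ofReal)).symm
    simp_rw [e1]
    rw [lintegral_lintegral_swap (hm2 k).aemeasurable]
    refine lintegral_congr fun τ => ?_
    have hne : rate τ (-s) ≠ ⊤ := ENNReal.ofReal_ne_top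
    rw [← lintegral_const_mul' _ _ hne]
    simp_rw [mul_assoc]
  simp_rw [e]
  rw [ENNReal.tsum_add]
  have hm3 : ∀ k, Measurable fun τ =>
      rate τ (-s) * ∫⁻ κ, ENNReal.ofReal (ker k κ (t - τ)) * G k κ := by
    intro k
    refine hrm.mul (Measurable.lintegral_prod_right' (f := fun p : ℝ × ℝ =>
      ENNReal.ofReal (ker k p.2 (t - p.1)) * G k p.2) ?_)
    exact (((hm k).comp (measurable_snd.prodMk
      (measurable_const.sub measurable_fst))).ennreal_ofReal).mul ((hG k).comp measurable_snd)
  rw [← lintegral_tsum fun k => (hm3 k).aemeasurable]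
  simp_rw [ENNReal.tsum_mul_left]
  calc _ ≤ X * rate t (-r) + ∫⁻ τ in Ioc 0 t, rate τ (-s) * (X * rate (t - τ) (-r)) := by
        refine add_le_add ?_ ?_
        · exact hX t ht
        · refine setLIntegral_mono' measurableSet_Ioc fun τ hτ => ?_
          gcongr
          exact hX _ (by linarith [hτ.2])
    _ = X * rate t (-r) + X * ∫⁻ τ in Ioc 0 t, rate τ (-s) * rate (t - τ) (-r) := by
        rw [← lintegral_const_mul]
        · congr 1
          refine lintegral_congr fun τ => ?_
          ring
        · exact hrm.mul ((continuous_bracket_rpow (-r)).comp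
            (continuous_const.sub continuous_id)).measurable.ennreal_ofReal
    _ ≤ X * rate t (-r) + X * (K * rate t (-r)) := by
        gcongr
        exact hK t ht
    _ = _ := by ring

/-- Cauchy-Schwarz in L² of the product of counting and Lebesgue measure, jointly in both
frequencies. -/
theorem tsum_lintegral_mul_le {a b : ℕ → ℝ → ℝ≥0∞} (ha : ∀ k, Measurable (a k))
    (hb : ∀ k, Measurable (b k)) : ∑' k, ∫⁻ κ, a k κ * b k κ
      ≤ (∑' k, ∫⁻ κ, a k κ ^ 2) ^ (1 / 2 : ℝ) * (∑' k, ∫⁻ κ, b k κ ^ 2) ^ (1 / 2 : ℝ) := by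
  have hp : ∀ F : ℕ → ℝ → ℝ≥0∞, (∀ k, Measurable (F k)) →
      ∑' k, ∫⁻ κ, F k κ = ∫⁻ p, F p.1 p.2 ∂(Measure.count.prod (volume : Measure ℝ)) := by
    intro F hF
    have hm : Measurable fun p : ℕ × ℝ => F p.1 p.2 := measurable_from_prod_countable_right hF
    rw [lintegral_prod _ hm.aemeasurable, lintegral_count]
  rw [hp (fun k κ => a k κ * b k κ) fun k => (ha k).mul (hb k),
    hp (fun k κ => a k κ ^ 2) fun k => (ha k).pow_const 2,
    hp (fun k κ => b k κ ^ 2) fun k => (hb k).pow_const 2]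
  have hma : Measurable fun p : ℕ × ℝ => a p.1 p.2 := measurable_from_prod_countable_right ha
  have hmb : Measurable fun p : ℕ × ℝ => b p.1 p.2 := measurable_from_prod_countable_right hb
  have := ENNReal.lintegral_mul_le_Lp_mul_Lq (Measure.count.prod (volume : Measure ℝ))
    Real.HolderConjugate.two_two hma.aemeasurable hmb.aemeasurable
  simpa using this

/-! ### ### Decay of the kernels in frequency and time -/

theorem exists_pow_mul_exp_bound {c : ℝ} (hc : 0 < c) (n : ℕ) :
    ∃ C, 0 ≤ C ∧ ∀ x, 0 ≤ x → (2 + x) ^ n * Real.exp (-(c * x)) ≤ C := by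
  refine ⟨n.factorial * Real.exp (2 * c) / c ^ n, by positivity, fun x hx => ?_⟩
  have h := Real.pow_div_factorial_le_exp (c * (2 + x)) (by positivity) n
  rw [div_le_iff₀ (by positivity), mul_pow] at h
  rw [le_div_iff₀ (by positivity)]
  calc (2 + x) ^ n * Real.exp (-(c * x)) * c ^ n
      = (c ^ n * (2 + x) ^ n) * Real.exp (-(c * x)) := by ring
    _ ≤ (Real.exp (c * (2 + x)) * n.factorial) * Real.exp (-(c * x)) := by gcongr
    _ = n.factorial * (Real.exp (c * (2 + x)) * Real.exp (-(c * x))) := by ring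
    _ = _ := by
        rw [← Real.exp_add]
        congr 2
        ring

/-- The profile of decay in frequency and time. -/
def profile (i : ℕ) (t κ : ℝ) : ℝ := (√(bracket t) ^ i * (1 + bracket t * κ ^ 2))⁻¹

theorem profile_pos (i : ℕ) (t κ : ℝ) : 0 < profile i t κ := by
  have := bracket_pos t
  rw [profile]
  positivity

theorem le_profile {i : ℕ} {t κ X C : ℝ}
    (h : X * (√(bracket t) ^ i * (1 + bracket t * κ ^ 2)) ≤ C) : X ≤ C * profile i t κ := by
  have := bracket_pos t
  rw [profile, ← div_eq_mul_inv, le_div_iff₀ (by positivity)]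
  exact h

/-- With T = ⟨t⟩, u = q²/L⁴ and v = |q| √T / L², the damping is exp(-c u t), and u ≤ 1 gives v² = uT
≤ 1 + ut. Hence the weights |q|^i T^(i/2) = v^i L^(2i) and 1 + Tκ² ≤ L⁴(1 + v²) are absorbed by the
exponential at the price of 2i + 4 powers of L. In the application κ is the integration variable of
the Fourier transform and q = 2πκ. -/
theorem exists_damp_bound {ν : ℝ} (hν : 0 < ν) (i : ℕ) : ∃ C, 0 ≤ C ∧ ∀ (k : ℕ) (q κ t : ℝ),
    1 ≤ k → |κ| ≤ |q| → 0 ≤ t →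
      |q| ^ i * damp ν q k t ≤ C * ell q k ^ (2 * i + 4) * profile i t κ := by
  obtain ⟨C, hC0, hC⟩ := exists_pow_mul_exp_bound (div_pos (dec_pos hν) hν) (i + 1)
  refine ⟨C, hC0, fun k q κ t hk hκ ht => le_profile ?_⟩
  set L := ell q k
  set T := bracket t with hT
  have hL : 1 ≤ L := one_le_ell q hk
  have hL0 : 0 < L := by linarith
  have hT1 : 1 ≤ T := one_le_bracket t
  have hTt : T ≤ 1 + t := max_le (by linarith) (by linarith)
  have hqL : |q| ≤ L := abs_le_ell q k
  have hs0 : 0 ≤ √T := Real.sqrt_nonneg _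
  have hsT : √T ^ 2 = T := Real.sq_sqrt (by linarith)
  obtain ⟨u, hu⟩ : ∃ u, u = q ^ 2 / L ^ 4 := ⟨_, rfl⟩
  have hu0 : 0 ≤ u := by rw [hu]; positivity
  have hL4 : L ^ 2 ≤ L ^ 4 := pow_le_pow_right₀ hL (by norm_num)
  have hu1 : u ≤ 1 := by
    rw [hu, div_le_one (by positivity), ← sq_abs]
    exact (pow_le_pow_left₀ (abs_nonneg q) hqL 2).trans hL4
  obtain ⟨v, hv⟩ : ∃ v, v = |q| * √T / L ^ 2 := ⟨_, rfl⟩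
  have hv0 : 0 ≤ v := by rw [hv]; positivity
  have hvu : v ^ 2 = u * T := by
    rw [hv, hu, div_pow, mul_pow, hsT, sq_abs]
    ring
  have hv2 : 1 + v ^ 2 ≤ 2 + u * t := by
    rw [hvu]
    nlinarith [mul_le_mul_of_nonneg_left hTt hu0]
  have hv1 : v ≤ 2 + u * t := by nlinarith [sq_nonneg (v - 1)]
  have hdamp : damp ν q k t = Real.exp (-(dec ν / ν * (u * t))) := by
    rw [damp, hu]
    congr 2
    change dec ν * (q ^ 2 / L ^ 2) / (ν * L ^ 2) * t = _
    field_simp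
  have e1 : |q| ^ i * √T ^ i = v ^ i * L ^ (2 * i) := by
    rw [hv, pow_mul, ← mul_pow, ← mul_pow, div_mul_cancel₀ _ (by positivity)]
  have e2 : 1 + T * κ ^ 2 ≤ L ^ 4 * (2 + u * t) := by
    have hκq : κ ^ 2 ≤ q ^ 2 := sq_le_sq.2 hκ
    have h1 : T * q ^ 2 = L ^ 4 * v ^ 2 := by
      rw [hvu, hu]; field_simp
    have h2 : 1 ≤ L ^ 4 := one_le_pow₀ hL
    calc 1 + T * κ ^ 2 ≤ L ^ 4 + T * q ^ 2 := by gcongr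
      _ = L ^ 4 * (1 + v ^ 2) := by rw [h1]; ring
      _ ≤ _ := by gcongr
  have hut : 0 ≤ u * t := mul_nonneg hu0 ht
  calc |q| ^ i * damp ν q k t * (√T ^ i * (1 + T * κ ^ 2))
      = (|q| ^ i * √T ^ i) * (1 + T * κ ^ 2) * damp ν q k t := by ring
    _ ≤ ((2 + u * t) ^ i * L ^ (2 * i)) * (L ^ 4 * (2 + u * t)) * damp ν q k t := by
        rw [e1]
        have := (damp_pos ν q k t).le
        gcongr
    _ = L ^ (2 * i + 4) * ((2 + u * t) ^ (i + 1) * Real.exp (-(dec ν / ν * (u * t)))) := by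
        rw [hdamp]
        ring
    _ ≤ L ^ (2 * i + 4) * C := by
        gcongr
        exact hC _ hut
    _ = _ := by ring

/-- Rescaling κ by √⟨t⟩ gives the integral of 1/(1 + x²); the Jacobian contributes the additional
half power. -/
theorem integral_profile (i : ℕ) (t : ℝ) : ∫⁻ κ, ENNReal.ofReal (profile i t κ)
    = ENNReal.ofReal Real.pi * rate t (-((i + 1) / 2)) := by
  have hT := bracket_pos t
  have hs : 0 < √(bracket t) := Real.sqrt_pos.2 hT
  have e : ∀ κ, profile i t κ = (√(bracket t) ^ i)⁻¹ * (1 + (√(bracket t) * κ) ^ 2)⁻¹ := by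
    intro κ
    rw [profile, mul_inv, mul_pow, Real.sq_sqrt hT.le]
  have hi : Integrable fun κ => (1 + (√(bracket t) * κ) ^ 2)⁻¹ :=
    integrable_inv_one_add_sq.comp_mul_left' hs.ne'
  rw [← ofReal_integral_eq_lintegral_ofReal ((hi.const_mul _).congr (ae_of_all _ fun κ => (e κ).symm))
    (ae_of_all _ fun κ => (profile_pos i t κ).le)]
  simp_rw [e]
  rw [integral_const_mul, Measure.integral_comp_mul_left (fun x : ℝ => (1 + x ^ 2)⁻¹),
    integral_univ_inv_one_add_sq, abs_of_pos (inv_pos.2 hs), smul_eq_mul, rate,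
    ← ENNReal.ofReal_mul Real.pi_pos.le]
  congr 1
  rw [← mul_assoc, mul_comm, ← mul_inv, ← pow_succ, Real.sqrt_eq_rpow, ← Real.rpow_natCast,
    ← Real.rpow_mul hT.le, ← Real.rpow_neg hT.le]
  congr 2
  push_cast
  ring

theorem exists_tsum_profile_bound {C : ℝ} (hC : 0 ≤ C) (i : ℕ) : ∃ K : ℝ≥0, ∀ t,
    ∑' k : ℕ, ∫⁻ κ, ENNReal.ofReal (C * (1 / ((k + 1 : ℕ) : ℝ) ^ 2) * profile i t κ)
      ≤ K * rate t (-((i + 1) / 2)) := by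
  have hs : Summable fun k : ℕ => C * (1 / ((k + 1 : ℕ) : ℝ) ^ 2) :=
    ((summable_nat_add_iff 1).2 (Real.summable_one_div_nat_pow.2 one_lt_two)).mul_left C
  have hn : ∀ k : ℕ, 0 ≤ C * (1 / ((k + 1 : ℕ) : ℝ) ^ 2) := fun k => by positivity
  refine ⟨(∑' k : ℕ, C * (1 / ((k + 1 : ℕ) : ℝ) ^ 2)).toNNReal * Real.pi.toNNReal, fun t => ?_⟩
  have e : ∀ k : ℕ, ∫⁻ κ, ENNReal.ofReal (C * (1 / ((k + 1 : ℕ) : ℝ) ^ 2) * profile i t κ)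
      = ENNReal.ofReal (C * (1 / ((k + 1 : ℕ) : ℝ) ^ 2))
        * (ENNReal.ofReal Real.pi * rate t (-((i + 1) / 2))) := by
    intro k
    simp_rw [ENNReal.ofReal_mul (hn k)]
    rw [lintegral_const_mul' _ _ ENNReal.ofReal_ne_top, integral_profile]
  simp_rw [e]
  rw [ENNReal.tsum_mul_right, ← ENNReal.ofReal_tsum_of_nonneg hn hs, ENNReal.coe_mul, mul_assoc]
  rfl

/-- Of the m + 2 powers of 1/L, the damping uses 2i + 4, the vertical derivatives use j, and the
last two make the sum over k converge. This fixes the order of regularity m = 2i + j + 4. -/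
theorem exists_kerY_bound {ν : ℝ} (hν : 0 < ν) {i j m : ℕ} (hm : m = 2 * i + j + 4) :
    ∃ C, 0 ≤ C ∧ ∀ (k : ℕ) (q κ t : ℝ), 1 ≤ k → |κ| ≤ |q| → 0 ≤ t →
      kerY ν m q k t * (|q| ^ i * (k * Real.pi) ^ j) ≤ C * (1 / (k : ℝ) ^ 2) * profile i t κ := by
  obtain ⟨C, hC0, hC⟩ := exists_damp_bound hν i
  refine ⟨C, hC0, fun k q κ t hk hκ ht => ?_⟩
  have hL : 1 ≤ ell q k := one_le_ell q hk
  have hL0 : 0 < ell q k := by linarith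
  have hk0 : (0 : ℝ) < k := by exact_mod_cast hk
  have hp := (profile_pos i t κ).le
  have hd := (damp_pos ν q k t).le
  calc kerY ν m q k t * (|q| ^ i * (k * Real.pi) ^ j)
      = (ell q k ^ (m + 2))⁻¹ * (|q| ^ i * damp ν q k t) * (k * Real.pi) ^ j := by
        rw [kerY]; ring
    _ ≤ (ell q k ^ (m + 2))⁻¹ * (C * ell q k ^ (2 * i + 4) * profile i t κ) * ell q k ^ j := by
        gcongr _ * ?_ * ?_ ^ j
        · exact hC k q κ t hk hκ ht
        · exact mul_pi_le_ell q k
    _ = C * (1 / ell q k ^ 2) * profile i t κ := by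
        have : ell q k ^ (m + 2) = ell q k ^ (2 * i + 4) * ell q k ^ j * ell q k ^ 2 := by
          rw [hm, ← pow_add, ← pow_add]; congr 1; ring
        rw [this]
        field_simp
    _ ≤ _ := by
        gcongr
        exact nat_le_ell q k

/-- Of the i horizontal derivatives, e are converted into decay and the others are bounded by powers
of L. One of the two damping factors in the square suffices and costs 4e + 4 powers of L. Together
with the derivatives and the two powers needed for the sum, this stays within the available 16
exactly when e + i + j ≤ 5. -/
theorem exists_kerY_sq_bound {ν : ℝ} (hν : 0 < ν) {e i j : ℕ} (he : e ≤ i) (h : e + i + j ≤ 5) :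
    ∃ C, 0 ≤ C ∧ ∀ (k : ℕ) (q κ t : ℝ), 1 ≤ k → |κ| ≤ |q| → 0 ≤ t →
      (kerY ν 6 q k t * (|q| ^ i * (k * Real.pi) ^ j)) ^ 2
        ≤ C * (1 / (k : ℝ) ^ 2) * profile (2 * e) t κ := by
  obtain ⟨C, hC0, hC⟩ := exists_damp_bound hν (2 * e)
  refine ⟨C, hC0, fun k q κ t hk hκ ht => ?_⟩
  have hL : 1 ≤ ell q k := one_le_ell q hk
  have hL0 : 0 < ell q k := by linarith
  have hk0 : (0 : ℝ) < k := by exact_mod_cast hk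
  have hp := (profile_pos (2 * e) t κ).le
  have hd := (damp_pos ν q k t).le
  have hd1 : damp ν q k t ≤ 1 := damp_le_one hν q k ht
  have hw : |q| ^ i * (k * Real.pi) ^ j ≤ |q| ^ e * ell q k ^ (i - e + j) := by
    calc |q| ^ i * (k * Real.pi) ^ j = |q| ^ e * (|q| ^ (i - e) * (k * Real.pi) ^ j) := by
          rw [← mul_assoc, ← pow_add, Nat.add_sub_cancel' he]
      _ ≤ |q| ^ e * (ell q k ^ (i - e) * ell q k ^ j) := by
          gcongr
          · exact abs_le_ell q k
          · exact mul_pi_le_ell q k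
      _ = _ := by rw [pow_add]
  have hk0' := kerY_nonneg ν 6 q k t
  calc (kerY ν 6 q k t * (|q| ^ i * (k * Real.pi) ^ j)) ^ 2
      ≤ (kerY ν 6 q k t * (|q| ^ e * ell q k ^ (i - e + j))) ^ 2 := by gcongr
    _ = ((ell q k ^ 8)⁻¹ * ell q k ^ (i - e + j)) ^ 2 * (|q| ^ (2 * e) * damp ν q k t)
          * damp ν q k t := by
        rw [kerY]; ring
    _ ≤ ((ell q k ^ 8)⁻¹ * ell q k ^ (i - e + j)) ^ 2
          * (C * ell q k ^ (2 * (2 * e) + 4) * profile (2 * e) t κ) * 1 := by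
        gcongr _ * ?_ * ?_
        exact hC k q κ t hk hκ ht
    _ = C * (ell q k ^ (2 * (i - e + j) + (2 * (2 * e) + 4)) / ell q k ^ 16)
          * profile (2 * e) t κ := by
        rw [pow_add (ell q k) (2 * (i - e + j)), pow_mul' (ell q k) 2 (i - e + j)]
        field_simp
    _ ≤ C * (1 / ell q k ^ 2) * profile (2 * e) t κ := by
        gcongr ?_ * ?_ * ?_
        rw [div_le_div_iff₀ (by positivity) (by positivity), one_mul, ← pow_add]
        exact pow_le_pow_right₀ hL (by omega)
    _ ≤ _ := by
        gcongr
        exact nat_le_ell q k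

/-- The fast part decays exponentially in time because L ≥ 1. The slow part carries q²/L⁶, and its
square provides the factor q⁴ that produces the profile of order 4, hence the rate 5/4, without
using up any derivative. -/
theorem exists_kerW_sq_bound {ν : ℝ} (hν : 0 < ν) {i j : ℕ} (h : i + j ≤ 3) :
    ∃ C, 0 ≤ C ∧ ∀ (k : ℕ) (q κ t : ℝ), 1 ≤ k → |κ| ≤ |q| → 0 ≤ t →
      (kerW ν 6 q k t * (|q| ^ i * (k * Real.pi) ^ j)) ^ 2
        ≤ C * (1 / (k : ℝ) ^ 2) * profile 4 t κ := by
  obtain ⟨C, hC0, hC⟩ := exists_damp_bound hν 4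
  obtain ⟨C', hC0', hC'⟩ := exists_pow_mul_exp_bound hν 3
  refine ⟨2 * C' + 2 * C, by positivity, fun k q κ t hk hκ ht => ?_⟩
  have hL : 1 ≤ ell q k := one_le_ell q hk
  set L := ell q k with hLdef
  have hL0 : 0 < L := by linarith
  have hk0 : (0 : ℝ) < k := by exact_mod_cast hk
  have hp := (profile_pos 4 t κ).le
  have hd := (damp_pos ν q k t).le
  have hd1 : damp ν q k t ≤ 1 := damp_le_one hν q k ht
  have hkL : (k : ℝ) ≤ L := nat_le_ell q k
  have hw : |q| ^ i * (k * Real.pi) ^ j ≤ L ^ 3 := by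
    calc |q| ^ i * (k * Real.pi) ^ j ≤ L ^ i * L ^ j := by
          gcongr
          · exact abs_le_ell q k
          · exact mul_pi_le_ell q k
      _ = L ^ (i + j) := by rw [pow_add]
      _ ≤ _ := pow_le_pow_right₀ hL h
  set E := Real.exp (-(ν * L ^ 2 * t)) with hE
  have hE0 : 0 ≤ E := (Real.exp_pos _).le
  have hE1 : E ≤ 1 := Real.exp_le_one_iff.2 (by
    have : 0 ≤ ν * L ^ 2 * t := by positivity
    linarith)
  have hEt : E ≤ Real.exp (-(ν * t)) := by
    refine Real.exp_le_exp.2 (neg_le_neg ?_)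
    have : 1 ≤ L ^ 2 := one_le_pow₀ hL
    calc ν * t = ν * 1 * t := by ring
      _ ≤ _ := by gcongr
  have hT1 := one_le_bracket t
  have hTt : bracket t ≤ 2 + t := max_le (by linarith) (by linarith)
  -- The factor 1/L² compensates for 1 + Tκ² ≤ T L²; the resulting T³ is absorbed by the
  -- exponential.
  have hexp : E * (1 / L ^ 2) ≤ C' * profile 4 t κ := by
    refine le_profile ?_
    have hsq : √(bracket t) ^ 4 = bracket t ^ 2 := by
      rw [show 4 = 2 * 2 by norm_num, pow_mul, Real.sq_sqrt (by linarith)]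
    have hκL : 1 + κ ^ 2 ≤ L ^ 2 := by
      rw [hLdef, ell_sq]
      have h1 : κ ^ 2 ≤ q ^ 2 := sq_le_sq.2 hκ
      have h2 : (1 : ℝ) ≤ k * Real.pi := by
        have : (1 : ℝ) ≤ k := by exact_mod_cast hk
        nlinarith [Real.pi_gt_three]
      nlinarith
    have h1 : 1 + bracket t * κ ^ 2 ≤ bracket t * L ^ 2 := by nlinarith
    calc E * (1 / L ^ 2) * (√(bracket t) ^ 4 * (1 + bracket t * κ ^ 2))
        ≤ E * (1 / L ^ 2) * (bracket t ^ 2 * (bracket t * L ^ 2)) := by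
          rw [hsq]
          gcongr
      _ = bracket t ^ 3 * E := by field_simp
      _ ≤ (2 + t) ^ 3 * Real.exp (-(ν * t)) := by
          gcongr
      _ ≤ C' := hC' t ht
  have hW0 := kerW_nonneg ν 6 q k t
  calc (kerW ν 6 q k t * (|q| ^ i * (k * Real.pi) ^ j)) ^ 2
      ≤ (kerW ν 6 q k t * L ^ 3) ^ 2 := by gcongr
    _ = (1 / L ^ 6) * (E + q ^ 2 / L ^ 6 * damp ν q k t) ^ 2 := by
        rw [kerW, ← hLdef, ← hE]
        field_simp
    _ ≤ (1 / L ^ 6) * (2 * E ^ 2 + 2 * (q ^ 2 / L ^ 6 * damp ν q k t) ^ 2) := by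
        gcongr
        nlinarith [sq_nonneg (E - q ^ 2 / L ^ 6 * damp ν q k t)]
    _ = 2 * (1 / L ^ 4) * (E * (1 / L ^ 2)) * E
          + 2 * (1 / L ^ 18) * (|q| ^ 4 * damp ν q k t) * damp ν q k t := by
        rw [show |q| ^ 4 = q ^ 4 by rw [show 4 = 2 * 2 by norm_num, pow_mul, sq_abs, ← pow_mul]]
        field_simp
    _ ≤ 2 * (1 / L ^ 2) * (C' * profile 4 t κ) * 1
          + 2 * (1 / L ^ 18) * (C * L ^ (2 * 4 + 4) * profile 4 t κ) * 1 := by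
        gcongr 2 * (1 / L ^ ?_) * ?_ * ?_ + 2 * _ * ?_ * ?_
        · norm_num
        · exact hC k q κ t hk hκ ht
    _ = 2 * C' * (1 / L ^ 2) * profile 4 t κ + 2 * C * (1 / L ^ 6) * profile 4 t κ := by
        field_simp
        ring
    _ ≤ 2 * C' * (1 / L ^ 2) * profile 4 t κ + 2 * C * (1 / L ^ 2) * profile 4 t κ := by
        gcongr
        · norm_num
    _ = (2 * C' + 2 * C) * (1 / L ^ 2) * profile 4 t κ := by ring
    _ ≤ _ := by gcongr

/-! ### ### Dual estimates for kernels -/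

/-- A nonnegative measurable kernel, depending on the two frequencies and continuously on time. -/
structure IsKernel (ker : ℕ → ℝ → ℝ → ℝ) : Prop where
  meas : ∀ k, Measurable fun p : ℝ × ℝ => ker k p.1 p.2
  cont : ∀ k κ, Continuous (ker k κ)
  nonneg : ∀ k κ t, 0 ≤ ker k κ t

theorem isKernel_kerY (ν : ℝ) (m : ℕ) : IsKernel fun k κ t => kerY ν m κ k t where
  meas k := by
    unfold kerY damp ell
    fun_prop
  cont k κ := continuous_kerY ν m κ k
  nonneg k κ t := kerY_nonneg ν m κ k t

theorem isKernel_kerW (ν : ℝ) (m : ℕ) : IsKernel fun k κ t => kerW ν m κ k t where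
  meas k := by
    unfold kerW damp ell
    fun_prop
  cont k κ := continuous_kerW ν m κ k
  nonneg k κ t := kerW_nonneg ν m κ k t

/-- The pairing of coefficients bounded by `M` with the modes of `∂₁^i ∂₂^j η`. -/
def dualSum (M : ℕ → ℝ → ℝ) (i j : ℕ) (η : ℝ × ℝ → ℝ) : ℝ≥0∞ :=
  ∑' k : ℕ, ∫⁻ κ, ENNReal.ofReal (M (k + 1) (2 * Real.pi * κ))
    * ENNReal.ofReal (|2 * Real.pi * κ| ^ i * ((k + 1 : ℕ) * Real.pi) ^ j
      * ‖four (slice (trig (k + 1) j) η) κ‖)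

theorem abs_le_abs_two_pi_mul (κ : ℝ) : |κ| ≤ |2 * Real.pi * κ| := by
  rw [abs_mul, abs_of_pos (by positivity : 0 < 2 * Real.pi)]
  have := Real.pi_gt_three
  nlinarith [abs_nonneg κ]

theorem IsTest.measurable_four_slice {η : ℝ × ℝ → ℝ} (h : IsTest η) (k j : ℕ) :
    Measurable fun κ => ‖four (slice (trig k j) η) κ‖ :=
  (continuous_four (h.contDiff_slice (continuous_trig k j))
    (h.hasCompactSupport_slice _)).norm.measurable

section kernel

variable {ker : ℕ → ℝ → ℝ → ℝ} {i j a : ℕ} {C s r : ℝ}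

theorem IsKernel.measurable_comp (hker : IsKernel ker) (k : ℕ) (t : ℝ) :
    Measurable fun κ => ker k (2 * Real.pi * κ) t :=
  (hker.meas k).comp ((measurable_const_mul (2 * Real.pi)).prodMk measurable_const)

theorem IsKernel.dualSum_duhamelKernel_le (hker : IsKernel ker) {η : ℝ × ℝ → ℝ} (hη : IsTest η)
    {X : ℝ≥0∞} {K : ℝ≥0}
    (hK : ∀ t, 0 ≤ t → ∫⁻ τ in Ioc 0 t, rate τ (-s) * rate (t - τ) (-r) ≤ K * rate t (-r))
    (hX : ∀ t, 0 ≤ t → dualSum (fun k κ => ker k κ t) i j η ≤ X * rate t (-r))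
    {t : ℝ} (ht : 0 ≤ t) : dualSum (fun k κ => duhamelKernel (ker k κ) s t) i j η
      ≤ (1 + K) * X * rate t (-r) :=
  tsum_lintegral_duhamelKernel_le (ker := fun k κ t => ker (k + 1) (2 * Real.pi * κ) t)
    (fun k => (hker.meas (k + 1)).comp
      (((measurable_const_mul (2 * Real.pi)).comp measurable_fst).prodMk measurable_snd))
    (fun k κ => hker.cont _ _) (fun k κ t => hker.nonneg _ _ _)
    (fun k => ((Measurable.mul (by fun_prop) (hη.measurable_four_slice (k + 1) j))).ennreal_ofReal)
    hK hX ht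

/-- The transforms of all slices are bounded pointwise by the L¹ norm of η, so only the kernel has
to be summed and integrated; this is the estimate behind the L^∞ bounds. -/
theorem IsKernel.exists_dualSum_le_integral (hker : IsKernel ker) (hC : 0 ≤ C)
    (hb : ∀ (k : ℕ) (q κ t : ℝ), 1 ≤ k → |κ| ≤ |q| → 0 ≤ t →
      ker k q t * (|q| ^ i * (k * Real.pi) ^ j) ≤ C * (1 / (k : ℝ) ^ 2) * profile a t κ)
    (hs : 1 < s) (hr : r = (a + 1) / 2) (hrs : r ≤ s) :
    ∃ K : ℝ≥0, ∀ t, 0 ≤ t → ∀ η, IsTest η →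
      dualSum (fun k κ => duhamelKernel (ker k κ) s t) i j η
        ≤ K * rate t (-r) * ENNReal.ofReal (∫ z, |η z| ∂μ) := by
  have hr0 : 0 ≤ r := by rw [hr]; positivity
  obtain ⟨K, hK⟩ := exists_convolution_bound hs hr0 hrs
  obtain ⟨K', hK'⟩ := exists_tsum_profile_bound hC a
  refine ⟨(1 + K) * K', fun t ht η hη => ?_⟩
  have hX : ∀ t, 0 ≤ t → dualSum (fun k κ => ker k κ t) i j η
      ≤ (K' * ENNReal.ofReal (∫ z, |η z| ∂μ)) * rate t (-r) := by
    intro t ht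
    calc dualSum (fun k κ => ker k κ t) i j η
        ≤ ∑' k : ℕ, ∫⁻ κ, ENNReal.ofReal (C * (1 / ((k + 1 : ℕ) : ℝ) ^ 2) * profile a t κ)
            * ENNReal.ofReal (∫ z, |η z| ∂μ) := by
          refine ENNReal.tsum_le_tsum fun k => lintegral_mono fun κ => ?_
          have h1 := hb (k + 1) _ κ t (Nat.le_add_left 1 k) (abs_le_abs_two_pi_mul κ) ht
          have h2 : ‖four (slice (trig (k + 1) j) η) κ‖ ≤ ∫ z, |η z| ∂μ :=
            (norm_four_le _ κ).trans
              (hη.integral_abs_slice_le (continuous_trig _ _) (abs_trig_le_one _ _))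
          rw [← ENNReal.ofReal_mul (hker.nonneg _ _ _), ← ENNReal.ofReal_mul (mul_nonneg
            (by positivity) (profile_pos a t κ).le), ← mul_assoc]
          refine ENNReal.ofReal_le_ofReal (mul_le_mul h1 h2 (norm_nonneg _)
            (mul_nonneg (by positivity) (profile_pos a t κ).le))
      _ = (∑' k : ℕ, ∫⁻ κ, ENNReal.ofReal (C * (1 / ((k + 1 : ℕ) : ℝ) ^ 2) * profile a t κ))
            * ENNReal.ofReal (∫ z, |η z| ∂μ) := by
          rw [← ENNReal.tsum_mul_right]
          refine tsum_congr fun k => lintegral_mul_const' _ _ ENNReal.ofReal_ne_top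
      _ ≤ K' * rate t (-((a + 1) / 2)) * ENNReal.ofReal (∫ z, |η z| ∂μ) := by
          gcongr
          exact hK' t
      _ = _ := by rw [hr]; ring
  refine (hker.dualSum_duhamelKernel_le hη hK hX ht).trans (le_of_eq ?_)
  push_cast
  ring

theorem rate_rpow (t x y : ℝ) : rate t x ^ y = rate t (x * y) := by
  have := bracket_pos t
  rw [rate, rate, ENNReal.ofReal_rpow_of_pos (by positivity), Real.rpow_mul this.le]

theorem IsTest.ofReal_two_mul_integral_sq {η : ℝ × ℝ → ℝ} (h : IsTest η) :
    ENNReal.ofReal (2 * ∫ z, η z ^ 2 ∂μ) ^ (1 / 2 : ℝ)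
      = ENNReal.ofReal √2 * eLpNorm η 2 μ := by
  have hi : Integrable (fun z => η z ^ 2) μ :=
    (memLp_two_iff_integrable_sq (h.memLp 2).1).1 (h.memLp 2)
  rw [ENNReal.ofReal_mul zero_le_two, ENNReal.mul_rpow_of_nonneg _ _ (by norm_num),
    Real.sqrt_eq_rpow, ENNReal.ofReal_rpow_of_pos two_pos,
    eLpNorm_eq_lintegral_rpow_enorm_toReal two_ne_zero ENNReal.ofNat_ne_top,
    ofReal_integral_eq_lintegral_ofReal hi (ae_of_all _ fun z => sq_nonneg _)]
  congr 2
  · refine lintegral_congr fun z => ?_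
    rw [Real.enorm_eq_ofReal_abs, ENNReal.toReal_ofNat, ENNReal.rpow_ofNat,
      ← ENNReal.ofReal_pow (abs_nonneg _), sq_abs]
  
/-- By Cauchy-Schwarz the kernel is needed in L² of the frequencies, which halves the exponent (a +
1)/2, while Plancherel and Parseval bring in the L² norm of η. -/
theorem IsKernel.exists_dualSum_le_eLpNorm (hker : IsKernel ker) (hC : 0 ≤ C)
    (hb : ∀ (k : ℕ) (q κ t : ℝ), 1 ≤ k → |κ| ≤ |q| → 0 ≤ t →
      (ker k q t * (|q| ^ i * (k * Real.pi) ^ j)) ^ 2 ≤ C * (1 / (k : ℝ) ^ 2) * profile a t κ)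
    (hs : 1 < s) (hr : r = (a + 1) / 4) (hrs : r ≤ s) :
    ∃ K : ℝ≥0, ∀ t, 0 ≤ t → ∀ η, IsTest η →
      dualSum (fun k κ => duhamelKernel (ker k κ) s t) i j η
        ≤ K * rate t (-r) * eLpNorm η 2 μ := by
  have hr0 : 0 ≤ r := by rw [hr]; positivity
  obtain ⟨K, hK⟩ := exists_convolution_bound hs hr0 hrs
  obtain ⟨K', hK'⟩ := exists_tsum_profile_bound hC a
  refine ⟨(1 + K) * (K' ^ (1 / 2 : ℝ) * (√2).toNNReal), fun t ht η hη => ?_⟩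
  have hX : ∀ t, 0 ≤ t → dualSum (fun k κ => ker k κ t) i j η
      ≤ (((K' : ℝ≥0∞) ^ (1 / 2 : ℝ)) * (ENNReal.ofReal √2 * eLpNorm η 2 μ)) * rate t (-r) := by
    intro t ht
    let A : ℕ → ℝ → ℝ := fun k κ => ker (k + 1) (2 * Real.pi * κ) t
      * (|2 * Real.pi * κ| ^ i * ((k + 1 : ℕ) * Real.pi) ^ j)
    have hA0 : ∀ k κ, 0 ≤ A k κ := fun k κ => mul_nonneg (hker.nonneg _ _ _) (by positivity)
    have hAm : ∀ k, Measurable fun κ => ENNReal.ofReal (A k κ) := fun k =>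
      (Measurable.mul (hker.measurable_comp (k + 1) t) (by fun_prop)).ennreal_ofReal
    calc dualSum (fun k κ => ker k κ t) i j η
        = ∑' k : ℕ, ∫⁻ κ, ENNReal.ofReal (A k κ)
            * ENNReal.ofReal ‖four (slice (trig (k + 1) j) η) κ‖ := by
          refine tsum_congr fun k => lintegral_congr fun κ => ?_
          rw [← ENNReal.ofReal_mul (hker.nonneg _ _ _), ← ENNReal.ofReal_mul (hA0 k κ)]
          congr 1
          simp only [A]
          ring
      _ ≤ (∑' k, ∫⁻ κ, ENNReal.ofReal (A k κ) ^ 2) ^ (1 / 2 : ℝ)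
          * (∑' k : ℕ, ∫⁻ κ, ENNReal.ofReal ‖four (slice (trig (k + 1) j) η) κ‖ ^ 2)
            ^ (1 / 2 : ℝ) :=
          tsum_lintegral_mul_le hAm fun k => (hη.measurable_four_slice (k + 1) j).ennreal_ofReal
      _ ≤ (K' * rate t (-((a + 1) / 2))) ^ (1 / 2 : ℝ)
          * (ENNReal.ofReal (2 * ∫ z, η z ^ 2 ∂μ)) ^ (1 / 2 : ℝ) := by
          gcongr
          · refine le_trans (ENNReal.tsum_le_tsum fun k => lintegral_mono fun κ => ?_) (hK' t)
            rw [← ENNReal.ofReal_pow (hA0 k κ)]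
            exact ENNReal.ofReal_le_ofReal (hb (k + 1) _ κ t (Nat.le_add_left 1 k)
              (abs_le_abs_two_pi_mul κ) ht)
          · refine le_trans ?_ (hη.tsum_lintegral_four_sq_le j)
            rw [tsum_eq_zero_add' (f := fun k : ℕ => ∫⁻ κ,
              ENNReal.ofReal (‖four (slice (trig k j) η) κ‖ ^ 2)) ENNReal.summable]
            refine le_add_left (ENNReal.tsum_le_tsum fun k => lintegral_mono fun κ => ?_)
            rw [← ENNReal.ofReal_pow (norm_nonneg _)]
      _ = _ := by
          rw [hη.ofReal_two_mul_integral_sq, ENNReal.mul_rpow_of_nonneg _ _ (by norm_num),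
            rate_rpow]
          have : -(((a : ℝ) + 1) / 2) * (1 / 2) = -r := by rw [hr]; ring
          rw [this]
          ring
  refine (hker.dualSum_duhamelKernel_le hη hK hX ht).trans (le_of_eq ?_)
  rw [ENNReal.coe_mul, ENNReal.coe_mul, ENNReal.coe_rpow_of_nonneg _ (by norm_num)]
  push_cast
  rw [ENNReal.ofReal]
  ring

/-- Duality: bounds for the wave packet coefficients yield bounds for the distributional
derivatives. -/
theorem IsKernel.ofReal_abs_integral_le (hker : IsKernel ker) {f : ℝ × ℝ → ℝ} (hf : MemLp f 2 μ)
    {A t : ℝ} {δ : ℕ → ℝ} (hA : 0 ≤ A) (ht : 0 ≤ t) (hδ : Tendsto δ atTop (𝓝 0))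
    (hb : ∀ N κ θ k, 1 ≤ k → |pairing f (packet κ θ N) k|
      ≤ A * duhamelKernel (ker k κ) s t + δ N * (1 + |κ|) ^ 2)
    {η : ℝ × ℝ → ℝ} (hη : IsTest η) (i j : ℕ) :
    ENNReal.ofReal |∫ z, f z * d1^[i] (d2^[j] η) z ∂μ| ≤ 2 * (ENNReal.ofReal A
      * dualSum (fun k κ => duhamelKernel (ker k κ) s t) i j η) := by
  refine (ofReal_abs_integral_mul_partials_le hf (M := fun k κ => A * duhamelKernel (ker k κ) s t)
    (fun k => (measurable_duhamelKernel (hker.meas k) (hker.cont k) (hker.nonneg k) s ht).const_mul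
      A) hδ hb hη i j).trans (le_of_eq ?_)
  congr 1
  rw [dualSum, ← ENNReal.tsum_mul_left]
  refine tsum_congr fun k => ?_
  rw [← lintegral_const_mul' _ _ ENNReal.ofReal_ne_top]
  refine lintegral_congr fun κ => ?_
  rw [ENNReal.ofReal_mul hA, mul_assoc]

end kernel

/-! ### ### Uniform estimates for admissible solutions -/

/-- A solution with data as in the theorem. -/
structure IsAdmissible (ν s : ℝ) (φ₀ φ₁ : ℝ × ℝ → ℝ) (F : ℝ → Lp ℝ 1 μ) (φ : ℝ → Lp ℝ 2 μ) :
    Prop where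
  init : MemD 8 1 φ₀
  init_dt : MemD 6 1 φ₁
  meas : AEStronglyMeasurable F (volume.restrict (Ioi 0))
  force : ∀ᵐ t ∂(volume.restrict (Ioi (0 : ℝ))), MemD 6 1 (F t)
  force_lt_top : normF s 6 F < ⊤
  sol : IsSolution ν φ₀ φ₁ F φ

/-- The size of the data. -/
def size (s : ℝ) (m : ℕ) (φ₀ φ₁ : ℝ × ℝ → ℝ) (F : ℝ → Lp ℝ 1 μ) : ℝ≥0∞ :=
  normW (m + 2) 1 φ₀ + normW m 1 φ₁ + normF s m F

theorem ae_rate_mul_normW_le (s : ℝ) (m : ℕ) (F : ℝ → Lp ℝ 1 μ) :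
    ∀ᵐ t ∂(volume.restrict (Ioi (0 : ℝ))), rate t s * normW m 1 (F t) ≤ normF s m F :=
  ENNReal.ae_le_essSup _

theorem toReal_normW_le {s t : ℝ} {m : ℕ} {f : ℝ × ℝ → ℝ} {X : ℝ≥0∞} (hX : X < ⊤)
    (h : rate t s * normW m 1 f ≤ X) : (normW m 1 f).toReal ≤ X.toReal * bracket t ^ (-s) := by
  have hb := bracket_pos t
  have hp : 0 < bracket t ^ s := Real.rpow_pos_of_pos hb s
  have h1 := ENNReal.toReal_mono hX.ne h
  rw [ENNReal.toReal_mul, rate, ENNReal.toReal_ofReal hp.le] at h1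
  rw [Real.rpow_neg hb.le, ← div_eq_mul_inv, le_div_iff₀ hp]
  linarith

theorem coeff_le_of_ell_pow_mul_le {f : ℝ × ℝ → ℝ} {κ θ X A : ℝ} {k m : ℕ} (hk : 1 ≤ k)
    (h : ell κ k ^ m * |coeff f κ θ k| ≤ X) (hX : X ≤ A) :
    |coeff f κ θ k| ≤ A * (ell κ k ^ m)⁻¹ := by
  have hL := one_le_ell κ hk
  rw [← div_eq_mul_inv, le_div_iff₀ (by positivity)]
  linarith

section data

variable {ν s : ℝ} {φ₀ φ₁ : ℝ × ℝ → ℝ} {F : ℝ → Lp ℝ 1 μ} {φ : ℝ → Lp ℝ 2 μ}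

theorem IsAdmissible.isBddCurve (h : IsAdmissible ν s φ₀ φ₁ F φ) (hs : 0 ≤ s) :
    IsBddCurve F (normF s 6 F).toReal where
  meas := h.meas
  bound := by
    filter_upwards [ae_rate_mul_normW_le s 6 F] with t ht
    have h1 : eLpNorm (F t) 1 μ ≤ normF s 6 F := by
      calc eLpNorm (F t) 1 μ ≤ normW 6 1 (F t) := le_self_add
        _ ≤ rate t s * normW 6 1 (F t) := by
            refine le_mul_of_one_le_left' ?_
            rw [rate, ENNReal.one_le_ofReal]
            exact Real.one_le_rpow (one_le_bracket t) hs
        _ ≤ _ := ht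
    rw [Lp.norm_def]
    exact ENNReal.toReal_mono h.force_lt_top.ne h1

/-- The coefficient decay of the data is inserted into the packet bound. The factor 2^(m+2) is that
of φ₀, the datum of highest order, and covers the other two. -/
theorem IsAdmissible.packet_bound (h : IsAdmissible ν s φ₀ φ₁ F φ) (hν : 0 < ν) (hs : 0 ≤ s)
    {m : ℕ} (hm : m ≤ 6) (hA : size s m φ₀ φ₁ F < ⊤) {t : ℝ} (ht : 0 ≤ t) :
    ∃ δ : ℕ → ℝ, Tendsto δ atTop (𝓝 0) ∧ ∀ N κ θ k, 1 ≤ k →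
      |pairing (φ t) (packet κ θ N) k|
        ≤ modeConst ν * (2 ^ (m + 2) * (size s m φ₀ φ₁ F).toReal)
          * duhamelKernel (kerY ν m κ k) s t + δ N * (1 + |κ|) ^ 2 ∧
      |pairing (dt φ t) (packet κ θ N) k|
        ≤ modeConst ν * (2 ^ (m + 2) * (size s m φ₀ φ₁ F).toReal)
          * duhamelKernel (kerW ν m κ k) s t + δ N * (1 + |κ|) ^ 2 := by
  have hle0 : (normW (m + 2) 1 φ₀).toReal ≤ (size s m φ₀ φ₁ F).toReal :=
    ENNReal.toReal_mono hA.ne (le_add_right le_self_add)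
  have hle1 : (normW m 1 φ₁).toReal ≤ (size s m φ₀ φ₁ F).toReal :=
    ENNReal.toReal_mono hA.ne (le_add_right le_add_self)
  have hF : normF s m F ≤ size s m φ₀ φ₁ F := le_add_self
  have hp : (2 : ℝ) ^ m ≤ 2 ^ (m + 2) := pow_le_pow_right₀ one_le_two (by omega)
  refine h.sol.packet_bound hν (h.isBddCurve hs) ht (by positivity)
    (memLp_one_iff_integrable.1 h.init.1.1) (memLp_one_iff_integrable.1 h.init_dt.1.1)
    (fun κ θ k hk => ?_) (fun κ θ k hk => ?_) ?_
  · exact coeff_le_of_ell_pow_mul_le hk (ell_pow_mul_coeff_le h.init (by omega) κ θ k)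
      (by gcongr)
  · exact coeff_le_of_ell_pow_mul_le hk (ell_pow_mul_coeff_le h.init_dt hm κ θ k)
      (by gcongr)
  · filter_upwards [h.force, ae_rate_mul_normW_le s m F] with τ hτ hτ' κ θ k hk
    refine coeff_le_of_ell_pow_mul_le hk (ell_pow_mul_coeff_le hτ hm κ θ k) ?_
    have := toReal_normW_le hA (hτ'.trans hF)
    rw [mul_assoc]
    gcongr

end data

/-- The sum of finitely many constants is a common one. -/
theorem exists_uniform {ι : Type*} (S : Finset ι) {P : ι → ℝ≥0 → Prop}
    (mono : ∀ x K K', K ≤ K' → P x K → P x K') (h : ∀ x ∈ S, ∃ K, P x K) :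
    ∃ K, ∀ x ∈ S, P x K := by
  classical
  choose! K hK using h
  exact ⟨∑ x ∈ S, K x, fun x hx => mono x _ _ (Finset.single_le_sum (fun _ _ => zero_le) hx)
    (hK x hx)⟩

theorem ofReal_modeConst_mul {ν : ℝ} (hν : 0 < ν) {m : ℕ} (hm : m ≤ 6) {X : ℝ≥0∞} (hX : X < ⊤) :
    ENNReal.ofReal (modeConst ν * (2 ^ (m + 2) * X.toReal))
      ≤ (((modeConst ν).toNNReal * 256 : ℝ≥0) : ℝ≥0∞) * X := by
  have hp : (2 : ℝ) ^ (m + 2) ≤ 256 := by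
    calc (2 : ℝ) ^ (m + 2) ≤ 2 ^ 8 := pow_le_pow_right₀ one_le_two (by omega)
      _ = 256 := by norm_num
  calc ENNReal.ofReal (modeConst ν * (2 ^ (m + 2) * X.toReal))
      ≤ ENNReal.ofReal (modeConst ν * (256 * X.toReal)) := by
        have := (modeConst_pos hν).le
        gcongr
    _ = _ := by
        rw [ENNReal.ofReal_mul (modeConst_pos hν).le, ENNReal.ofReal_mul (by norm_num),
          ENNReal.ofReal_toReal hX.ne, ENNReal.coe_mul, ← mul_assoc, ENNReal.ofReal]
        simp

theorem exists_pairing_le_integral {ν s : ℝ} (hν : 0 < ν) (hs : 1 < s) {i j m : ℕ}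
    (hm : m = 2 * i + j + 4) (hm6 : m ≤ 6) {r : ℝ} (hr : r = (i + 1) / 2) (hrs : r ≤ s) :
    ∃ K : ℝ≥0, ∀ φ₀ φ₁ F φ, IsAdmissible ν s φ₀ φ₁ F φ → size s m φ₀ φ₁ F < ⊤ →
      ∀ t, 0 ≤ t → ∀ η, IsTest η → ENNReal.ofReal |∫ z, φ t z * d1^[i] (d2^[j] η) z ∂μ|
        ≤ K * rate t (-r) * size s m φ₀ φ₁ F * ENNReal.ofReal (∫ z, |η z| ∂μ) := by
  obtain ⟨C, hC0, hC⟩ := exists_kerY_bound hν hm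
  obtain ⟨K, hK⟩ := (isKernel_kerY ν m).exists_dualSum_le_integral hC0 hC hs hr hrs
  refine ⟨2 * ((modeConst ν).toNNReal * 256 * K), fun φ₀ φ₁ F φ h hA t ht η hη => ?_⟩
  obtain ⟨δ, hδ, hb⟩ := h.packet_bound hν (by linarith) hm6 hA ht
  have hc : 0 ≤ modeConst ν * (2 ^ (m + 2) * (size s m φ₀ φ₁ F).toReal) :=
    mul_nonneg (modeConst_pos hν).le (by positivity)
  refine ((isKernel_kerY ν m).ofReal_abs_integral_le (Lp.memLp (φ t)) hc ht hδ
    (fun N κ θ k hk => (hb N κ θ k hk).1) hη i j).trans ?_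
  calc _ ≤ 2 * ((((modeConst ν).toNNReal * 256 : ℝ≥0) : ℝ≥0∞) * size s m φ₀ φ₁ F
        * (K * rate t (-r) * ENNReal.ofReal (∫ z, |η z| ∂μ))) := by
        gcongr
        · exact ofReal_modeConst_mul hν hm6 hA
        · exact hK t ht η hη
    _ = _ := by
        push_cast
        ring

/-- Dual boundedness in L² gives both the existence of the weak derivative and its norm, so the
regularity beyond H² results from the decay estimate itself. -/
theorem pairing_le_eLpNorm {ν s : ℝ} (hν : 0 < ν) {ker : ℕ → ℝ → ℝ → ℝ} (hker : IsKernel ker)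
    {i j : ℕ} {r : ℝ} {K : ℝ≥0}
    (hK : ∀ t, 0 ≤ t → ∀ η, IsTest η → dualSum (fun k κ => duhamelKernel (ker k κ) s t) i j η
        ≤ K * rate t (-r) * eLpNorm η 2 μ) {X : ℝ≥0∞} (hX : X < ⊤) {t : ℝ} (ht : 0 ≤ t)
    {f : ℝ × ℝ → ℝ} (hf : MemLp f 2 μ) {δ : ℕ → ℝ} (hδ : Tendsto δ atTop (𝓝 0))
    (hb : ∀ N κ θ k, 1 ≤ k → |pairing f (packet κ θ N) k|
      ≤ modeConst ν * (2 ^ (6 + 2) * X.toReal) * duhamelKernel (ker k κ) s t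
        + δ N * (1 + |κ|) ^ 2) :
    (∃ g, IsWeakDeriv i j f g ∧ MemLp g 2 μ) ∧ eLpNorm (weakDeriv i j f) 2 μ
      ≤ (2 * ((modeConst ν).toNNReal * 256 * K) : ℝ≥0) * rate t (-r) * X := by
  set B := ((2 * ((modeConst ν).toNNReal * 256 * K) : ℝ≥0) : ℝ≥0∞) * rate t (-r) * X with hB
  have hBtop : B ≠ ⊤ := ENNReal.mul_ne_top (ENNReal.mul_ne_top ENNReal.coe_ne_top
    ENNReal.ofReal_ne_top) hX.ne
  have hc : 0 ≤ modeConst ν * (2 ^ (6 + 2) * X.toReal) :=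
    mul_nonneg (modeConst_pos hν).le (by positivity)
  have key : ∀ η, IsTest η → |∫ z, f z * d1^[i] (d2^[j] η) z ∂μ|
      ≤ B.toReal * (eLpNorm η 2 μ).toReal := by
    intro η hη
    have h1 : ENNReal.ofReal |∫ z, f z * d1^[i] (d2^[j] η) z ∂μ| ≤ B * eLpNorm η 2 μ := by
      refine (hker.ofReal_abs_integral_le hf hc ht hδ hb hη i j).trans ?_
      calc _ ≤ 2 * ((((modeConst ν).toNNReal * 256 : ℝ≥0) : ℝ≥0∞) * X
            * (K * rate t (-r) * eLpNorm η 2 μ)) := by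
            gcongr
            · exact ofReal_modeConst_mul hν le_rfl hX
            · exact hK t ht η hη
        _ = _ := by
            rw [hB]
            push_cast
            ring
    have h2 := ENNReal.toReal_mono (ENNReal.mul_ne_top hBtop (hη.memLp 2).2.ne) h1
    rwa [ENNReal.toReal_ofReal (abs_nonneg _), ENNReal.toReal_mul] at h2
  have := weakDeriv_of_forall_test (LocallyIntegrableOn.of_memLp one_le_two hf)
    ENNReal.toReal_nonneg key
  rwa [ENNReal.ofReal_toReal hBtop] at this

/-- The triples of exponents for which the derivative `∂₁^i ∂₂^j φ` decays like
`t^{-(2e+1)/4}`. -/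
def exponents : Finset (ℕ × ℕ × ℕ) :=
  (Finset.range 6 ×ˢ Finset.range 6 ×ˢ Finset.range 6).filter
    fun p => p.1 ≤ p.2.1 ∧ p.1 + p.2.1 + p.2.2 ≤ 5

theorem mem_exponents {e i j : ℕ} (he : e ≤ i) (h : e + i + j ≤ 5) : (e, i, j) ∈ exponents := by
  simp only [exponents, Finset.mem_filter, Finset.mem_product, Finset.mem_range]
  omega

/-- The restriction on s is kept separately for each e, since the convolution preserves only rates
up to s; triples whose rate exceeds s receive the constant 0 and assert nothing. -/
theorem exists_weakDeriv_bound {ν s : ℝ} (hν : 0 < ν) (hs : 1 < s) :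
    ∃ K : ℝ≥0, ∀ φ₀ φ₁ F φ, IsAdmissible ν s φ₀ φ₁ F φ → size s 6 φ₀ φ₁ F < ⊤ → ∀ t, 0 ≤ t →
      ∀ e i j, e ≤ i → e + i + j ≤ 5 → ((2 * e : ℕ) + 1 : ℝ) / 4 ≤ s →
        (∃ g, IsWeakDeriv i j (φ t) g ∧ MemLp g 2 μ) ∧ eLpNorm (weakDeriv i j (φ t)) 2 μ
          ≤ K * rate t (-(((2 * e : ℕ) + 1) / 4)) * size s 6 φ₀ φ₁ F := by
  have H : ∀ p ∈ exponents, ∃ K : ℝ≥0, ((2 * p.1 : ℕ) + 1 : ℝ) / 4 ≤ s → ∀ t, 0 ≤ t →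
      ∀ η, IsTest η → dualSum (fun k κ => duhamelKernel (kerY ν 6 κ k) s t) p.2.1 p.2.2 η
        ≤ K * rate t (-(((2 * p.1 : ℕ) + 1) / 4)) * eLpNorm η 2 μ := by
    rintro ⟨e, i, j⟩ hp
    simp only [exponents, Finset.mem_filter] at hp
    by_cases hes : ((2 * e : ℕ) + 1 : ℝ) / 4 ≤ s
    · obtain ⟨C, hC0, hC⟩ := exists_kerY_sq_bound hν hp.2.1 hp.2.2
      obtain ⟨K, hK⟩ := (isKernel_kerY ν 6).exists_dualSum_le_eLpNorm hC0 hC hs rfl hes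
      exact ⟨K, fun _ => hK⟩
    · exact ⟨0, fun h => absurd h hes⟩
  obtain ⟨K, hK⟩ := exists_uniform exponents (fun p K K' hKK h hes t ht η hη =>
    (h hes t ht η hη).trans (by gcongr)) H
  refine ⟨2 * ((modeConst ν).toNNReal * 256 * K), fun φ₀ φ₁ F φ h hA t ht e i j he hij hes => ?_⟩
  obtain ⟨δ, hδ, hb⟩ := h.packet_bound hν (by linarith) le_rfl hA ht
  exact pairing_le_eLpNorm hν (isKernel_kerY ν 6) (hK _ (mem_exponents he hij) hes) hA ht
    (Lp.memLp (φ t)) hδ (fun N κ θ k hk => (hb N κ θ k hk).1)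

theorem exists_weakDeriv_dt_bound {ν s : ℝ} (hν : 0 < ν) (hs : 5 / 4 ≤ s) :
    ∃ K : ℝ≥0, ∀ φ₀ φ₁ F φ, IsAdmissible ν s φ₀ φ₁ F φ → size s 6 φ₀ φ₁ F < ⊤ → ∀ t, 0 ≤ t →
      ∀ i j, i + j ≤ 3 →
        (∃ g, IsWeakDeriv i j (dt φ t) g ∧ MemLp g 2 μ) ∧ eLpNorm (weakDeriv i j (dt φ t)) 2 μ
          ≤ K * rate t (-(5 / 4)) * size s 6 φ₀ φ₁ F := by
  have hs1 : 1 < s := by linarith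
  have H : ∀ p ∈ (Finset.range 4 ×ˢ Finset.range 4).filter fun p => p.1 + p.2 ≤ 3,
      ∃ K : ℝ≥0, ∀ t, 0 ≤ t → ∀ η, IsTest η →
        dualSum (fun k κ => duhamelKernel (kerW ν 6 κ k) s t) p.1 p.2 η
          ≤ K * rate t (-(5 / 4)) * eLpNorm η 2 μ := by
    rintro ⟨i, j⟩ hp
    simp only [Finset.mem_filter] at hp
    obtain ⟨C, hC0, hC⟩ := exists_kerW_sq_bound hν hp.2
    exact (isKernel_kerW ν 6).exists_dualSum_le_eLpNorm hC0 hC hs1 (by norm_num) hs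
  obtain ⟨K, hK⟩ := exists_uniform _ (fun p K K' hKK h t ht η hη =>
    (h t ht η hη).trans (by gcongr)) H
  refine ⟨2 * ((modeConst ν).toNNReal * 256 * K), fun φ₀ φ₁ F φ h hA t ht i j hij => ?_⟩
  obtain ⟨δ, hδ, hb⟩ := h.packet_bound hν (by linarith) le_rfl hA ht
  refine pairing_le_eLpNorm hν (isKernel_kerW ν 6) (hK (i, j) ?_) hA ht
    (Lp.memLp (dt φ t)) hδ (fun N κ θ k hk => (hb N κ θ k hk).2)
  simp only [Finset.mem_filter, Finset.mem_product, Finset.mem_range]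
  omega

/-- Duality between L¹ and L^∞. Membership of g in L² supplies the local integrability needed for
the mollification; for an infinite B there is nothing to prove. -/
theorem IsWeakDeriv.eLpNorm_top_le {f g : ℝ × ℝ → ℝ} {i j : ℕ} (hg : IsWeakDeriv i j f g)
    (hg2 : MemLp g 2 μ) {B : ℝ≥0∞}
    (h : ∀ η, IsTest η → ENNReal.ofReal |∫ z, f z * d1^[i] (d2^[j] η) z ∂μ|
      ≤ B * ENNReal.ofReal (∫ z, |η z| ∂μ)) : eLpNorm g ⊤ μ ≤ B := by
  rcases eq_or_ne B ⊤ with hB | hB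
  · rw [hB]
    exact le_top
  rw [← ENNReal.ofReal_toReal hB]
  refine eLpNorm_top_le_of_forall_test hg2 fun η hη => ?_
  have h1 := ENNReal.toReal_mono (ENNReal.mul_ne_top hB ENNReal.ofReal_ne_top) (h η hη)
  rw [ENNReal.toReal_ofReal (abs_nonneg _), ENNReal.toReal_mul, hg.integral_eq η hη, abs_mul,
    abs_pow, abs_neg, abs_one, one_pow, one_mul,
    ENNReal.toReal_ofReal (integral_nonneg fun _ => abs_nonneg _)] at h1
  exact h1

theorem normW_le {m : ℕ} {f : ℝ × ℝ → ℝ} {X : ℝ≥0∞} (h0 : eLpNorm f 2 μ ≤ X)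
    (h : ∀ i j, i + j = m → eLpNorm (weakDeriv i j f) 2 μ ≤ X) :
    normW m 2 f ≤ (m + 2 : ℕ) * X := by
  have h1 : ∑ a ∈ Finset.HasAntidiagonal.antidiagonal m, eLpNorm (weakDeriv a.1 a.2 f) 2 μ
      ≤ (m + 1 : ℕ) * X := by
    refine (Finset.sum_le_card_nsmul _ _ X fun a ha =>
      h a.1 a.2 (Finset.HasAntidiagonal.mem_antidiagonal.1 ha)).trans (le_of_eq ?_)
    rw [Finset.Nat.card_antidiagonal, nsmul_eq_mul]
  calc normW m 2 f ≤ X + (m + 1 : ℕ) * X := add_le_add h0 h1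
    _ = _ := by
        push_cast
        ring

/-! ### ### The decay estimates -/

section decay

variable {ν s : ℝ} {φ₀ φ₁ : ℝ × ℝ → ℝ} {F : ℝ → Lp ℝ 1 μ} {φ : ℝ → Lp ℝ 2 μ}

theorem IsAdmissible.size_lt_top (h : IsAdmissible ν s φ₀ φ₁ F φ) : size s 6 φ₀ φ₁ F < ⊤ :=
  ENNReal.add_lt_top.2 ⟨ENNReal.add_lt_top.2 ⟨normW_lt_top h.init.1 le_rfl,
    normW_lt_top h.init_dt.1 le_rfl⟩, h.force_lt_top⟩

theorem isWeakDeriv_zero (f : Lp ℝ 2 μ) : IsWeakDeriv 0 0 f f :=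
  have hf := LocallyIntegrableOn.of_memLp one_le_two (Lp.memLp f)
  ⟨hf, hf, fun η _ => by simp⟩

/-- Finiteness of the size is at hand only at order 6. For an infinite size of lower order the right
side is infinite, provided the constant is nonzero; this avoids interpolation between Sobolev norms.
-/
theorem le_mul_rate_mul_size {x : ℝ≥0∞} {K C : ℝ≥0} (hC : C ≠ 0) (hKC : K ≤ C) {t r : ℝ} {m : ℕ}
    (h : size s m φ₀ φ₁ F < ⊤ → x ≤ K * rate t r * size s m φ₀ φ₁ F) :
    x ≤ C * rate t r * size s m φ₀ φ₁ F := by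
  by_cases hA : size s m φ₀ φ₁ F < ⊤
  · exact (h hA).trans (by gcongr)
  · rw [not_lt_top_iff.1 hA, ENNReal.mul_top]
    · exact le_top
    · have hb := bracket_pos t
      exact mul_ne_zero (ENNReal.coe_ne_zero.2 hC)
        (pos_iff_ne_zero.1 (ENNReal.ofReal_pos.2 (Real.rpow_pos_of_pos hb r)))

/-- The decay of `φ` in `L^∞` and in Sobolev norms. -/
theorem exists_decay (hν : 0 < ν) (hs : 1 < s) :
    ∃ C : ℝ≥0, ∀ φ₀ φ₁ F φ, IsAdmissible ν s φ₀ φ₁ F φ → ∀ t, 0 ≤ t →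
      MemW 4 2 (φ t) ∧
      eLpNorm (φ t) ⊤ μ ≤ C * rate t (-(1 / 2)) * size s 4 φ₀ φ₁ F ∧
      eLpNorm (weakDeriv 0 1 (φ t)) ⊤ μ ≤ C * rate t (-(1 / 2)) * size s 5 φ₀ φ₁ F ∧
      eLpNorm (weakDeriv 1 0 (φ t)) ⊤ μ ≤ C * rate t (-1) * size s 6 φ₀ φ₁ F ∧
      normW 4 2 (φ t) ≤ C * rate t (-(1 / 4)) * size s 6 φ₀ φ₁ F ∧
      normW 2 2 (weakDeriv 1 0 (φ t)) ≤ C * rate t (-(3 / 4)) * size s 6 φ₀ φ₁ F ∧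
      (5 / 4 ≤ s → eLpNorm (weakDeriv 2 0 (φ t)) 2 μ
        ≤ C * rate t (-(5 / 4)) * size s 6 φ₀ φ₁ F) := by
  -- The three L^∞ bounds use (i, j) = (0, 0), (0, 1), (1, 0), for which 2i + j + 4 is 4, 5, 6 and
  -- (i + 1)/2 is 1/2, 1/2, 1.
  obtain ⟨K₁, h₁⟩ := exists_pairing_le_integral hν hs (i := 0) (j := 0) (m := 4) rfl (by norm_num)
    (r := 1 / 2) (by norm_num) (by linarith)
  obtain ⟨K₂, h₂⟩ := exists_pairing_le_integral hν hs (i := 0) (j := 1) (m := 5) rfl (by norm_num)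
    (r := 1 / 2) (by norm_num) (by linarith)
  obtain ⟨K₃, h₃⟩ := exists_pairing_le_integral hν hs (i := 1) (j := 0) (m := 6) rfl (by norm_num)
    (r := 1) (by norm_num) (by linarith)
  obtain ⟨K₄, h₄⟩ := exists_weakDeriv_bound hν hs
  -- The summand 1 keeps the constant nonzero for infinite sizes; 6 counts the terms of the H⁴ norm,
  -- namely the function and its five fourth derivatives.
  refine ⟨1 + K₁ + K₂ + K₃ + 6 * K₄, fun φ₀ φ₁ F φ h t ht => ?_⟩
  set C := 1 + K₁ + K₂ + K₃ + 6 * K₄ with hC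
  have hC0 : C ≠ 0 := by
    rw [hC]
    positivity
  have c1 : K₁ ≤ C := by rw [hC]; exact le_add_right (le_add_right (le_add_right le_add_self))
  have c2 : K₂ ≤ C := by rw [hC]; exact le_add_right (le_add_right le_add_self)
  have c3 : K₃ ≤ C := by rw [hC]; exact le_add_right le_add_self
  have c6 : 6 * K₄ ≤ C := by rw [hC]; exact le_add_self
  have c4 : K₄ ≤ C := le_trans (le_mul_of_one_le_left' (by norm_num)) c6
  have hA := h.size_lt_top
  have H := h₄ φ₀ φ₁ F φ h hA t ht
  have H0 : ∀ i j, i + j ≤ 4 → (∃ g, IsWeakDeriv i j (φ t) g ∧ MemLp g 2 μ) ∧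
      eLpNorm (weakDeriv i j (φ t)) 2 μ ≤ K₄ * rate t (-(1 / 4)) * size s 6 φ₀ φ₁ F := by
    intro i j hij
    have e : (-(1 / 4) : ℝ) = -(((2 * 0 : ℕ) + 1) / 4) := by norm_num
    rw [e]
    exact H 0 i j (Nat.zero_le i) (by omega) (by norm_num; linarith)
  have H1 : ∀ i j, i + j ≤ 2 → (∃ g, IsWeakDeriv (1 + i) j (φ t) g ∧ MemLp g 2 μ) ∧
      eLpNorm (weakDeriv (1 + i) j (φ t)) 2 μ ≤ K₄ * rate t (-(3 / 4)) * size s 6 φ₀ φ₁ F := by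
    intro i j hij
    have e : (-(3 / 4) : ℝ) = -(((2 * 1 : ℕ) + 1) / 4) := by norm_num
    rw [e]
    exact H 1 (1 + i) j (by omega) (by omega) (by norm_num; linarith)
  have hW2 := h.sol.memH2 t ht
  have hd1 := hW2.isWeakDeriv (i := 1) (j := 0) (by norm_num)
  have hd2 := hW2.isWeakDeriv (i := 0) (j := 1) (by norm_num)
  refine ⟨⟨Lp.memLp (φ t), fun i j hij => (H0 i j hij).1⟩, ?_, ?_, ?_, ?_, ?_, ?_⟩
  · exact le_mul_rate_mul_size hC0 c1 fun hA' =>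
      (isWeakDeriv_zero (φ t)).eLpNorm_top_le (Lp.memLp (φ t)) (h₁ φ₀ φ₁ F φ h hA' t ht)
  · exact le_mul_rate_mul_size hC0 c2 fun hA' =>
      hd2.eLpNorm_top_le (hW2.memLp (by norm_num)) (h₂ φ₀ φ₁ F φ h hA' t ht)
  · exact le_mul_rate_mul_size hC0 c3 fun hA' =>
      hd1.eLpNorm_top_le (hW2.memLp (by norm_num)) (h₃ φ₀ φ₁ F φ h hA' t ht)
  · refine le_mul_rate_mul_size hC0 c6 fun _ => ?_
    refine (normW_le (X := K₄ * rate t (-(1 / 4)) * size s 6 φ₀ φ₁ F) ?_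
      fun i j hij => (H0 i j hij.le).2).trans (le_of_eq ?_)
    · rw [← eLpNorm_congr_ae (isWeakDeriv_zero (φ t)).weakDeriv_ae_eq]
      exact (H0 0 0 (by norm_num)).2
    · push_cast
      ring
  · refine le_mul_rate_mul_size hC0 c6 fun _ => ?_
    refine (normW_le (X := K₄ * rate t (-(3 / 4)) * size s 6 φ₀ φ₁ F) (H1 0 0 (by norm_num)).2
      fun i j hij => ?_).trans ?_
    · obtain ⟨⟨g, hg, -⟩, hb⟩ := H1 i j hij.le
      -- The derivatives of ∂₁φ are identified with the derivatives of φ that have one more ∂₁.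
      rw [eLpNorm_congr_ae (hd1.of_comp_d1 hg.weakDeriv).weakDeriv_ae_eq]
      exact hb
    · rw [← mul_assoc, ← mul_assoc]
      push_cast
      gcongr
      norm_num
  · intro hs'
    refine le_mul_rate_mul_size hC0 c4 fun _ => ?_
    have e : (-(5 / 4) : ℝ) = -(((2 * 2 : ℕ) + 1) / 4) := by norm_num
    rw [e]
    exact (H 2 2 0 le_rfl (by norm_num) (by norm_num; linarith)).2

/-- The decay of `∂ₜφ`. -/
theorem exists_decay_dt (hν : 0 < ν) (hs : 5 / 4 ≤ s) :
    ∃ C : ℝ≥0, ∀ φ₀ φ₁ F φ, IsAdmissible ν s φ₀ φ₁ F φ → ∀ t, 0 ≤ t →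
      MemW 3 2 (dt φ t) ∧ normW 3 2 (dt φ t) ≤ C * rate t (-(5 / 4)) * size s 6 φ₀ φ₁ F := by
  obtain ⟨K, hK⟩ := exists_weakDeriv_dt_bound hν hs
  refine ⟨5 * K, fun φ₀ φ₁ F φ h t ht => ?_⟩
  have H := hK φ₀ φ₁ F φ h h.size_lt_top t ht
  refine ⟨⟨Lp.memLp (dt φ t), fun i j hij => (H i j hij).1⟩, ?_⟩
  refine (normW_le (X := K * rate t (-(5 / 4)) * size s 6 φ₀ φ₁ F) ?_
    fun i j hij => (H i j hij.le).2).trans (le_of_eq ?_)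
  · rw [← eLpNorm_congr_ae (isWeakDeriv_zero (dt φ t)).weakDeriv_ae_eq]
    exact (H 0 0 (by norm_num)).2
  · push_cast
    ring

end decay

end Strip

end

open Strip in
theorem lemma3p4 (ν : ℝ) (hν : 0 < ν) (s : ℝ) (hs : 0 < s) :
    ∃ C : ℝ≥0, ∀ (φ₀ φ₁ : ℝ × ℝ → ℝ) (F : ℝ → Lp ℝ 1 μ) (φ : ℝ → Lp ℝ 2 μ),
      MemD 8 1 φ₀ → MemD 6 1 φ₁ →
      AEStronglyMeasurable F (volume.restrict (Ioi 0)) →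
      (∀ᵐ t ∂(volume.restrict (Ioi (0 : ℝ))), MemD 6 1 (F t)) →
      normF s 6 F < ⊤ →
      IsSolution ν φ₀ φ₁ F φ →
      ∀ t : ℝ, 0 < t →
        (1 < s →
          MemW 4 2 (φ t) ∧
          eLpNorm (φ t) ⊤ μ
            ≤ C * rate t (-(1 / 2)) * (normW 6 1 φ₀ + normW 4 1 φ₁ + normF s 4 F) ∧
          eLpNorm (weakDeriv 0 1 (φ t)) ⊤ μ
            ≤ C * rate t (-(1 / 2)) * (normW 7 1 φ₀ + normW 5 1 φ₁ + normF s 5 F) ∧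
          eLpNorm (weakDeriv 1 0 (φ t)) ⊤ μ
            ≤ C * rate t (-1) * (normW 8 1 φ₀ + normW 6 1 φ₁ + normF s 6 F) ∧
          normW 4 2 (φ t)
            ≤ C * rate t (-(1 / 4)) * (normW 8 1 φ₀ + normW 6 1 φ₁ + normF s 6 F) ∧
          normW 2 2 (weakDeriv 1 0 (φ t))
            ≤ C * rate t (-(3 / 4)) * (normW 8 1 φ₀ + normW 6 1 φ₁ + normF s 6 F)) ∧
        (5 / 4 ≤ s →
          eLpNorm (weakDeriv 2 0 (φ t)) 2 μ
            ≤ C * rate t (-(5 / 4)) * (normW 8 1 φ₀ + normW 6 1 φ₁ + normF s 6 F) ∧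
          MemW 3 2 (dt φ t) ∧
          normW 3 2 (dt φ t)
            ≤ C * rate t (-(5 / 4)) * (normW 8 1 φ₀ + normW 6 1 φ₁ + normF s 6 F)) := by
  by_cases hs1 : 1 < s
  · obtain ⟨C₁, h₁⟩ := exists_decay hν hs1
    -- The constant has to exist also for 1 < s < 5/4, where the second group of estimates is void.
    obtain ⟨C₂, h₂⟩ : ∃ C₂ : ℝ≥0, 5 / 4 ≤ s → ∀ φ₀ φ₁ F φ, IsAdmissible ν s φ₀ φ₁ F φ →
        ∀ t, 0 ≤ t → MemW 3 2 (dt φ t) ∧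
          normW 3 2 (dt φ t) ≤ C₂ * rate t (-(5 / 4)) * size s 6 φ₀ φ₁ F := by
      by_cases hs2 : 5 / 4 ≤ s
      · obtain ⟨C₂, h₂⟩ := exists_decay_dt hν hs2
        exact ⟨C₂, fun _ => h₂⟩
      · exact ⟨0, fun h => absurd h hs2⟩
    have enlarge : ∀ {x a b : ℝ≥0∞} {K : ℝ≥0}, K ≤ C₁ + C₂ → x ≤ K * a * b →
        x ≤ (C₁ + C₂ : ℝ≥0) * a * b := fun hK hx => hx.trans (by gcongr)
    have hC₁ : C₁ ≤ C₁ + C₂ := le_self_add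
    have hC₂ : C₂ ≤ C₁ + C₂ := le_add_self
    refine ⟨C₁ + C₂, fun φ₀ φ₁ F φ d0 d1 hm hd hF sol t ht => ?_⟩
    have adm : IsAdmissible ν s φ₀ φ₁ F φ := ⟨d0, d1, hm, hd, hF, sol⟩
    obtain ⟨w, b₁, b₂, b₃, b₄, b₅, b₆⟩ := h₁ φ₀ φ₁ F φ adm t ht.le
    exact ⟨fun _ => ⟨w, enlarge hC₁ b₁, enlarge hC₁ b₂, enlarge hC₁ b₃, enlarge hC₁ b₄,
        enlarge hC₁ b₅⟩,
      fun hs2 => ⟨enlarge hC₁ (b₆ hs2), (h₂ hs2 φ₀ φ₁ F φ adm t ht.le).1,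
        enlarge hC₂ (h₂ hs2 φ₀ φ₁ F φ adm t ht.le).2⟩⟩
  · exact ⟨0, fun _ _ _ _ _ _ _ _ _ _ _ _ =>
      ⟨fun h => absurd h hs1, fun h => absurd (by linarith) hs1⟩⟩
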